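/- Let $\Box=-\partial_t^2+\partial_x^2$ on $\mathbb{R}\times\mathbb{R}$, and set $\underline u=t+x$, $u=t-x$, $L=\partial_t+\partial_x$, $\underline L=\partial_t-\partial_x$. Let $Q:\mathbb{R}\to\mathbb{R}$ be smooth, and let $C>0$ and $\lambda\ge 0$ be constants and $B_1,B_2$ compact intervals containing the origin, such that, with $2B_1=\{2x:x\in B_1\}$, (1) $0\le Q$ on $\mathbb{R}$ (positivity); (2) $0\le -x\,Q'(x)$ on $\mathbb{R}$ (repulsivity); (3) $xQ'(x)+2Q(x)\le -C\,\mathrm{sgn}(x)\,Q'(x)$ for $x\notin B_1$ (strong repulsivity); (4) $xQ'(x)+2Q(x)\le C|x|^{-1}Q(x)$ for $x\notin B_2$ (homogeneity); (5) $(1+\lambda^2)x^2\le -C\,x\,Q'(x)$ for $x\in 2B_1$ (critical point); (6) $C^{-1}\le Q(x)\le C(1+\lambda^2)$ for $x\in 2B_1$ (local bounds). Let $\psi:\mathbb{R}\times\mathbb{R}\to\mathbb{R}$ be of class $C^2$, with $\psi(t,\cdot)$ compactly supported for each fixed $t$, and suppose that $\Box\psi-Q(x)\psi=H$. For $s\in\mathbb{R}$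 put $$\underline E(\psi(s))=\int_{\mathbb{R}\times\{s\}}\Big((1+\underline u^2)(L\psi)^2+(1+u^2)(\underline L\psi)^2+(1+\underline u^2+u^2)\,Q(x)\,\psi^2\Big)\,dx .$$ Then for every $t\ge 0$ $$\underline E(\psi(t))\le K\Big[(1+\lambda^2)\,\underline E(\psi(0))+\int_0^t\big\|(1+|\underline u|+|u|)(1+\lambda)H(s)\big\|_{L^2(dx)}\,\big\|(1+\lambda)\big(|\nabla_{t,x}\psi|+Q^{1/2}|\psi|\big)(s)\big\|_{L^2(dx)}\,ds+\int_0^t\big\|(1+|\underline u|+|u|)H(s)\big\|_{L^2(dx)}\,\underline E(\psi(s))^{1/2}\,ds\Big],$$ where $|\nabla_{t,x}\psi|^2=(\partial_t\psi)^2+(\partial_x\psi)^2$, on the time slice at $s$ one takes $\underline u=s+x$ and $u=s-x$, integrals of nonnegative functions take values in $[0,\infty]$, and the constant $K<\infty$ depends only on $C$ and the lengths of $B_1$ and $B_2$; it does not depend on $t$, $\lambda$, $\psi$, $H$ or any other property of $Q$. -/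

import Mathlib

open MeasureTheory
open scoped ENNReal NNReal Pointwise

noncomputable section

namespace Morawetz

/-- The time derivative `∂ₜψ` of a function `ψ t x` on `(1+1)`-dimensional Minkowski space. -/
def dt (ψ : ℝ → ℝ → ℝ) (t x : ℝ) : ℝ := deriv (fun s => ψ s x) t

/-- The space derivative `∂ₓψ`. -/
def dx (ψ : ℝ → ℝ → ℝ) (t x : ℝ) : ℝ := deriv (fun y => ψ t y) x

/-- The wave operator `□ = -∂ₜ² + ∂ₓ²`. -/
def box (ψ : ℝ → ℝ → ℝ) (t x : ℝ) : ℝ := -dt (dt ψ) t x + dx (dx ψ) t x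

/-- The null derivative `L = ∂ₜ + ∂ₓ`. -/
def L (ψ : ℝ → ℝ → ℝ) (t x : ℝ) : ℝ := dt ψ t x + dx ψ t x

/-- The null derivative `L̲ = ∂ₜ - ∂ₓ`. -/
def Lbar (ψ : ℝ → ℝ → ℝ) (t x : ℝ) : ℝ := dt ψ t x - dx ψ t x

/-- The optical function `u̲ = t + x`. -/
def ubar (t x : ℝ) : ℝ := t + x

/-- The optical function `u = t - x`. -/
def u (t x : ℝ) : ℝ := t - x

/-- The conformal energy of `ψ` on the slice `ℝ × {s}`, as an integral of a nonnegative
function (for `Q ≥ 0`) with values in `[0, ∞]`. -/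
def conformalEnergy (Q : ℝ → ℝ) (ψ : ℝ → ℝ → ℝ) (s : ℝ) : ℝ≥0∞ :=
  ∫⁻ x : ℝ, ENNReal.ofReal
    ((1 + ubar s x ^ 2) * L ψ s x ^ 2 + (1 + u s x ^ 2) * Lbar ψ s x ^ 2
      + (1 + ubar s x ^ 2 + u s x ^ 2) * Q x * ψ s x ^ 2)

/-- The conditions on a positive, strongly repulsive potential `Q`, with constants `C`, `lam` and
sets `B₁`, `B₂` (compact intervals containing the origin in the application). Here `2 • B₁` is
the dilate `{2x : x ∈ B₁}`. -/
structure StronglyRepulsive (Q : ℝ → ℝ) (C lam : ℝ) (B₁ B₂ : Set ℝ) : Prop where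
  positivity : ∀ x, 0 ≤ Q x
  repulsive_one : ∀ x, 0 ≤ -(x * deriv Q x)
  repulsive_two : ∀ x, x ∉ B₁ → x * deriv Q x + 2 * Q x ≤ -(C * Real.sign x * deriv Q x)
  homogeneity : ∀ x, x ∉ B₂ → x * deriv Q x + 2 * Q x ≤ C * |x|⁻¹ * Q x
  critical_point : ∀ x ∈ (2 : ℝ) • B₁, (1 + lam ^ 2) * x ^ 2 ≤ -(C * x * deriv Q x)
  local_bounds : ∀ x ∈ (2 : ℝ) • B₁, C⁻¹ ≤ Q x ∧ Q x ≤ C * (1 + lam ^ 2)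

end Morawetz

end

/-!
Multiplying `□ψ - Qψ = H` by the conformal multiplier `(1 + u̲²) L + (1 + u²) L̲` gives an identity
for the conformal energy with bulk error `4 s (x Q' + 2 Q) ψ²`, which has no favourable sign near the
critical point `x = 0`. Outside the interior of the light cone, where `|x|` is at least of size `s`,
homogeneity makes `s (x Q' + 2 Q)` at most a constant times `Q`. Inside, the error is paid for by a
Morawetz estimate, that is by the derivative of
`s ∫ ∂ₜφ (f ∂ₓφ + f' φ / 2) dx` with `f = x / (1 + ε |x|)` and `φ = cut ψ` the restriction of `ψ` to
the interior of the cone. Its bulk term `f' (∂ₓφ)² - f Q' φ²` is nonnegative by repulsivity, and the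
delta function which the corner of `f'` contributes is absorbed for small `ε`
(`RepulsiveBounds.morawetz_slice`). The bulk term dominates the error: strong repulsivity gives this
where `x²` is at least of size `1 / (1 + λ)`, and at smaller distances from the critical point the
uncertainty principle for a harmonic oscillator does, so that only one factor `1 + λ` is lost
(`RepulsiveBounds.integral_conformal_error_le`). A Hardy inequality (`RepulsiveBounds.hardy`)
handles the zeroth order terms produced by the cutoff.

What remains is a multiple of `(1 + λ) (∫ e ds + t e(t))`, with `e(s)` the standard energy in the
interior of the cone at time `s` (`exists_coneEnergy_one_le`). Here `e(s)` is bounded both by the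
standard energy, which is almost conserved, and by the conformal energy divided by `1 + s²`. Using
the first bound for `s` up to a large multiple of `1 + λ` and the second beyond, `1 + λ` times the
integral is at most `(1 + λ)²` times the standard energy plus a small multiple of the supremum of
the conformal energy, which is absorbed (`exists_coneEnergy_bound`).

The supports of the slices `ψ(s, ·)` need not be locally uniform in `s`. All energies are therefore
cut off by `cone` to a truncated backward light cone; the cutoff is nonincreasing along both null
directions, so its flux has the right sign, and the cone exhausts space-time at the end.
-/

namespace Morawetz

/-! ### Partial derivatives of functions of two real variables -/

section Partial

variable {φ : ℝ → ℝ → ℝ}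

theorem dt_eq_fderiv (h : Differentiable ℝ (fun p : ℝ × ℝ => φ p.1 p.2)) (s x : ℝ) :
    dt φ s x = fderiv ℝ (fun p : ℝ × ℝ => φ p.1 p.2) (s, x) (1, 0) := by
  have h1 : HasDerivAt (fun r : ℝ => (r, x)) ((1 : ℝ), (0 : ℝ)) s :=
    (hasDerivAt_id s).prodMk (hasDerivAt_const s x)
  exact ((h (s, x)).hasFDerivAt.comp_hasDerivAt s h1).deriv

theorem dx_eq_fderiv (h : Differentiable ℝ (fun p : ℝ × ℝ => φ p.1 p.2)) (s x : ℝ) :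
    dx φ s x = fderiv ℝ (fun p : ℝ × ℝ => φ p.1 p.2) (s, x) (0, 1) := by
  have h1 : HasDerivAt (fun r : ℝ => (s, r)) ((0 : ℝ), (1 : ℝ)) x :=
    (hasDerivAt_const x s).prodMk (hasDerivAt_id x)
  exact ((h (s, x)).hasFDerivAt.comp_hasDerivAt x h1).deriv

theorem hasDerivAt_dt (h : Differentiable ℝ (fun p : ℝ × ℝ => φ p.1 p.2)) (s x : ℝ) :
    HasDerivAt (fun r => φ r x) (dt φ s x) s := by
  have h1 : DifferentiableAt ℝ (fun r : ℝ => φ r x) s :=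
    (h (s, x)).comp s (f := fun r : ℝ => (r, x)) (by fun_prop)
  exact h1.hasDerivAt

theorem hasDerivAt_dx (h : Differentiable ℝ (fun p : ℝ × ℝ => φ p.1 p.2)) (s x : ℝ) :
    HasDerivAt (fun y => φ s y) (dx φ s x) x := by
  have h1 : DifferentiableAt ℝ (fun y : ℝ => φ s y) x :=
    (h (s, x)).comp x (f := fun y : ℝ => (s, y)) (by fun_prop)
  exact h1.hasDerivAt

theorem contDiff_dt (h : ContDiff ℝ 2 (fun p : ℝ × ℝ => φ p.1 p.2)) :
    ContDiff ℝ 1 (fun p : ℝ × ℝ => dt φ p.1 p.2) := by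
  have hd : Differentiable ℝ (fun p : ℝ × ℝ => φ p.1 p.2) := h.differentiable (by norm_num)
  have h1 : ContDiff ℝ 1 (fderiv ℝ (fun p : ℝ × ℝ => φ p.1 p.2)) :=
    h.fderiv_right (by norm_num)
  have h2 := h1.clm_apply (contDiff_const (c := ((1 : ℝ), (0 : ℝ))))
  exact (funext fun p => dt_eq_fderiv hd p.1 p.2 : (fun p : ℝ × ℝ => dt φ p.1 p.2) = _) ▸ h2

theorem contDiff_dx (h : ContDiff ℝ 2 (fun p : ℝ × ℝ => φ p.1 p.2)) :
    ContDiff ℝ 1 (fun p : ℝ × ℝ => dx φ p.1 p.2) := by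
  have hd : Differentiable ℝ (fun p : ℝ × ℝ => φ p.1 p.2) := h.differentiable (by norm_num)
  have h1 : ContDiff ℝ 1 (fderiv ℝ (fun p : ℝ × ℝ => φ p.1 p.2)) :=
    h.fderiv_right (by norm_num)
  have h2 := h1.clm_apply (contDiff_const (c := ((0 : ℝ), (1 : ℝ))))
  exact (funext fun p => dx_eq_fderiv hd p.1 p.2 : (fun p : ℝ × ℝ => dx φ p.1 p.2) = _) ▸ h2

theorem continuous_dt (h : ContDiff ℝ 1 (fun p : ℝ × ℝ => φ p.1 p.2)) :
    Continuous (fun p : ℝ × ℝ => dt φ p.1 p.2) := by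
  have hd : Differentiable ℝ (fun p : ℝ × ℝ => φ p.1 p.2) := h.differentiable (by norm_num)
  have h2 := (h.continuous_fderiv (by norm_num)).clm_apply
    (continuous_const (y := ((1 : ℝ), (0 : ℝ))))
  exact h2.congr (fun p => (dt_eq_fderiv hd p.1 p.2).symm)

theorem continuous_dx (h : ContDiff ℝ 1 (fun p : ℝ × ℝ => φ p.1 p.2)) :
    Continuous (fun p : ℝ × ℝ => dx φ p.1 p.2) := by
  have hd : Differentiable ℝ (fun p : ℝ × ℝ => φ p.1 p.2) := h.differentiable (by norm_num)
  have h2 := (h.continuous_fderiv (by norm_num)).clm_apply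
    (continuous_const (y := ((0 : ℝ), (1 : ℝ))))
  exact h2.congr (fun p => (dx_eq_fderiv hd p.1 p.2).symm)

/-- Mixed second partial derivatives of a `C²` function commute. -/
theorem dt_dx_eq_dx_dt (h : ContDiff ℝ 2 (fun p : ℝ × ℝ => φ p.1 p.2)) (s x : ℝ) :
    dt (dx φ) s x = dx (dt φ) s x := by
  have hd : Differentiable ℝ (fun p : ℝ × ℝ => φ p.1 p.2) := h.differentiable (by norm_num)
  have h1 : ContDiff ℝ 1 (fderiv ℝ (fun p : ℝ × ℝ => φ p.1 p.2)) :=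
    h.fderiv_right (by norm_num)
  have hd1 := h1.differentiable (by norm_num)
  have hsym : IsSymmSndFDerivAt ℝ (fun p : ℝ × ℝ => φ p.1 p.2) (s, x) :=
    h.contDiffAt.isSymmSndFDerivAt (by simp)
  rw [dt_eq_fderiv ((contDiff_dx h).differentiable (by norm_num)),
    dx_eq_fderiv ((contDiff_dt h).differentiable (by norm_num))]
  have e1 : (fun p : ℝ × ℝ => dx φ p.1 p.2)
      = fun p => fderiv ℝ (fun p : ℝ × ℝ => φ p.1 p.2) p (0, 1) :=
    funext fun p => dx_eq_fderiv hd p.1 p.2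
  have e2 : (fun p : ℝ × ℝ => dt φ p.1 p.2)
      = fun p => fderiv ℝ (fun p : ℝ × ℝ => φ p.1 p.2) p (1, 0) :=
    funext fun p => dt_eq_fderiv hd p.1 p.2
  rw [e1, e2]
  have k (v w : ℝ × ℝ) : fderiv ℝ (fun p => fderiv ℝ (fun p : ℝ × ℝ => φ p.1 p.2) p v) (s, x) w
      = fderiv ℝ (fderiv ℝ (fun p : ℝ × ℝ => φ p.1 p.2)) (s, x) w v := by
    have := ((hd1 (s, x)).hasFDerivAt.clm_apply (hasFDerivAt_const v (s, x))).fderiv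
    rw [this]; simp
  rw [k, k]
  exact hsym _ _

end Partial

/-- If `P` is differentiable in time with jointly continuous time derivative `P'`, the increment
of `∫ P dx` is the time integral of `∫ P' dx`. -/
theorem integral_sub_eq_integral_integral {P P' : ℝ → ℝ → ℝ}
    (hP : ∀ s x, HasDerivAt (fun r => P r x) (P' s x) s)
    (hc : Continuous (fun p : ℝ × ℝ => P p.1 p.2))
    (hc' : Continuous (fun p : ℝ × ℝ => P' p.1 p.2)) (a b c d : ℝ) :
    (∫ x in c..d, P b x) - ∫ x in c..d, P a x = ∫ s in a..b, ∫ x in c..d, P' s x := by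
  have hcP (s : ℝ) : Continuous (P s) := hc.comp (Continuous.prodMk_right s)
  rw [intervalIntegral_intervalIntegral_swap (F := P'),
    ← intervalIntegral.integral_sub ((hcP b).intervalIntegrable _ _)
      ((hcP a).intervalIntegrable _ _)]
  · refine intervalIntegral.integral_congr fun x _ => ?_
    refine (intervalIntegral.integral_eq_sub_of_hasDerivAt (fun s _ => hP s x) ?_).symm
    exact (hc'.comp (Continuous.prodMk_left x)).intervalIntegrable _ _
  · have h1 : IntegrableOn (Function.uncurry P') (Set.uIcc a b ×ˢ Set.uIcc c d) :=
      hc'.continuousOn.integrableOn_compact (isCompact_uIcc.prod isCompact_uIcc)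
    exact h1.mono_set (Set.prod_mono Set.uIoc_subset_uIcc Set.uIoc_subset_uIcc)

/-! ### Inequalities on an interval -/

theorem integral_mul_le_sqrt_mul_sqrt {f g : ℝ → ℝ} (hf : Continuous f) (hg : Continuous g)
    {a b : ℝ} (hab : a ≤ b) :
    ∫ x in a..b, f x * g x ≤ √(∫ x in a..b, f x ^ 2) * √(∫ x in a..b, g x ^ 2) := by
  have i1 : IntervalIntegrable (fun x => f x ^ 2) volume a b := (hf.pow 2).intervalIntegrable _ _
  have i2 : IntervalIntegrable (fun x => f x * g x) volume a b := (hf.mul hg).intervalIntegrable _ _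
  have i3 : IntervalIntegrable (fun x => g x ^ 2) volume a b := (hg.pow 2).intervalIntegrable _ _
  have hA : 0 ≤ ∫ x in a..b, f x ^ 2 :=
    intervalIntegral.integral_nonneg hab fun x _ => sq_nonneg _
  rw [← Real.sqrt_mul hA]
  refine Real.le_sqrt_of_sq_le ?_
  have hq (t : ℝ) : 0 ≤ (∫ x in a..b, f x ^ 2) * (t * t) + (2 * ∫ x in a..b, f x * g x) * t
      + ∫ x in a..b, g x ^ 2 := by
    have h0 : 0 ≤ ∫ x in a..b, (t * f x + g x) ^ 2 :=
      intervalIntegral.integral_nonneg hab fun x _ => sq_nonneg _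
    have h1 : ∫ x in a..b, (t * f x + g x) ^ 2
        = ∫ x in a..b, ((t * t) * f x ^ 2 + (2 * t) * (f x * g x) + g x ^ 2) :=
      intervalIntegral.integral_congr fun x _ => by ring
    rw [h1, intervalIntegral.integral_add ((i1.const_mul _).add (i2.const_mul _)) i3,
      intervalIntegral.integral_add (i1.const_mul _) (i2.const_mul _),
      intervalIntegral.integral_const_mul, intervalIntegral.integral_const_mul] at h0
    linarith
  have := discrim_le_zero hq
  rw [discrim] at this
  linarith

theorem sq_sub_le_integral {g g' : ℝ → ℝ} (hg : ∀ x, HasDerivAt g (g' x) x) (hg' : Continuous g')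
    {a b : ℝ} (hab : a ≤ b) :
    (g b - g a) ^ 2 ≤ (b - a) * ∫ x in a..b, g' x ^ 2 := by
  have h1 : ∫ x in a..b, g' x = g b - g a :=
    intervalIntegral.integral_eq_sub_of_hasDerivAt (fun x _ => hg x) (hg'.intervalIntegrable _ _)
  have key (h : ℝ → ℝ) (hh : Continuous h) :
      ∫ x in a..b, h x ≤ √((b - a) * ∫ x in a..b, h x ^ 2) := by
    have := integral_mul_le_sqrt_mul_sqrt (continuous_const (y := (1 : ℝ))) hh hab
    rw [Real.sqrt_mul (by linarith)]
    simpa using this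
  have h2 : |g b - g a| ≤ √((b - a) * ∫ x in a..b, g' x ^ 2) := by
    rw [← h1, abs_le']
    refine ⟨key g' hg', ?_⟩
    simpa using key (fun x => - g' x) hg'.neg
  have h3 : 0 ≤ (b - a) * ∫ x in a..b, g' x ^ 2 :=
    mul_nonneg (by linarith) (intervalIntegral.integral_nonneg hab fun x _ => sq_nonneg _)
  calc (g b - g a) ^ 2 = |g b - g a| ^ 2 := (sq_abs _).symm
    _ ≤ √((b - a) * ∫ x in a..b, g' x ^ 2) ^ 2 := by gcongr
    _ = _ := Real.sq_sqrt h3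

/-- Near the origin, `g` is controlled by its mean square over a nearby interval of length `δ`
and by its derivative. -/
theorem sq_le_integral_sq_add {g g' : ℝ → ℝ} (hg : ∀ x, HasDerivAt g (g' x) x)
    (hg' : Continuous g') {δ c x : ℝ} (hδ : 0 < δ) (hc : -(2 * δ) ≤ c) (hc' : c ≤ δ)
    (hx : |x| ≤ δ) :
    g x ^ 2 ≤ 2 / δ * (∫ y in c..c + δ, g y ^ 2) + 6 * δ * ∫ y in -(2 * δ)..2 * δ, g' y ^ 2 := by
  have hgc : Continuous g := continuous_iff_continuousAt.2 fun x => (hg x).continuousAt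
  obtain ⟨hx1, hx2⟩ := abs_le.1 hx
  set D := ∫ y in -(2 * δ)..2 * δ, g' y ^ 2 with hD
  have i1 (a b : ℝ) : IntervalIntegrable (fun x => g' x ^ 2) volume a b :=
    (hg'.pow 2).intervalIntegrable _ _
  have hD0 : 0 ≤ D := intervalIntegral.integral_nonneg (by linarith) fun x _ => sq_nonneg _
  have mono {a b : ℝ} (ha : -(2 * δ) ≤ a) (hab : a ≤ b) (hb : b ≤ 2 * δ) :
      (b - a) * ∫ y in a..b, g' y ^ 2 ≤ 3 * δ * D ∨ 3 * δ < b - a := by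
    rcases le_or_gt (b - a) (3 * δ) with h | h
    · left
      have : ∫ y in a..b, g' y ^ 2 ≤ D :=
        intervalIntegral.integral_mono_interval ha hab hb
          (Filter.Eventually.of_forall fun x => sq_nonneg _) (i1 _ _)
      have h0 : 0 ≤ ∫ y in a..b, g' y ^ 2 :=
        intervalIntegral.integral_nonneg hab fun x _ => sq_nonneg _
      exact mul_le_mul h this h0 (by linarith)
    · exact Or.inr h
  have pt (y : ℝ) (hy : y ∈ Set.Icc c (c + δ)) : g x ^ 2 ≤ 2 * g y ^ 2 + 6 * δ * D := by
    have hd : (g x - g y) ^ 2 ≤ 3 * δ * D := by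
      rcases le_total x y with h | h
      · have h1 := sq_sub_le_integral hg hg' h
        rcases mono (a := x) (b := y) (by linarith) h (by linarith [hy.2]) with h2 | h2
        · nlinarith
        · linarith [hy.2]
      · have h1 := sq_sub_le_integral hg hg' h
        rcases mono (a := y) (b := x) (by linarith [hy.1]) h (by linarith) with h2 | h2
        · nlinarith
        · linarith [hy.1]
    nlinarith [sq_nonneg (g x - 2 * g y)]
  have h1 : ∫ y in c..c + δ, g x ^ 2 ≤ ∫ y in c..c + δ, (2 * g y ^ 2 + 6 * δ * D) :=
    intervalIntegral.integral_mono_on (by linarith) (continuous_const.intervalIntegrable _ _)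
      ((by fun_prop : Continuous fun y => 2 * g y ^ 2 + 6 * δ * D).intervalIntegrable _ _) pt
  rw [intervalIntegral.integral_add
    ((by fun_prop : Continuous fun y => 2 * g y ^ 2).intervalIntegrable _ _)
    (continuous_const.intervalIntegrable _ _), intervalIntegral.integral_const_mul,
    intervalIntegral.integral_const, intervalIntegral.integral_const] at h1
  simp only [add_sub_cancel_left, smul_eq_mul] at h1
  have h2 : 2 / δ * (∫ y in c..c + δ, g y ^ 2) + 6 * δ * D
      = (2 * (∫ y in c..c + δ, g y ^ 2) + δ * (6 * δ * D)) / δ := by field_simp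
  rw [h2, le_div_iff₀ hδ]
  linarith

theorem integral_neg_zero_eq (h : ℝ → ℝ) (ρ : ℝ) :
    ∫ x in -ρ..0, h x = ∫ x in 0..ρ, h (-x) := by
  rw [intervalIntegral.integral_comp_neg, neg_zero]

theorem integral_sq_div_sq_le_half {g g' : ℝ → ℝ} (hg : ∀ x, HasDerivAt g (g' x) x)
    (hg' : Continuous g') {ρ : ℝ} (hρ : 0 ≤ ρ) :
    ∫ x in 0..ρ, g x ^ 2 / (1 + |x|) ^ 2 ≤ 2 * g 0 ^ 2 + 4 * ∫ x in 0..ρ, g' x ^ 2 := by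
  have hgc : Continuous g := continuous_iff_continuousAt.2 fun x => (hg x).continuousAt
  have hne (x : ℝ) : 1 + |x| ≠ 0 := by positivity
  have hc1 : Continuous fun x => g x ^ 2 / (1 + |x|) ^ 2 - 2 * g x * g' x / (1 + |x|) := by
    fun_prop (disch := intro x; have := hne x; positivity)
  have hc2 : Continuous fun x => g x ^ 2 / (1 + |x|) ^ 2 := by
    fun_prop (disch := intro x; have := hne x; positivity)
  have ftc : ∫ x in 0..ρ, (g x ^ 2 / (1 + |x|) ^ 2 - 2 * g x * g' x / (1 + |x|))
      = -(g ρ ^ 2 / (1 + ρ)) - -(g 0 ^ 2 / (1 + 0)) := by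
    rw [intervalIntegral.integral_congr (g := fun x => g x ^ 2 / (1 + x) ^ 2
      - 2 * g x * g' x / (1 + x))]
    · refine intervalIntegral.integral_eq_sub_of_hasDerivAt (f := fun x => -(g x ^ 2 / (1 + x)))
        (fun x hx => ?_) ?_
      · rw [Set.uIcc_of_le hρ] at hx
        have hx1 : 1 + x ≠ 0 := by linarith [hx.1]
        refine (((hg x).fun_pow 2).fun_div ((hasDerivAt_id' x).const_add 1) hx1).fun_neg.congr_deriv ?_
        field_simp
        push_cast
        ring
      · refine ContinuousOn.intervalIntegrable ?_
        rw [Set.uIcc_of_le hρ]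
        have : ∀ x ∈ Set.Icc 0 ρ, 1 + x ≠ 0 := fun x hx => by linarith [hx.1]
        have h2 : ∀ x ∈ Set.Icc 0 ρ, (1 + x) ^ 2 ≠ 0 := fun x hx => pow_ne_zero _ (this x hx)
        exact ((by fun_prop : ContinuousOn (fun x => g x ^ 2) _).div (by fun_prop) h2).sub
          ((by fun_prop : ContinuousOn (fun x => 2 * g x * g' x) _).div (by fun_prop) this)
    · intro x hx
      rw [Set.uIcc_of_le hρ] at hx
      simp only [abs_of_nonneg hx.1]
  have hle : ∫ x in 0..ρ, g x ^ 2 / (1 + |x|) ^ 2 ≤ ∫ x in 0..ρ,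
      (2 * (g x ^ 2 / (1 + |x|) ^ 2 - 2 * g x * g' x / (1 + |x|)) + 4 * g' x ^ 2) := by
    refine intervalIntegral.integral_mono_on hρ (hc2.intervalIntegrable _ _)
      ((by fun_prop : Continuous _).intervalIntegrable _ _) fun x _ => ?_
    have e1 : g x ^ 2 / (1 + |x|) ^ 2 = (g x / (1 + |x|)) ^ 2 := by rw [div_pow]
    have e2 : 2 * g x * g' x / (1 + |x|) = 2 * (g x / (1 + |x|)) * g' x := by ring
    rw [e1, e2]
    nlinarith [sq_nonneg (g x / (1 + |x|) - 2 * g' x)]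
  rw [intervalIntegral.integral_add ((hc1.const_mul 2).intervalIntegrable _ _)
    ((by fun_prop : Continuous fun x => 4 * g' x ^ 2).intervalIntegrable _ _),
    intervalIntegral.integral_const_mul, intervalIntegral.integral_const_mul, ftc] at hle
  have : 0 ≤ g ρ ^ 2 / (1 + ρ) := by positivity
  rw [add_zero, div_one] at hle
  linarith

/-- Hardy's inequality on a symmetric interval. -/
theorem integral_sq_div_sq_le {g g' : ℝ → ℝ} (hg : ∀ x, HasDerivAt g (g' x) x)
    (hg' : Continuous g') {ρ : ℝ} (hρ : 0 ≤ ρ) :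
    ∫ x in -ρ..ρ, g x ^ 2 / (1 + |x|) ^ 2 ≤ 4 * g 0 ^ 2 + 4 * ∫ x in -ρ..ρ, g' x ^ 2 := by
  have hgc : Continuous g := continuous_iff_continuousAt.2 fun x => (hg x).continuousAt
  have hne (x : ℝ) : 1 + |x| ≠ 0 := by positivity
  have hc2 : Continuous fun x => g x ^ 2 / (1 + |x|) ^ 2 := by
    fun_prop (disch := intro x; have := hne x; positivity)
  have hc3 : Continuous fun x => g' x ^ 2 := by fun_prop
  have h1 := integral_sq_div_sq_le_half hg hg' hρ
  have h2 := integral_sq_div_sq_le_half (g := fun x => g (-x)) (g' := fun x => -g' (-x))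
    (fun x => by simpa [Function.comp_def] using (hg (-x)).comp x (hasDerivAt_neg x)) (by fun_prop) hρ
  rw [← intervalIntegral.integral_add_adjacent_intervals (hc2.intervalIntegrable (-ρ) 0)
    (hc2.intervalIntegrable 0 ρ), ← intervalIntegral.integral_add_adjacent_intervals
    (hc3.intervalIntegrable (-ρ) 0) (hc3.intervalIntegrable 0 ρ),
    integral_neg_zero_eq, integral_neg_zero_eq]
  simp only [neg_zero, even_two, Even.neg_pow, abs_neg] at h2 ⊢
  linarith

/-! ### The Morawetz multiplier on a time slice -/

/-- The bounded odd multiplier `x / (1 + ε |x|)`. -/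
noncomputable def mult (ε x : ℝ) : ℝ := x / (1 + ε * |x|)

/-- The derivative `1 / (1 + ε |x|) ^ 2` of `mult ε`; it has a concave corner at the origin. -/
noncomputable def mult' (ε x : ℝ) : ℝ := 1 / (1 + ε * |x|) ^ 2

section Mult

variable {ε : ℝ}

theorem continuous_mult (hε : 0 ≤ ε) : Continuous (mult ε) := by
  unfold mult
  have hne (x : ℝ) : 1 + ε * |x| ≠ 0 := by positivity
  fun_prop (disch := exact hne)

theorem continuous_mult' (hε : 0 ≤ ε) : Continuous (mult' ε) := by
  unfold mult'
  have hne (x : ℝ) : 1 + ε * |x| ≠ 0 := by positivity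
  have hne' (x : ℝ) : (1 + ε * |x|) ^ 2 ≠ 0 := pow_ne_zero _ (hne x)
  fun_prop (disch := exact hne')

theorem mult'_nonneg (ε x : ℝ) : 0 ≤ mult' ε x := by unfold mult'; positivity

theorem abs_mult (hε : 0 ≤ ε) (x : ℝ) : |mult ε x| = |x| / (1 + ε * |x|) := by
  rw [mult, abs_div, abs_of_pos (by positivity : 0 < 1 + ε * |x|)]

theorem abs_mult_le (hε : 0 < ε) (x : ℝ) : |mult ε x| ≤ ε⁻¹ := by
  rw [abs_mult hε.le, div_le_iff₀ (by positivity)]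
  field_simp
  linarith

theorem mult_mul_nonpos {Q' : ℝ → ℝ} (hε : 0 ≤ ε) (h : ∀ x, x * Q' x ≤ 0) (x : ℝ) :
    mult ε x * Q' x ≤ 0 := by
  rw [mult, div_mul_eq_mul_div]
  exact div_nonpos_of_nonpos_of_nonneg (h x) (by positivity)

/-- The Morawetz identity on a half-line. The term `ε g(0)² / 2` is the boundary contribution of
the corner of `mult' ε`, and `-g(0) g'(0) / 2` cancels against the other half-line. -/
theorem integral_morawetz_le_half (hε : 0 ≤ ε) {g g' g'' k k' Q Q' h : ℝ → ℝ}
    (hg : ∀ x, HasDerivAt g (g' x) x) (hg' : ∀ x, HasDerivAt g' (g'' x) x)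
    (hk : ∀ x, HasDerivAt k (k' x) x) (hQ : ∀ x, HasDerivAt Q (Q' x) x)
    (hgc : Continuous g'') (hkc : Continuous k') (hQc : Continuous Q') (hh : Continuous h)
    {R : ℝ} (hR : 0 ≤ R) (g0 : g R = 0) (g0' : g' R = 0) (k0 : k R = 0) :
    ∫ x in 0..R, (mult ε x * ((g'' x - Q x * g x - h x) * g' x + k x * k' x)
        + mult' ε x / 2 * (k x ^ 2 + g x * (g'' x - Q x * g x - h x)))
      ≤ (∫ x in 0..R, (-(1 / 3 * mult' ε x * g' x ^ 2) + 1 / 2 * mult ε x * Q' x * g x ^ 2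
          - h x * (mult ε x * g' x + mult' ε x / 2 * g x)))
        - g 0 * g' 0 / 2 + ε * g 0 ^ 2 / 2 := by
  have cg : Continuous g := continuous_iff_continuousAt.2 fun x => (hg x).continuousAt
  have cg' : Continuous g' := continuous_iff_continuousAt.2 fun x => (hg' x).continuousAt
  have ck : Continuous k := continuous_iff_continuousAt.2 fun x => (hk x).continuousAt
  have cQ : Continuous Q := continuous_iff_continuousAt.2 fun x => (hQ x).continuousAt
  have cm := continuous_mult hε
  have cm' := continuous_mult' hε
  set V : ℝ → ℝ := fun x => x / (1 + ε * x) / 2 * (k x ^ 2 + g' x ^ 2 - Q x * g x ^ 2)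
    + 1 / (1 + ε * x) ^ 2 / 2 * (g x * g' x) - ε / 2 * (1 / (1 + ε * x) ^ 3 * g x ^ 2) with hV
  set V' : ℝ → ℝ := fun x =>
    mult' ε x / 2 * (k x ^ 2 + g' x ^ 2 - Q x * g x ^ 2)
    + mult ε x / 2 * (2 * k x * k' x + 2 * g' x * g'' x - (Q' x * g x ^ 2 + Q x * (2 * g x * g' x)))
    + (-(ε / (1 + ε * |x|) ^ 3) * (g x * g' x) + mult' ε x / 2 * (g' x ^ 2 + g x * g'' x))
    - ε / 2 * (-(3 * ε / (1 + ε * |x|) ^ 4) * g x ^ 2 + 1 / (1 + ε * |x|) ^ 3 * (2 * g x * g' x))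
    with hV'
  have cV' : Continuous V' := by
    have hne (x : ℝ) : 1 + ε * |x| ≠ 0 := by positivity
    have h3 (x : ℝ) : (1 + ε * |x|) ^ 3 ≠ 0 := pow_ne_zero _ (hne x)
    have h4 (x : ℝ) : (1 + ε * |x|) ^ 4 ≠ 0 := pow_ne_zero _ (hne x)
    rw [hV']
    have e1 : Continuous fun x => ε / (1 + ε * |x|) ^ 3 := by fun_prop (disch := assumption)
    have e2 : Continuous fun x => 1 / (1 + ε * |x|) ^ 3 := by fun_prop (disch := assumption)
    have e3 : Continuous fun x => 3 * ε / (1 + ε * |x|) ^ 4 := by fun_prop (disch := assumption)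
    fun_prop
  have dV : ∀ x ∈ Set.uIcc 0 R, HasDerivAt V (V' x) x := by
    intro x hx
    rw [Set.uIcc_of_le hR] at hx
    have hz : 0 < 1 + ε * x := by have := mul_nonneg hε hx.1; linarith
    have dz : HasDerivAt (fun x => 1 + ε * x) ε x := by
      simpa using ((hasDerivAt_id' x).const_mul ε).const_add 1
    have d1 : HasDerivAt (fun x => x / (1 + ε * x) / 2) (1 / (1 + ε * x) ^ 2 / 2) x := by
      refine (((hasDerivAt_id' x).fun_div dz hz.ne').div_const 2).congr_deriv ?_
      field_simp
      ring
    have d2 : HasDerivAt (fun x => 1 / (1 + ε * x) ^ 2 / 2) (-(ε / (1 + ε * x) ^ 3)) x := by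
      refine (((hasDerivAt_const x 1).fun_div (dz.fun_pow 2) (pow_ne_zero _ hz.ne')).div_const
        2).congr_deriv ?_
      field_simp
      push_cast
      ring
    have d3 : HasDerivAt (fun x => 1 / (1 + ε * x) ^ 3) (-(3 * ε / (1 + ε * x) ^ 4)) x := by
      refine ((hasDerivAt_const x 1).fun_div (dz.fun_pow 3) (pow_ne_zero _ hz.ne')).congr_deriv ?_
      field_simp
      push_cast
      ring
    have sq {a : ℝ → ℝ} {a' : ℝ} (ha : HasDerivAt a a' x) :
        HasDerivAt (fun x => a x ^ 2) (2 * a x * a') x := by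
      refine (ha.fun_pow 2).congr_deriv ?_
      push_cast
      ring
    rw [hV, hV']
    simp only [mult, mult', abs_of_nonneg hx.1]
    refine (((d1.fun_mul (((sq (hk x)).fun_add (sq (hg' x))).fun_sub
      ((hQ x).fun_mul (sq (hg x))))).fun_add (d2.fun_mul ((hg x).fun_mul (hg' x)))).fun_sub
      ((d3.fun_mul (sq (hg x))).const_mul (ε / 2))).congr_deriv ?_
    ring
  have ftc := intervalIntegral.integral_eq_sub_of_hasDerivAt dV (cV'.intervalIntegrable _ _)
  have e0 : V R - V 0 = - (g 0 * g' 0 / 2) + ε * g 0 ^ 2 / 2 := by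
    rw [hV]
    simp [g0, g0', k0]
    ring
  have hle : ∫ x in 0..R, (mult ε x * ((g'' x - Q x * g x - h x) * g' x + k x * k' x)
        + mult' ε x / 2 * (k x ^ 2 + g x * (g'' x - Q x * g x - h x)))
      ≤ ∫ x in 0..R, ((-(1 / 3 * mult' ε x * g' x ^ 2) + 1 / 2 * mult ε x * Q' x * g x ^ 2
          - h x * (mult ε x * g' x + mult' ε x / 2 * g x)) + V' x) := by
    refine intervalIntegral.integral_mono_on hR ((by fun_prop : Continuous _).intervalIntegrable _ _)
      ((by fun_prop : Continuous _).intervalIntegrable _ _) fun x hx => ?_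
    have hz : 0 < 1 + ε * |x| := by positivity
    simp only [hV', mult']
    -- in `X = g' / z`, `Y = ε g / z²`, the difference of both sides is
    -- `(2 X² - 6 X Y + 9 Y² / 2) / 3`
    have key := mul_nonneg (by norm_num : (0 : ℝ) ≤ 1 / 6)
      (sq_nonneg (2 * (g' x / (1 + ε * |x|)) - 3 * (ε * g x / (1 + ε * |x|) ^ 2)))
    rw [← sub_nonneg]
    refine key.trans_eq ?_
    field_simp
    ring
  rw [intervalIntegral.integral_add ((by fun_prop : Continuous _).intervalIntegrable _ _)
    (cV'.intervalIntegrable _ _), ftc, e0] at hle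
  linarith

/-- The Morawetz estimate on the line. -/
theorem integral_morawetz_le (hε : 0 ≤ ε) {g g' g'' k k' Q Q' h : ℝ → ℝ}
    (hg : ∀ x, HasDerivAt g (g' x) x) (hg' : ∀ x, HasDerivAt g' (g'' x) x)
    (hk : ∀ x, HasDerivAt k (k' x) x) (hQ : ∀ x, HasDerivAt Q (Q' x) x)
    (hgc : Continuous g'') (hkc : Continuous k') (hQc : Continuous Q') (hh : Continuous h)
    {R : ℝ} (hR : 0 ≤ R) (hg0 : ∀ x, |x| = R → g x = 0) (hg0' : ∀ x, |x| = R → g' x = 0)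
    (hk0 : ∀ x, |x| = R → k x = 0) :
    ∫ x in -R..R, (mult ε x * ((g'' x - Q x * g x - h x) * g' x + k x * k' x)
        + mult' ε x / 2 * (k x ^ 2 + g x * (g'' x - Q x * g x - h x)))
      ≤ (∫ x in -R..R, (-(1 / 3 * mult' ε x * g' x ^ 2) + 1 / 2 * mult ε x * Q' x * g x ^ 2
          - h x * (mult ε x * g' x + mult' ε x / 2 * g x))) + ε * g 0 ^ 2 := by
  have cg : Continuous g := continuous_iff_continuousAt.2 fun x => (hg x).continuousAt
  have cg' : Continuous g' := continuous_iff_continuousAt.2 fun x => (hg' x).continuousAt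
  have ck : Continuous k := continuous_iff_continuousAt.2 fun x => (hk x).continuousAt
  have cQ : Continuous Q := continuous_iff_continuousAt.2 fun x => (hQ x).continuousAt
  have cm := continuous_mult hε
  have cm' := continuous_mult' hε
  have refl {a : ℝ → ℝ} {a' : ℝ → ℝ} (ha : ∀ x, HasDerivAt a (a' x) x) (x : ℝ) :
      HasDerivAt (fun x => a (-x)) (-a' (-x)) x := by
    simpa [Function.comp_def] using (ha (-x)).comp x (hasDerivAt_neg x)
  have aR : |R| = R := abs_of_nonneg hR
  have aR' : |-R| = R := by rw [abs_neg, aR]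
  have h1 := integral_morawetz_le_half hε hg hg' hk hQ hgc hkc hQc hh hR (hg0 R aR) (hg0' R aR)
    (hk0 R aR)
  have h2 := integral_morawetz_le_half (g := fun x => g (-x)) (g' := fun x => -g' (-x))
    (g'' := fun x => g'' (-x)) (k := fun x => k (-x)) (k' := fun x => -k' (-x))
    (Q := fun x => Q (-x)) (Q' := fun x => -Q' (-x)) (h := fun x => h (-x)) hε (refl hg)
    (fun x => by simpa using (refl hg' x).fun_neg) (refl hk) (refl hQ) (by fun_prop) (by fun_prop)
    (by fun_prop) (by fun_prop) hR (hg0 (-R) aR') (by simp [hg0' (-R) aR']) (hk0 (-R) aR')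
  have m1 (x : ℝ) : mult ε (-x) = -mult ε x := by simp [mult, neg_div]
  have m2 (x : ℝ) : mult' ε (-x) = mult' ε x := by simp [mult']
  rw [← intervalIntegral.integral_add_adjacent_intervals (b := 0)
      ((by fun_prop : Continuous _).intervalIntegrable _ _)
      ((by fun_prop : Continuous _).intervalIntegrable _ _),
    ← intervalIntegral.integral_add_adjacent_intervals (a := -R) (b := 0)
      ((by fun_prop : Continuous fun x => (-(1 / 3 * mult' ε x * g' x ^ 2)
        + 1 / 2 * mult ε x * Q' x * g x ^ 2
        - h x * (mult ε x * g' x + mult' ε x / 2 * g x))).intervalIntegrable _ _)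
      ((by fun_prop : Continuous _).intervalIntegrable _ _),
    integral_neg_zero_eq, integral_neg_zero_eq]
  simp only [m1, m2]
  have e1 : ∫ x in 0..R, (-mult ε x * ((g'' (-x) - Q (-x) * g (-x) - h (-x)) * g' (-x)
        + k (-x) * k' (-x)) + mult' ε x / 2 * (k (-x) ^ 2
        + g (-x) * (g'' (-x) - Q (-x) * g (-x) - h (-x))))
      = ∫ x in 0..R, (mult ε x * ((g'' (-x) - Q (-x) * g (-x) - h (-x)) * -g' (-x)
        + k (-x) * -k' (-x)) + mult' ε x / 2 * (k (-x) ^ 2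
        + g (-x) * (g'' (-x) - Q (-x) * g (-x) - h (-x)))) :=
    intervalIntegral.integral_congr fun x _ => by ring
  have e2 : ∫ x in 0..R, (-(1 / 3 * mult' ε x * g' (-x) ^ 2)
        + 1 / 2 * -mult ε x * Q' (-x) * g (-x) ^ 2
        - h (-x) * (-mult ε x * g' (-x) + mult' ε x / 2 * g (-x)))
      = ∫ x in 0..R, (-(1 / 3 * mult' ε x * (-g' (-x)) ^ 2)
        + 1 / 2 * mult ε x * -Q' (-x) * g (-x) ^ 2
        - h (-x) * (mult ε x * -g' (-x) + mult' ε x / 2 * g (-x))) :=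
    intervalIntegral.integral_congr fun x _ => by ring
  rw [e1, e2]
  simp only [neg_zero] at h2
  linarith

end Mult

/-! ### The conformal energy identity in a truncated cone -/

/-- The flux density transported by `L̲` for the multiplier with weights `1 + κ u̲²`, `1 + κ u²`;
`κ = 1` gives the conformal energy and `κ = 0` the standard energy. -/
noncomputable def densL (κ : ℝ) (Q : ℝ → ℝ) (ψ : ℝ → ℝ → ℝ) (s x : ℝ) : ℝ :=
  (1 + κ * (s + x) ^ 2) * (dt ψ s x + dx ψ s x) ^ 2 + (1 + κ * (s - x) ^ 2) * Q x * ψ s x ^ 2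

/-- The flux density transported by `L`, see `densL`. -/
noncomputable def densLbar (κ : ℝ) (Q : ℝ → ℝ) (ψ : ℝ → ℝ → ℝ) (s x : ℝ) : ℝ :=
  (1 + κ * (s - x) ^ 2) * (dt ψ s x - dx ψ s x) ^ 2 + (1 + κ * (s + x) ^ 2) * Q x * ψ s x ^ 2

/-- A smooth cutoff to the backward light cone `|x| ≤ R - s`, equal to `1` where
`|x| ≤ R - s - 1`. It is a product of nonincreasing functions of `s + x` and of `s - x`, which gives
the flux through its boundary layer a sign. -/
noncomputable def cone (R s x : ℝ) : ℝ :=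
  Real.smoothTransition (R - s - x) * Real.smoothTransition (R - s + x)

theorem contDiff_cone (R : ℝ) : ContDiff ℝ 1 (fun p : ℝ × ℝ => cone R p.1 p.2) := by
  unfold cone
  have h : ContDiff ℝ 1 Real.smoothTransition := Real.smoothTransition.contDiff (n := 1)
  exact (h.comp (by fun_prop)).mul (h.comp (by fun_prop))

theorem continuous_cone (R : ℝ) : Continuous (fun p : ℝ × ℝ => cone R p.1 p.2) :=
  (contDiff_cone R).continuous

theorem cone_nonneg (R s x : ℝ) : 0 ≤ cone R s x :=
  mul_nonneg (Real.smoothTransition.nonneg _) (Real.smoothTransition.nonneg _)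

theorem cone_le_one (R s x : ℝ) : cone R s x ≤ 1 :=
  mul_le_one₀ (Real.smoothTransition.le_one _) (Real.smoothTransition.nonneg _)
    (Real.smoothTransition.le_one _)

theorem cone_eq_one {R s x : ℝ} (h : |x| ≤ R - s - 1) : cone R s x = 1 := by
  obtain ⟨h1, h2⟩ := abs_le.1 h
  rw [cone, Real.smoothTransition.one_of_one_le (by linarith),
    Real.smoothTransition.one_of_one_le (by linarith), one_mul]

theorem cone_eq_zero {R s x : ℝ} (hs : 0 ≤ s) (h : |x| = R) : cone R s x = 0 := by
  rcases abs_cases x with ⟨h1, _⟩ | ⟨h1, _⟩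
  · rw [cone, Real.smoothTransition.zero_of_nonpos (by linarith), zero_mul]
  · rw [cone, Real.smoothTransition.zero_of_nonpos (x := R - s + x) (by linarith), mul_zero]

/-- The cutoff is nonincreasing along both null directions. -/
theorem exists_cone_deriv (R s x : ℝ) : ∃ α β : ℝ, 0 ≤ α ∧ 0 ≤ β ∧
    HasDerivAt (fun r => cone R r x) (-α - β) s ∧ HasDerivAt (fun y => cone R s y) (β - α) x := by
  have hS (y : ℝ) : HasDerivAt Real.smoothTransition (deriv Real.smoothTransition y) y :=
    ((Real.smoothTransition.contDiff (n := 1)).differentiable (by norm_num) y).hasDerivAt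
  have hm (y : ℝ) : 0 ≤ deriv Real.smoothTransition y := Real.smoothTransition.monotone.deriv_nonneg
  refine ⟨deriv Real.smoothTransition (R - s - x) * Real.smoothTransition (R - s + x),
    Real.smoothTransition (R - s - x) * deriv Real.smoothTransition (R - s + x),
    mul_nonneg (hm _) (Real.smoothTransition.nonneg _),
    mul_nonneg (Real.smoothTransition.nonneg _) (hm _), ?_, ?_⟩
  · have h1 : HasDerivAt (fun r => R - r - x) (-1) s := by
      simpa using ((hasDerivAt_id' s).const_sub R).sub_const x
    have h2 : HasDerivAt (fun r => R - r + x) (-1) s := by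
      simpa using ((hasDerivAt_id' s).const_sub R).add_const x
    refine (((hS _).comp s h1).fun_mul ((hS _).comp s h2)).congr_deriv ?_
    simp only [Function.comp]
    ring
  · have h1 : HasDerivAt (fun y => R - s - y) (-1) x := by
      simpa using (hasDerivAt_id' x).const_sub (R - s)
    have h2 : HasDerivAt (fun y => R - s + y) 1 x := by
      simpa using (hasDerivAt_id' x).const_add (R - s)
    refine (((hS _).comp x h1).fun_mul ((hS _).comp x h2)).congr_deriv ?_
    simp only [Function.comp]
    ring

section Energy

variable {Q : ℝ → ℝ} {ψ H : ℝ → ℝ → ℝ}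

theorem contDiff_densL (κ : ℝ) (hQ : ContDiff ℝ 1 Q)
    (hψ : ContDiff ℝ 2 (fun p : ℝ × ℝ => ψ p.1 p.2)) :
    ContDiff ℝ 1 (fun p : ℝ × ℝ => densL κ Q ψ p.1 p.2) := by
  have h0 := hψ.of_le (by norm_num : (1 : WithTop ℕ∞) ≤ 2)
  have h1 := contDiff_dt hψ
  have h2 := contDiff_dx hψ
  have h3 : ContDiff ℝ 1 (fun p : ℝ × ℝ => Q p.2) := hQ.comp contDiff_snd
  unfold densL
  fun_prop

theorem contDiff_densLbar (κ : ℝ) (hQ : ContDiff ℝ 1 Q)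
    (hψ : ContDiff ℝ 2 (fun p : ℝ × ℝ => ψ p.1 p.2)) :
    ContDiff ℝ 1 (fun p : ℝ × ℝ => densLbar κ Q ψ p.1 p.2) := by
  have h0 := hψ.of_le (by norm_num : (1 : WithTop ℕ∞) ≤ 2)
  have h1 := contDiff_dt hψ
  have h2 := contDiff_dx hψ
  have h3 : ContDiff ℝ 1 (fun p : ℝ × ℝ => Q p.2) := hQ.comp contDiff_snd
  unfold densLbar
  fun_prop

theorem densL_nonneg {κ : ℝ} (hκ : 0 ≤ κ) (hQ : ∀ x, 0 ≤ Q x) (s x : ℝ) :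
    0 ≤ densL κ Q ψ s x := by
  have := hQ x
  unfold densL
  positivity

theorem densLbar_nonneg {κ : ℝ} (hκ : 0 ≤ κ) (hQ : ∀ x, 0 ≤ Q x) (s x : ℝ) :
    0 ≤ densLbar κ Q ψ s x := by
  have := hQ x
  unfold densLbar
  positivity

/-- The local form of the energy identity: `L̲ (densL) + L (densLbar)` is a multiple of `ψ²` plus
terms containing the source. -/
theorem densL_densLbar_deriv (κ : ℝ) (hQ : ContDiff ℝ 1 Q)
    (hψ : ContDiff ℝ 2 (fun p : ℝ × ℝ => ψ p.1 p.2))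
    (hH : ∀ s x, box ψ s x - Q x * ψ s x = H s x) (s x : ℝ) :
    dt (densL κ Q ψ) s x - dx (densL κ Q ψ) s x + (dt (densLbar κ Q ψ) s x
      + dx (densLbar κ Q ψ) s x)
      = 4 * κ * s * (x * deriv Q x + 2 * Q x) * ψ s x ^ 2
        - 2 * H s x * ((1 + κ * (s + x) ^ 2) * (dt ψ s x + dx ψ s x)
          + (1 + κ * (s - x) ^ 2) * (dt ψ s x - dx ψ s x)) := by
  have dψ := hψ.differentiable (by norm_num)
  have d1 := (contDiff_dt hψ).differentiable (by norm_num)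
  have d2 := (contDiff_dx hψ).differentiable (by norm_num)
  have hQx : HasDerivAt Q (deriv Q x) x := (hQ.differentiable (by norm_num) x).hasDerivAt
  have sq {a : ℝ → ℝ} {a' y : ℝ} (ha : HasDerivAt a a' y) :
      HasDerivAt (fun x => a x ^ 2) (2 * a y * a') y := by
    refine (ha.fun_pow 2).congr_deriv ?_
    push_cast
    ring
  have t1 : HasDerivAt (fun r => 1 + κ * (r + x) ^ 2) (2 * κ * (s + x)) s := by
    refine (((sq ((hasDerivAt_id' s).add_const x)).const_mul κ).const_add 1).congr_deriv ?_
    ring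
  have t2 : HasDerivAt (fun r => 1 + κ * (r - x) ^ 2) (2 * κ * (s - x)) s := by
    refine (((sq ((hasDerivAt_id' s).sub_const x)).const_mul κ).const_add 1).congr_deriv ?_
    ring
  have x1 : HasDerivAt (fun y => 1 + κ * (s + y) ^ 2) (2 * κ * (s + x)) x := by
    refine (((sq ((hasDerivAt_id' x).const_add s)).const_mul κ).const_add 1).congr_deriv ?_
    ring
  have x2 : HasDerivAt (fun y => 1 + κ * (s - y) ^ 2) (-(2 * κ * (s - x))) x := by
    refine (((sq ((hasDerivAt_id' x).const_sub s)).const_mul κ).const_add 1).congr_deriv ?_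
    ring
  have pt := hasDerivAt_dt dψ s x
  have px := hasDerivAt_dx dψ s x
  have ptt := hasDerivAt_dt d1 s x
  have ptx := hasDerivAt_dx d1 s x
  have pxt := hasDerivAt_dt d2 s x
  have pxx := hasDerivAt_dx d2 s x
  rw [dt_dx_eq_dx_dt hψ] at pxt
  have A := ((t1.fun_mul (sq (ptt.fun_add pxt))).fun_add ((t2.mul_const (Q x)).fun_mul (sq pt))).deriv
  have B := ((x1.fun_mul (sq (ptx.fun_add pxx))).fun_add ((x2.fun_mul hQx).fun_mul (sq px))).deriv
  have C := ((t2.fun_mul (sq (ptt.fun_sub pxt))).fun_add ((t1.mul_const (Q x)).fun_mul (sq pt))).deriv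
  have D := ((x2.fun_mul (sq (ptx.fun_sub pxx))).fun_add ((x1.fun_mul hQx).fun_mul (sq px))).deriv
  have hHx := hH s x
  rw [box] at hHx
  rw [dt, dx, dt, dx]
  unfold densL densLbar
  rw [A, B, C, D, ← hHx]
  ring

/-- The energy density of `densL` and `densLbar`, cut off to a backward cone. -/
noncomputable def coneDens (κ : ℝ) (Q : ℝ → ℝ) (ψ : ℝ → ℝ → ℝ) (R s x : ℝ) : ℝ :=
  cone R s x * (densL κ Q ψ s x + densLbar κ Q ψ s x)

/-- The energy cut off to a backward cone. -/
noncomputable def coneEnergy (κ : ℝ) (Q : ℝ → ℝ) (ψ : ℝ → ℝ → ℝ) (R s : ℝ) : ℝ :=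
  ∫ x in -R..R, coneDens κ Q ψ R s x

theorem contDiff_coneDens (κ R : ℝ) (hQ : ContDiff ℝ 1 Q)
    (hψ : ContDiff ℝ 2 (fun p : ℝ × ℝ => ψ p.1 p.2)) :
    ContDiff ℝ 1 (fun p : ℝ × ℝ => coneDens κ Q ψ R p.1 p.2) := by
  have h1 := contDiff_densL κ hQ hψ
  have h2 := contDiff_densLbar κ hQ hψ
  have h3 := contDiff_cone R
  unfold coneDens
  fun_prop

theorem coneDens_nonneg {κ : ℝ} (hκ : 0 ≤ κ) (hQ : ∀ x, 0 ≤ Q x) (R s x : ℝ) :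
    0 ≤ coneDens κ Q ψ R s x :=
  mul_nonneg (cone_nonneg _ _ _) (add_nonneg (densL_nonneg hκ hQ s x) (densLbar_nonneg hκ hQ s x))

theorem integral_dt_coneDens_le {κ : ℝ} (hκ : 0 ≤ κ) (hQ : ContDiff ℝ 1 Q) (hQ0 : ∀ x, 0 ≤ Q x)
    (hψ : ContDiff ℝ 2 (fun p : ℝ × ℝ => ψ p.1 p.2))
    (hH : ∀ s x, box ψ s x - Q x * ψ s x = H s x) (hHc : Continuous (fun p : ℝ × ℝ => H p.1 p.2))
    {R s : ℝ} (hR : 0 ≤ R) (hs : 0 ≤ s) :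
    ∫ x in -R..R, dt (coneDens κ Q ψ R) s x
      ≤ ∫ x in -R..R, cone R s x * (4 * κ * s * (x * deriv Q x + 2 * Q x) * ψ s x ^ 2
        - 2 * H s x * ((1 + κ * (s + x) ^ 2) * (dt ψ s x + dx ψ s x)
          + (1 + κ * (s - x) ^ 2) * (dt ψ s x - dx ψ s x))) := by
  have hL := contDiff_densL κ hQ hψ
  have hLb := contDiff_densLbar κ hQ hψ
  have hc := contDiff_cone R
  have slice {a : ℝ → ℝ → ℝ} (ha : Continuous (fun p : ℝ × ℝ => a p.1 p.2)) : Continuous (a s) :=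
    ha.comp (Continuous.prodMk_right s)
  set J : ℝ → ℝ → ℝ := fun s x => cone R s x * (densLbar κ Q ψ s x - densL κ Q ψ s x) with hJ
  have hJc : ContDiff ℝ 1 (fun p : ℝ × ℝ => J p.1 p.2) := by
    simp only [hJ]
    fun_prop
  have hPc := contDiff_coneDens κ R hQ hψ
  have cJ := slice (continuous_dx hJc)
  have cP := slice (continuous_dt hPc)
  have ftc : ∫ x in -R..R, dx J s x = 0 := by
    rw [intervalIntegral.integral_eq_sub_of_hasDerivAt
      (fun x _ => hasDerivAt_dx (hJc.differentiable (by norm_num)) s x)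
      (cJ.intervalIntegrable _ _)]
    simp only [hJ]
    rw [cone_eq_zero hs (abs_of_nonneg hR), cone_eq_zero hs (by rw [abs_neg, abs_of_nonneg hR])]
    ring
  have h1 : ∫ x in -R..R, dt (coneDens κ Q ψ R) s x
      = ∫ x in -R..R, (dt (coneDens κ Q ψ R) s x + dx J s x) := by
    rw [intervalIntegral.integral_add (cP.intervalIntegrable _ _) (cJ.intervalIntegrable _ _), ftc,
      add_zero]
  rw [h1]
  have c1 := slice hψ.continuous
  have c2 := slice (contDiff_dt hψ).continuous
  have c3 := slice (contDiff_dx hψ).continuous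
  have c4 := slice hc.continuous
  have c5 := slice hHc
  have c6 := hQ.continuous
  have c7 : Continuous (deriv Q) := hQ.continuous_deriv (by norm_num)
  refine intervalIntegral.integral_mono_on (by linarith) ((cP.add cJ).intervalIntegrable _ _)
    ((by fun_prop : Continuous _).intervalIntegrable _ _) fun x _ => ?_
  obtain ⟨α, β, hα, hβ, h2, h3⟩ := exists_cone_deriv R s x
  have t1 := hasDerivAt_dt (hL.differentiable (by norm_num)) s x
  have t2 := hasDerivAt_dt (hLb.differentiable (by norm_num)) s x
  have x1 := hasDerivAt_dx (hL.differentiable (by norm_num)) s x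
  have x2 := hasDerivAt_dx (hLb.differentiable (by norm_num)) s x
  have e1 : dt (coneDens κ Q ψ R) s x = _ := (h2.fun_mul (t1.fun_add t2)).deriv
  have e2 : dx J s x = _ := (h3.fun_mul (x2.fun_sub x1)).deriv
  rw [e1, e2, ← densL_densLbar_deriv κ hQ hψ hH s x]
  have := mul_nonneg hα (densLbar_nonneg (ψ := ψ) hκ hQ0 s x)
  have := mul_nonneg hβ (densL_nonneg (ψ := ψ) hκ hQ0 s x)
  linarith

end Energy

/-! ### Consequences of strong repulsivity -/

/-- The quantitative form in which strong repulsivity enters the estimates. All bounds are uniform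
in `lam`, and `δ₀` is a length at which the critical point is seen from at least one side. -/
structure RepulsiveBounds (Q : ℝ → ℝ) (C c δ₀ lam : ℝ) : Prop where
  C_pos : 0 < C
  c_pos : 0 < c
  δ₀_pos : 0 < δ₀
  δ₀_le : δ₀ ≤ 1 / 8
  lam_nonneg : 0 ≤ lam
  smooth : ContDiff ℝ 1 Q
  nonneg : ∀ x, 0 ≤ Q x
  repulsive : ∀ x, x * deriv Q x ≤ 0
  upper : ∀ x, Q x ≤ C * (1 + lam ^ 2)
  near : ∀ δ, 0 < δ → δ ≤ δ₀ → ∃ a, -(2 * δ) ≤ a ∧ a ≤ δ ∧ ∀ x ∈ Set.Icc a (a + δ),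
    δ ^ 2 ≤ x ^ 2 ∧ C⁻¹ ≤ Q x ∧ (1 + lam ^ 2) * x ^ 2 ≤ -(C * x * deriv Q x)
  outer : ∀ s x, 0 ≤ s → 1 + s ^ 2 ≤ 16 * x ^ 2 → s * (x * deriv Q x + 2 * Q x) ≤ c * Q x
  inner : ∀ ε x, 0 ≤ ε → ε ≤ 1 → δ₀ ^ 2 / (1 + lam) ≤ x ^ 2 →
    x * deriv Q x + 2 * Q x ≤ -(c * (1 + lam) * (mult ε x * deriv Q x))

theorem le_apply_zero {Q : ℝ → ℝ} (hQ : ContDiff ℝ 1 Q) (h : ∀ x, x * deriv Q x ≤ 0) (x : ℝ) :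
    Q x ≤ Q 0 := by
  have hd := hQ.differentiable (by norm_num)
  rcases le_total 0 x with hx | hx
  · refine antitoneOn_of_deriv_nonpos (convex_Ici 0) hQ.continuous.continuousOn
      hd.differentiableOn (fun y hy => ?_) Set.self_mem_Ici hx hx
    rw [interior_Ici, Set.mem_Ioi] at hy
    exact nonpos_of_mul_nonpos_right (h y) hy
  · refine monotoneOn_of_deriv_nonneg (convex_Iic 0) hQ.continuous.continuousOn
      hd.differentiableOn (fun y hy => ?_) hx Set.self_mem_Iic hx
    rw [interior_Iic, Set.mem_Iio] at hy
    nlinarith [h y]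

theorem deriv_zero_eq_zero {Q : ℝ → ℝ} (hQ : ContDiff ℝ 1 Q) (h : ∀ x, x * deriv Q x ≤ 0) :
    deriv Q 0 = 0 := by
  have : IsLocalMax Q 0 := Filter.Eventually.of_forall (le_apply_zero hQ h)
  exact this.deriv_eq_zero

/-- The interval `B₁` cannot degenerate to the origin: `Q'(0) = 0` and `Q(0) > 0` would contradict
the repulsivity condition just outside. -/
theorem StronglyRepulsive.length_pos {Q : ℝ → ℝ} {C lam a₁ b₁ : ℝ} {B₂ : Set ℝ} (hC : 0 < C)
    (ha : a₁ ≤ 0) (hb : 0 ≤ b₁) (hQ : ContDiff ℝ 1 Q)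
    (h : StronglyRepulsive Q C lam (Set.Icc a₁ b₁) B₂) : 0 < b₁ - a₁ := by
  by_contra hle
  have hb0 : b₁ = 0 := by linarith
  have hrep (x : ℝ) : x * deriv Q x ≤ 0 := by linarith [h.repulsive_one x]
  have hQ0 : C⁻¹ ≤ Q 0 := (h.local_bounds 0
    ⟨0, ⟨ha, hb⟩, by simp⟩).1
  have hcQ' : Continuous (deriv Q) := hQ.continuous_deriv (by norm_num)
  have hev : ∀ x ∈ Set.Ioi (0 : ℝ), x * deriv Q x + 2 * Q x + C * deriv Q x ≤ 0 := by
    intro x hx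
    have := h.repulsive_two x (by rw [hb0]; exact fun hx' => not_lt.2 hx'.2 hx)
    rw [Real.sign_of_pos hx] at this
    linarith
  have hcont : Continuous fun x => x * deriv Q x + 2 * Q x + C * deriv Q x := by
    have := hQ.continuous
    fun_prop
  have h0 : 0 * deriv Q 0 + 2 * Q 0 + C * deriv Q 0 ≤ 0 := by
    have hcl : (0 : ℝ) ∈ closure (Set.Ioi 0) := by rw [closure_Ioi]; exact Set.self_mem_Ici
    exact closure_minimal hev (isClosed_le hcont continuous_const) hcl
  rw [deriv_zero_eq_zero hQ hrep] at h0
  have : 0 < C⁻¹ := inv_pos.2 hC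
  linarith

theorem mem_two_smul_Icc {a b x : ℝ} : x ∈ (2 : ℝ) • Set.Icc a b ↔ 2 * a ≤ x ∧ x ≤ 2 * b := by
  constructor
  · rintro ⟨y, ⟨h1, h2⟩, rfl⟩
    simp only [smul_eq_mul]
    constructor <;> linarith
  · rintro ⟨h1, h2⟩
    exact ⟨x / 2, ⟨by linarith, by linarith⟩, by simp only [smul_eq_mul]; ring⟩

theorem StronglyRepulsive.repulsiveBounds {Q : ℝ → ℝ} {C lam a₁ b₁ a₂ b₂ δ₀ c : ℝ} (hC : 0 < C)
    (hlam : 0 ≤ lam) (ha₁ : a₁ ≤ 0) (hb₁ : 0 ≤ b₁) (ha₂ : a₂ ≤ 0) (hb₂ : 0 ≤ b₂)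
    (hQ : ContDiff ℝ 1 Q) (h : StronglyRepulsive Q C lam (Set.Icc a₁ b₁) (Set.Icc a₂ b₂))
    (hδ₀ : 0 < δ₀) (hδ₀' : δ₀ ≤ 1 / 8) (hδ₁ : 2 * δ₀ ≤ b₁ - a₁)
    (hc₁ : 4 * C + 8 * (b₂ - a₂) ≤ c) (hc₂ : 2 * C / δ₀ ≤ c)
    (hc₃ : 2 * C ^ 2 / δ₀ ^ 2 * (1 + (b₁ - a₁)) ≤ c) :
    RepulsiveBounds Q C c δ₀ lam where
  C_pos := hC
  c_pos := by linarith
  δ₀_pos := hδ₀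
  δ₀_le := hδ₀'
  lam_nonneg := hlam
  smooth := hQ
  nonneg := h.positivity
  repulsive x := by linarith [h.repulsive_one x]
  upper x := (le_apply_zero hQ (fun x => by linarith [h.repulsive_one x]) x).trans
    (h.local_bounds 0 (mem_two_smul_Icc.2 ⟨by linarith, by linarith⟩)).2
  near δ hδ hδ' := by
    rcases le_total ((b₁ - a₁) / 2) b₁ with hb | hb
    · refine ⟨δ, by linarith, le_rfl, fun x hx => ⟨by nlinarith [hx.1], ?_⟩⟩
      have hx' : x ∈ (2 : ℝ) • Set.Icc a₁ b₁ :=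
        mem_two_smul_Icc.2 ⟨by linarith [hx.1], by linarith [hx.2]⟩
      exact ⟨(h.local_bounds x hx').1, h.critical_point x hx'⟩
    · refine ⟨-(2 * δ), le_rfl, by linarith, fun x hx => ⟨by nlinarith [hx.2], ?_⟩⟩
      have hx' : x ∈ (2 : ℝ) • Set.Icc a₁ b₁ :=
        mem_two_smul_Icc.2 ⟨by linarith [hx.1], by linarith [hx.2]⟩
      exact ⟨(h.local_bounds x hx').1, h.critical_point x hx'⟩
  outer s x hs hsx := by
    have hQx := h.positivity x
    have hrep := h.repulsive_one x
    have hs4 : s ≤ 4 * |x| := by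
      refine abs_le_of_sq_le_sq' ?_ (by positivity) |>.2
      rw [mul_pow, sq_abs]
      linarith
    by_cases hx : x ∈ Set.Icc a₂ b₂
    · have hx2 : |x| ≤ b₂ - a₂ := abs_le.2 ⟨by linarith [hx.1], by linarith [hx.2]⟩
      have h1 : s * (x * deriv Q x + 2 * Q x) ≤ s * (2 * Q x) := by gcongr; linarith
      have h2 : s * (2 * Q x) ≤ 8 * (b₂ - a₂) * Q x := by nlinarith
      have h3 : 8 * (b₂ - a₂) * Q x ≤ c * Q x := by gcongr; linarith
      linarith
    · have hx0 : 0 < |x| := abs_pos.2 fun h0 => by subst h0; nlinarith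
      have h1 : s * (x * deriv Q x + 2 * Q x) ≤ s * (C * |x|⁻¹ * Q x) := by
        gcongr
        exact h.homogeneity x hx
      have h2 : s * (C * |x|⁻¹ * Q x) ≤ 4 * |x| * (C * |x|⁻¹ * Q x) := by gcongr
      have h3 : 4 * |x| * (C * |x|⁻¹ * Q x) = 4 * C * Q x := by field_simp
      have h4 : 4 * C * Q x ≤ c * Q x := by gcongr; linarith
      linarith
  inner ε x hε hε1 hx := by
    have hQx := h.positivity x
    have hrep := h.repulsive_one x
    have hl : 1 ≤ 1 + lam := by linarith
    have hl0 : 0 < 1 + lam := by linarith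
    have hz : 0 < 1 + ε * |x| := by positivity
    have hz1 : 1 + ε * |x| ≤ 1 + |x| := by nlinarith [abs_nonneg x]
    -- `w` is the nonnegative quantity `-mult ε x * Q' x`, in terms of which both cases are bounded
    obtain ⟨w, hw⟩ : ∃ w, w = -(mult ε x * deriv Q x) := ⟨_, rfl⟩
    have hxw : -(x * deriv Q x) = (1 + ε * |x|) * w := by
      rw [hw, mult]
      field_simp
    have hw0 : 0 ≤ w := by
      by_contra hneg
      nlinarith [mul_pos hz (by linarith : 0 < -w)]
    have hδx : δ₀ ^ 2 ≤ (1 + lam) * x ^ 2 := by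
      rw [div_le_iff₀ hl0] at hx
      linarith
    suffices hs : x * deriv Q x + 2 * Q x ≤ c * (1 + lam) * w by
      rw [hw] at hs
      linarith
    by_cases hxB : x ∈ Set.Icc a₁ b₁
    · have hx' : x ∈ (2 : ℝ) • Set.Icc a₁ b₁ :=
        mem_two_smul_Icc.2 ⟨by linarith [hxB.1], by linarith [hxB.2]⟩
      have hx1 : |x| ≤ b₁ - a₁ := abs_le.2 ⟨by linarith [hxB.1], by linarith [hxB.2]⟩
      have h1 := (h.local_bounds x hx').2
      have h2 := h.critical_point x hx'
      have h3 : 1 ≤ (1 + lam) * x ^ 2 / δ₀ ^ 2 := by rwa [le_div_iff₀ (by positivity), one_mul]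
      calc x * deriv Q x + 2 * Q x ≤ 2 * (C * (1 + lam ^ 2)) * 1 := by linarith
        _ ≤ 2 * (C * (1 + lam ^ 2)) * ((1 + lam) * x ^ 2 / δ₀ ^ 2) := by gcongr
        _ = 2 * C * (1 + lam) / δ₀ ^ 2 * ((1 + lam ^ 2) * x ^ 2) := by ring
        _ ≤ 2 * C * (1 + lam) / δ₀ ^ 2 * (-(C * x * deriv Q x)) := by gcongr
        _ = 2 * C * (1 + lam) / δ₀ ^ 2 * (C * ((1 + ε * |x|) * w)) := by rw [← hxw]; ring
        _ ≤ 2 * C * (1 + lam) / δ₀ ^ 2 * (C * ((1 + (b₁ - a₁)) * w)) := by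
            gcongr
            linarith
        _ = 2 * C ^ 2 / δ₀ ^ 2 * (1 + (b₁ - a₁)) * (1 + lam) * w := by ring
        _ ≤ c * (1 + lam) * w := by gcongr
    · have h1 := h.repulsive_two x hxB
      have hx0 : x ≠ 0 := fun h0 => hxB (by rw [h0]; exact ⟨ha₁, hb₁⟩)
      have hxp : 0 < |x| := abs_pos.2 hx0
      have hsg : Real.sign x * |x| = x := by
        rcases lt_or_gt_of_ne hx0 with h0 | h0
        · rw [Real.sign_of_neg h0, abs_of_neg h0]; ring
        · rw [Real.sign_of_pos h0, abs_of_pos h0]; ring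
      have h2 : -(C * Real.sign x * deriv Q x) = C * ((1 + ε * |x|) / |x| * w) := by
        have : -(Real.sign x * deriv Q x) = (1 + ε * |x|) / |x| * w := by
          rw [div_mul_eq_mul_div, ← hxw, eq_div_iff hxp.ne']
          calc -(Real.sign x * deriv Q x) * |x| = -((Real.sign x * |x|) * deriv Q x) := by ring
            _ = _ := by rw [hsg]
        linear_combination C * this
      -- `|x| ≥ δ₀ / (1 + λ)` turns `(1 + ε |x|) / |x|` into `2 (1 + λ) / δ₀`
      have h3 : δ₀ ≤ (1 + lam) * |x| := by
        refine abs_le_of_sq_le_sq' ?_ (by positivity) |>.2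
        rw [mul_pow, sq_abs]
        nlinarith [sq_nonneg x]
      have h4 : (1 + ε * |x|) / |x| ≤ 2 * (1 + lam) / δ₀ := by
        rw [div_le_div_iff₀ hxp hδ₀]
        nlinarith
      calc x * deriv Q x + 2 * Q x ≤ C * ((1 + ε * |x|) / |x| * w) := by rw [← h2]; exact h1
        _ ≤ C * (2 * (1 + lam) / δ₀ * w) := by gcongr
        _ = 2 * C / δ₀ * (1 + lam) * w := by ring
        _ ≤ c * (1 + lam) * w := by gcongr

/-! ### A cutoff to the interior of the light cone -/

/-- A smooth function equal to `1` on `y ≤ 1 / 16` and vanishing for `y ≥ 1 / 5`. -/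
noncomputable def bump (y : ℝ) : ℝ := Real.smoothTransition (8 * (1 / 5 - y))

/-- A cutoff to `|x| ≤ √(1 + s²) / 2`, a region in which `u` and `u̲` are both of size `s`. -/
noncomputable def inCone (s x : ℝ) : ℝ := bump (x ^ 2 / (1 + s ^ 2))

theorem contDiff_bump : ContDiff ℝ 2 bump :=
  (Real.smoothTransition.contDiff (n := 2)).comp (by fun_prop)

theorem contDiff_inCone : ContDiff ℝ 2 (fun p : ℝ × ℝ => inCone p.1 p.2) := by
  refine contDiff_bump.comp ?_
  refine ContDiff.div (by fun_prop) (by fun_prop) fun p => by positivity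

theorem inCone_nonneg (s x : ℝ) : 0 ≤ inCone s x := Real.smoothTransition.nonneg _

theorem inCone_le_one (s x : ℝ) : inCone s x ≤ 1 := Real.smoothTransition.le_one _

theorem inCone_eq_one {s x : ℝ} (h : 16 * x ^ 2 ≤ 1 + s ^ 2) : inCone s x = 1 := by
  have : x ^ 2 / (1 + s ^ 2) ≤ 1 / 16 := by
    rw [div_le_div_iff₀ (by positivity) (by norm_num)]
    linarith
  exact Real.smoothTransition.one_of_one_le (by linarith)

theorem hasDerivAt_bump (y : ℝ) : HasDerivAt bump (deriv bump y) y :=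
  (contDiff_bump.differentiable (by norm_num) y).hasDerivAt

theorem contDiff_deriv_bump : ContDiff ℝ 1 (deriv bump) :=
  ((contDiff_succ_iff_deriv (n := 1)).1 contDiff_bump).2.2

theorem hasDerivAt_deriv_bump (y : ℝ) : HasDerivAt (deriv bump) (deriv (deriv bump) y) y :=
  (contDiff_deriv_bump.differentiable (by norm_num) y).hasDerivAt

theorem hasDerivAt_ratio_time (s x : ℝ) :
    HasDerivAt (fun r => x ^ 2 / (1 + r ^ 2)) (-(2 * s * x ^ 2 / (1 + s ^ 2) ^ 2)) s := by
  have h : HasDerivAt (fun r : ℝ => 1 + r ^ 2) (2 * s) s := by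
    refine (((hasDerivAt_id' s).fun_pow 2).const_add 1).congr_deriv ?_
    push_cast
    ring
  refine ((hasDerivAt_const s (x ^ 2)).fun_div h (by positivity)).congr_deriv ?_
  field_simp
  ring

theorem hasDerivAt_ratio_space (s x : ℝ) :
    HasDerivAt (fun y => y ^ 2 / (1 + s ^ 2)) (2 * x / (1 + s ^ 2)) x := by
  refine (((hasDerivAt_id' x).fun_pow 2).div_const _).congr_deriv ?_
  push_cast
  ring

theorem dt_inCone (s x : ℝ) :
    dt inCone s x = deriv bump (x ^ 2 / (1 + s ^ 2)) * -(2 * s * x ^ 2 / (1 + s ^ 2) ^ 2) :=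
  ((hasDerivAt_bump _).comp s (hasDerivAt_ratio_time s x)).deriv

theorem dx_inCone (s x : ℝ) :
    dx inCone s x = deriv bump (x ^ 2 / (1 + s ^ 2)) * (2 * x / (1 + s ^ 2)) :=
  ((hasDerivAt_bump _).comp x (hasDerivAt_ratio_space s x)).deriv

theorem box_inCone (s x : ℝ) :
    box inCone s x = deriv (deriv bump) (x ^ 2 / (1 + s ^ 2))
        * ((2 * x / (1 + s ^ 2)) ^ 2 - (2 * s * x ^ 2 / (1 + s ^ 2) ^ 2) ^ 2)
      + deriv bump (x ^ 2 / (1 + s ^ 2)) * (2 / (1 + s ^ 2) + 2 * x ^ 2 / (1 + s ^ 2) ^ 2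
        - 8 * s ^ 2 * x ^ 2 / (1 + s ^ 2) ^ 3) := by
  have e1 : dt (dt inCone) s x = deriv (deriv bump) (x ^ 2 / (1 + s ^ 2))
      * -(2 * s * x ^ 2 / (1 + s ^ 2) ^ 2) * -(2 * s * x ^ 2 / (1 + s ^ 2) ^ 2)
      + deriv bump (x ^ 2 / (1 + s ^ 2))
        * -(2 * x ^ 2 / (1 + s ^ 2) ^ 2 - 8 * s ^ 2 * x ^ 2 / (1 + s ^ 2) ^ 3) := by
    rw [show dt inCone = _ from funext₂ dt_inCone]
    have h : HasDerivAt (fun r : ℝ => 1 + r ^ 2) (2 * s) s := by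
      refine (((hasDerivAt_id' s).fun_pow 2).const_add 1).congr_deriv ?_
      push_cast
      ring
    have h2 : HasDerivAt (fun r => -(2 * r * x ^ 2 / (1 + r ^ 2) ^ 2))
        (-(2 * x ^ 2 / (1 + s ^ 2) ^ 2 - 8 * s ^ 2 * x ^ 2 / (1 + s ^ 2) ^ 3)) s := by
      refine ((((hasDerivAt_id' s).const_mul 2).mul_const (x ^ 2)).fun_div (h.fun_pow 2)
        (by positivity)).fun_neg.congr_deriv ?_
      push_cast
      field_simp
      ring
    exact (((hasDerivAt_deriv_bump _).comp s (hasDerivAt_ratio_time s x)).fun_mul h2).deriv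
  have e2 : dx (dx inCone) s x = deriv (deriv bump) (x ^ 2 / (1 + s ^ 2))
      * (2 * x / (1 + s ^ 2)) * (2 * x / (1 + s ^ 2))
      + deriv bump (x ^ 2 / (1 + s ^ 2)) * (2 / (1 + s ^ 2)) := by
    rw [show dx inCone = _ from funext₂ dx_inCone]
    have h2 : HasDerivAt (fun y => 2 * y / (1 + s ^ 2)) (2 / (1 + s ^ 2)) x := by
      refine (((hasDerivAt_id' x).const_mul 2).div_const (1 + s ^ 2)).congr_deriv ?_
      ring
    exact (((hasDerivAt_deriv_bump _).comp x (hasDerivAt_ratio_space s x)).fun_mul h2).deriv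
  rw [box, e1, e2]
  ring

theorem inCone_eq_zero {s x : ℝ} (h : 1 + s ^ 2 ≤ 4 * x ^ 2) :
    inCone s x = 0 ∧ dt inCone s x = 0 ∧ dx inCone s x = 0 ∧ box inCone s x = 0 := by
  have hy : 1 / 5 < x ^ 2 / (1 + s ^ 2) := by
    rw [div_lt_div_iff₀ (by norm_num) (by positivity)]
    nlinarith [sq_nonneg s]
  have h0 (y : ℝ) (hy : 1 / 5 < y) : bump y = 0 :=
    Real.smoothTransition.zero_of_nonpos (by linarith)
  have h1 (y : ℝ) (hy : 1 / 5 < y) : deriv bump y = 0 := by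
    have : bump =ᶠ[nhds y] fun _ => 0 := by
      filter_upwards [lt_mem_nhds hy] with z hz using h0 z hz
    rw [this.deriv_eq, deriv_const]
  have h2 (y : ℝ) (hy : 1 / 5 < y) : deriv (deriv bump) y = 0 := by
    have : deriv bump =ᶠ[nhds y] fun _ => 0 := by
      filter_upwards [lt_mem_nhds hy] with z hz using h1 z hz
    rw [this.deriv_eq, deriv_const]
  refine ⟨h0 _ hy, ?_, ?_, ?_⟩
  · rw [dt_inCone, h1 _ hy, zero_mul]
  · rw [dx_inCone, h1 _ hy, zero_mul]
  · rw [box_inCone, h1 _ hy, h2 _ hy, zero_mul, zero_mul, zero_add]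

theorem exists_inCone_bound : ∃ K : ℝ, 0 < K ∧ ∀ s x : ℝ, 4 * x ^ 2 ≤ 1 + s ^ 2 →
    dt inCone s x ^ 2 ≤ K / (1 + s ^ 2) ∧ dx inCone s x ^ 2 ≤ K / (1 + s ^ 2) ∧
      box inCone s x ^ 2 ≤ K / (1 + s ^ 2) ^ 2 := by
  obtain ⟨K1, hK1⟩ := (isCompact_Icc (a := (0 : ℝ)) (b := 1)).exists_bound_of_continuousOn
    contDiff_deriv_bump.continuous.continuousOn
  obtain ⟨K2, hK2⟩ := (isCompact_Icc (a := (0 : ℝ)) (b := 1)).exists_bound_of_continuousOn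
    (contDiff_deriv_bump.continuous_deriv (by norm_num)).continuousOn
  obtain ⟨K, hK1', hK2', hK⟩ : ∃ K, K1 ≤ K ∧ K2 ≤ K ∧ 0 < K :=
    ⟨max (max K1 K2) 1, by simp, by simp, by positivity⟩
  refine ⟨100 * K ^ 2, by positivity, fun s x hx => ?_⟩
  obtain ⟨T, hT⟩ : ∃ T, T = 1 + s ^ 2 := ⟨_, rfl⟩
  have hT1 : 0 < T := by rw [hT]; positivity
  -- in terms of `y = x² / T ∈ [0, 1 / 4]` and `z = s² / T ∈ [0, 1]` all derivatives are polynomial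
  obtain ⟨y, hy⟩ : ∃ y, y = x ^ 2 / T := ⟨_, rfl⟩
  obtain ⟨z, hz⟩ : ∃ z, z = s ^ 2 / T := ⟨_, rfl⟩
  have hy0 : 0 ≤ y := by rw [hy]; positivity
  have hz0 : 0 ≤ z := by rw [hz]; positivity
  have hy1 : y ≤ 1 / 4 := by
    rw [hy, div_le_div_iff₀ hT1 (by norm_num), hT]
    linarith
  have hz1 : z ≤ 1 := by rw [hz, div_le_one hT1, hT]; linarith
  have ex : x ^ 2 = y * T := by rw [hy]; field_simp
  have es : s ^ 2 = z * T := by rw [hz]; field_simp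
  have b1 : |deriv bump y| ≤ K := (hK1 y ⟨hy0, by linarith⟩).trans hK1'
  have b2 : |deriv (deriv bump) y| ≤ K := (hK2 y ⟨hy0, by linarith⟩).trans hK2'
  have b1' : deriv bump y ^ 2 ≤ K ^ 2 := sq_le_sq' (abs_le.1 b1).1 (abs_le.1 b1).2
  rw [dt_inCone, dx_inCone, box_inCone, ← hT, ← hy]
  generalize deriv bump y = p at b1 b1'
  generalize deriv (deriv bump) y = q at b2
  have hyy : y ^ 2 ≤ 1 := by nlinarith
  have hzy : z * y ^ 2 ≤ 1 := by nlinarith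
  refine ⟨?_, ?_, ?_⟩
  · have e : (p * -(2 * s * x ^ 2 / T ^ 2)) ^ 2 = p ^ 2 * (4 * (z * y ^ 2)) / T := by
      calc (p * -(2 * s * x ^ 2 / T ^ 2)) ^ 2 = p ^ 2 * (4 * s ^ 2 * (x ^ 2) ^ 2 / T ^ 4) := by ring
        _ = _ := by rw [ex, es]; field_simp
    rw [e]
    refine div_le_div_of_nonneg_right ?_ hT1.le
    nlinarith [sq_nonneg p, mul_nonneg hz0 (sq_nonneg y)]
  · have e : (p * (2 * x / T)) ^ 2 = p ^ 2 * (4 * y) / T := by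
      calc (p * (2 * x / T)) ^ 2 = p ^ 2 * (4 * x ^ 2 / T ^ 2) := by ring
        _ = _ := by rw [ex]; field_simp
    rw [e]
    refine div_le_div_of_nonneg_right ?_ hT1.le
    nlinarith [sq_nonneg p]
  · have e : q * ((2 * x / T) ^ 2 - (2 * s * x ^ 2 / T ^ 2) ^ 2)
        + p * (2 / T + 2 * x ^ 2 / T ^ 2 - 8 * s ^ 2 * x ^ 2 / T ^ 3)
        = (q * (4 * y - 4 * (z * y ^ 2)) + p * (2 + 2 * y - 8 * (z * y))) / T := by
      calc _ = q * (4 * x ^ 2 / T ^ 2 - 4 * s ^ 2 * (x ^ 2) ^ 2 / T ^ 4)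
            + p * (2 / T + 2 * x ^ 2 / T ^ 2 - 8 * s ^ 2 * x ^ 2 / T ^ 3) := by ring
        _ = _ := by rw [ex, es]; field_simp
    rw [e, div_pow]
    gcongr
    have h1 : |4 * y - 4 * (z * y ^ 2)| ≤ 4 := by
      rw [abs_le]; constructor <;> nlinarith [mul_nonneg hz0 (sq_nonneg y)]
    have h2 : |2 + 2 * y - 8 * (z * y)| ≤ 6 := by
      rw [abs_le]; constructor <;> nlinarith [mul_nonneg hz0 hy0]
    have h3 : |q * (4 * y - 4 * (z * y ^ 2)) + p * (2 + 2 * y - 8 * (z * y))| ≤ 10 * K := by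
      calc _ ≤ |q| * |4 * y - 4 * (z * y ^ 2)| + |p| * |2 + 2 * y - 8 * (z * y)| := by
            rw [← abs_mul, ← abs_mul]; exact abs_add_le _ _
        _ ≤ K * 4 + K * 6 := by gcongr
        _ = 10 * K := by ring
    calc _ ≤ (10 * K) ^ 2 := sq_le_sq' (abs_le.1 h3).1 (abs_le.1 h3).2
      _ = 100 * K ^ 2 := by ring

/-! ### Coercivity of the Morawetz bulk term -/

/-- The bulk term of the Morawetz estimate with multiplier `mult ε`. -/
noncomputable def bulk (ε : ℝ) (Q g g' : ℝ → ℝ) (x : ℝ) : ℝ :=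
  mult' ε x * g' x ^ 2 - mult ε x * deriv Q x * g x ^ 2

theorem integral_le_of_le_on {A n : ℝ → ℝ} (hA : Continuous A) (hn : Continuous n) {ρ R : ℝ}
    (hρ : 0 ≤ ρ) (hR : ρ ≤ R) (h1 : ∀ x, |x| ≤ ρ → A x ≤ n x) (h2 : ∀ x, ρ ≤ |x| → A x ≤ 0) :
    ∫ x in -R..R, A x ≤ ∫ x in -ρ..ρ, n x := by
  have i (a b : ℝ) : IntervalIntegrable A volume a b := hA.intervalIntegrable a b
  rw [← intervalIntegral.integral_add_adjacent_intervals (i (-R) (-ρ)) (i (-ρ) R),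
    ← intervalIntegral.integral_add_adjacent_intervals (i (-ρ) ρ) (i ρ R)]
  have e0 (a b : ℝ) : ∫ _ in a..b, (0 : ℝ) = 0 := by simp
  have l1 : ∫ x in -R..-ρ, A x ≤ 0 := by
    rw [← e0 (-R) (-ρ)]
    refine intervalIntegral.integral_mono_on (by linarith) (i _ _)
      (continuous_const.intervalIntegrable _ _) fun x hx => h2 x ?_
    rw [abs_of_nonpos (by linarith [hx.2])]
    linarith [hx.2]
  have l2 : ∫ x in ρ..R, A x ≤ 0 := by
    rw [← e0 ρ R]
    refine intervalIntegral.integral_mono_on hR (i _ _)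
      (continuous_const.intervalIntegrable _ _) fun x hx => h2 x ?_
    exact hx.1.trans (le_abs_self x)
  have l3 : ∫ x in -ρ..ρ, A x ≤ ∫ x in -ρ..ρ, n x :=
    intervalIntegral.integral_mono_on (by linarith) (i _ _) (hn.intervalIntegrable _ _)
      fun x hx => h1 x (abs_le.2 hx)
  linarith

theorem integral_le_integral_of_subset {f : ℝ → ℝ} (hf : Continuous f) (h0 : ∀ x, 0 ≤ f x)
    {a b c d : ℝ} (h1 : c ≤ a) (h2 : a ≤ b) (h3 : b ≤ d) :
    ∫ x in a..b, f x ≤ ∫ x in c..d, f x :=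
  intervalIntegral.integral_mono_interval h1 h2 h3 (Filter.Eventually.of_forall h0)
    (hf.intervalIntegrable _ _)

namespace RepulsiveBounds

variable {Q : ℝ → ℝ} {C c δ₀ lam ε : ℝ}

theorem neg_mult_nonneg (hB : RepulsiveBounds Q C c δ₀ lam) (hε : 0 ≤ ε) (x : ℝ) :
    0 ≤ -(mult ε x * deriv Q x) := by
  have := mult_mul_nonpos hε hB.repulsive x
  linarith

theorem bulk_nonneg (hB : RepulsiveBounds Q C c δ₀ lam) (hε : 0 ≤ ε) (g g' : ℝ → ℝ) (x : ℝ) :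
    0 ≤ bulk ε Q g g' x := by
  have h1 := mul_nonneg (hB.neg_mult_nonneg hε x) (sq_nonneg (g x))
  have h2 := mul_nonneg (mult'_nonneg ε x) (sq_nonneg (g' x))
  rw [bulk]
  linarith

theorem continuous_deriv (hB : RepulsiveBounds Q C c δ₀ lam) : Continuous (deriv Q) :=
  hB.smooth.continuous_deriv (by norm_num)

theorem continuous_bulk (hB : RepulsiveBounds Q C c δ₀ lam) (hε : 0 ≤ ε) {g g' : ℝ → ℝ}
    (hg : Continuous g) (hg' : Continuous g') : Continuous (bulk ε Q g g') := by
  have h1 := continuous_mult hε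
  have h2 := continuous_mult' hε
  have h3 := hB.continuous_deriv
  unfold bulk
  fun_prop

/-- The bulk term controls the values of `g` close to the critical point. With `δ` of size
`(1 + lam) ^ (-1 / 2)` this is the uncertainty principle for a harmonic oscillator. -/
theorem sq_le_integral_bulk (hB : RepulsiveBounds Q C c δ₀ lam) (hε : 0 ≤ ε) (hε1 : ε ≤ 1)
    {g g' : ℝ → ℝ} (hg : ∀ x, HasDerivAt g (g' x) x) (hg' : Continuous g') {δ R x : ℝ}
    (hδ : 0 < δ) (hδ' : δ ≤ δ₀) (hR : 2 * δ ≤ R) (hx : |x| ≤ δ) :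
    g x ^ 2 ≤ (4 * C / (δ ^ 3 * (1 + lam ^ 2)) + 24 * δ) * ∫ y in -R..R, bulk ε Q g g' y := by
  have cg : Continuous g := continuous_iff_continuousAt.2 fun x => (hg x).continuousAt
  have cb := hB.continuous_bulk hε cg hg'
  have b0 := hB.bulk_nonneg hε g g'
  have hδ8 := hB.δ₀_le
  have hC := hB.C_pos
  obtain ⟨a, ha1, ha2, ha⟩ := hB.near δ hδ hδ'
  have h := sq_le_integral_sq_add hg hg' hδ ha1 ha2 hx
  have hz1 {y : ℝ} (hy : |y| ≤ 2 * δ) : 1 + ε * |y| ≤ 2 := by nlinarith [abs_nonneg y]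
  have hz0 (y : ℝ) : 0 < 1 + ε * |y| := by positivity
  have j1 : ∫ y in a..a + δ, g y ^ 2
      ≤ 2 * C / (δ ^ 2 * (1 + lam ^ 2)) * ∫ y in -R..R, bulk ε Q g g' y := by
    have l1 : ∫ y in a..a + δ, g y ^ 2
        ≤ ∫ y in a..a + δ, 2 * C / (δ ^ 2 * (1 + lam ^ 2)) * bulk ε Q g g' y := by
      refine intervalIntegral.integral_mono_on (by linarith)
        ((cg.pow 2).intervalIntegrable _ _) ((cb.const_mul _).intervalIntegrable _ _)
        fun y hy => ?_
      obtain ⟨e1, -, e3⟩ := ha y hy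
      have hy2 : |y| ≤ 2 * δ := abs_le.2 ⟨by linarith [hy.1], by linarith [hy.2]⟩
      have e4 := hB.neg_mult_nonneg hε y
      have e5 : -(C * y * deriv Q y) = C * ((1 + ε * |y|) * -(mult ε y * deriv Q y)) := by
        rw [mult]
        have := (hz0 y).ne'
        field_simp
      have e6 : (1 + lam ^ 2) * δ ^ 2 ≤ C * (2 * -(mult ε y * deriv Q y)) := by
        calc (1 + lam ^ 2) * δ ^ 2 ≤ (1 + lam ^ 2) * y ^ 2 := by gcongr
          _ ≤ C * ((1 + ε * |y|) * -(mult ε y * deriv Q y)) := by rw [← e5]; exact e3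
          _ ≤ _ := by
            gcongr
            exact hz1 hy2
      have e7 : -(mult ε y * deriv Q y) * g y ^ 2 ≤ bulk ε Q g g' y := by
        have := mul_nonneg (mult'_nonneg ε y) (sq_nonneg (g' y))
        rw [bulk]
        linarith
      rw [div_mul_eq_mul_div, le_div_iff₀ (by positivity)]
      calc g y ^ 2 * (δ ^ 2 * (1 + lam ^ 2)) = ((1 + lam ^ 2) * δ ^ 2) * g y ^ 2 := by ring
        _ ≤ C * (2 * -(mult ε y * deriv Q y)) * g y ^ 2 := by gcongr
        _ = 2 * C * (-(mult ε y * deriv Q y) * g y ^ 2) := by ring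
        _ ≤ 2 * C * bulk ε Q g g' y := by gcongr
    rw [intervalIntegral.integral_const_mul] at l1
    refine l1.trans ?_
    gcongr
    exact integral_le_integral_of_subset cb b0 (by linarith) (by linarith) (by linarith)
  have j2 : ∫ y in -(2 * δ)..2 * δ, g' y ^ 2 ≤ 4 * ∫ y in -R..R, bulk ε Q g g' y := by
    have l1 : ∫ y in -(2 * δ)..2 * δ, g' y ^ 2 ≤ ∫ y in -(2 * δ)..2 * δ, 4 * bulk ε Q g g' y := by
      refine intervalIntegral.integral_mono_on (by linarith)
        ((hg'.pow 2).intervalIntegrable _ _) ((cb.const_mul _).intervalIntegrable _ _)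
        fun y hy => ?_
      have hy2 := hz1 (abs_le.2 hy)
      have e1 : 1 / 4 ≤ mult' ε y := by
        rw [mult']
        have := hz0 y
        apply one_div_le_one_div_of_le (by positivity)
        nlinarith
      have e2 := mul_nonneg (hB.neg_mult_nonneg hε y) (sq_nonneg (g y))
      have e3 := mul_le_mul_of_nonneg_right e1 (sq_nonneg (g' y))
      rw [bulk]
      linarith
    rw [intervalIntegral.integral_const_mul] at l1
    refine l1.trans ?_
    gcongr
    exact integral_le_integral_of_subset cb b0 (by linarith) (by linarith) (by linarith)
  calc g x ^ 2 ≤ _ := h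
    _ ≤ 2 / δ * (2 * C / (δ ^ 2 * (1 + lam ^ 2)) * ∫ y in -R..R, bulk ε Q g g' y)
        + 6 * δ * (4 * ∫ y in -R..R, bulk ε Q g g' y) := by gcongr
    _ = _ := by
      field_simp
      ring

/-- Hardy's inequality, where the lower bound for `Q` on an interval replaces the vanishing of `g`
at the origin. -/
theorem hardy (hB : RepulsiveBounds Q C c δ₀ lam) {g g' : ℝ → ℝ}
    (hg : ∀ x, HasDerivAt g (g' x) x) (hg' : Continuous g') {ρ : ℝ} (hρ : 1 / 2 ≤ ρ) :
    ∫ x in -ρ..ρ, g x ^ 2 / (1 + |x|) ^ 2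
      ≤ (8 * C / δ₀ + 8) * ∫ x in -ρ..ρ, (g' x ^ 2 + Q x * g x ^ 2) := by
  have cg : Continuous g := continuous_iff_continuousAt.2 fun x => (hg x).continuousAt
  have cQ := hB.smooth.continuous
  have hδ8 := hB.δ₀_le
  have hδ := hB.δ₀_pos
  have hC := hB.C_pos
  have cn : Continuous fun x => g' x ^ 2 + Q x * g x ^ 2 := by fun_prop
  have n0 (x : ℝ) : 0 ≤ g' x ^ 2 + Q x * g x ^ 2 :=
    add_nonneg (sq_nonneg _) (mul_nonneg (hB.nonneg x) (sq_nonneg _))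
  obtain ⟨a, ha1, ha2, ha⟩ := hB.near δ₀ hδ le_rfl
  have h := sq_le_integral_sq_add hg hg' hδ ha1 ha2 (x := 0) (by simpa using hδ.le)
  have h1 := integral_sq_div_sq_le hg hg' (ρ := ρ) (by linarith)
  have m1 : ∫ x in -ρ..ρ, g' x ^ 2 ≤ ∫ x in -ρ..ρ, (g' x ^ 2 + Q x * g x ^ 2) := by
    refine intervalIntegral.integral_mono_on (by linarith)
      ((hg'.pow 2).intervalIntegrable _ _) (cn.intervalIntegrable _ _) fun y _ => ?_
    have := mul_nonneg (hB.nonneg y) (sq_nonneg (g y))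
    linarith
  have m2 : ∫ y in -(2 * δ₀)..2 * δ₀, g' y ^ 2 ≤ ∫ x in -ρ..ρ, g' x ^ 2 :=
    integral_le_integral_of_subset (hg'.pow 2) (fun x => sq_nonneg _) (by linarith) (by linarith)
      (by linarith)
  have m3 : ∫ y in a..a + δ₀, g y ^ 2 ≤ C * ∫ x in -ρ..ρ, (g' x ^ 2 + Q x * g x ^ 2) := by
    have l1 : ∫ y in a..a + δ₀, g y ^ 2 ≤ ∫ y in a..a + δ₀, C * (g' y ^ 2 + Q y * g y ^ 2) := by
      refine intervalIntegral.integral_mono_on (by linarith)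
        ((cg.pow 2).intervalIntegrable _ _) ((cn.const_mul _).intervalIntegrable _ _)
        fun y hy => ?_
      have e2 : 1 ≤ C * Q y := by
        have := mul_le_mul_of_nonneg_left (ha y hy).2.1 hC.le
        rwa [mul_inv_cancel₀ hC.ne'] at this
      have e3 := mul_le_mul_of_nonneg_right e2 (sq_nonneg (g y))
      have e4 := mul_nonneg hC.le (sq_nonneg (g' y))
      linarith
    rw [intervalIntegral.integral_const_mul] at l1
    refine l1.trans ?_
    gcongr
    exact integral_le_integral_of_subset cn n0 (by linarith) (by linarith) (by linarith)
  set I := ∫ x in -ρ..ρ, (g' x ^ 2 + Q x * g x ^ 2) with hI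
  have hI0 : 0 ≤ I := intervalIntegral.integral_nonneg (by linarith) fun x _ => n0 x
  have h2 : g 0 ^ 2 ≤ 2 / δ₀ * (C * I) + 6 * δ₀ * I := by
    refine h.trans ?_
    gcongr
    exact m2.trans m1
  have h3 : 6 * δ₀ * I ≤ 1 * I := by gcongr; linarith
  have h4 : (8 * C / δ₀ + 8) * I = 4 * (2 / δ₀ * (C * I)) + 8 * I := by ring
  rw [h4]
  linarith

/-- The Morawetz estimate on a slice: the corner of the multiplier is absorbed for small `ε`. -/
theorem morawetz_slice (hB : RepulsiveBounds Q C c δ₀ lam) (hε : 0 ≤ ε) (hε1 : ε ≤ 1)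
    (hε2 : ε * (4 * C / δ₀ ^ 3 + 24 * δ₀) ≤ 1 / 12) {g g' g'' k k' h : ℝ → ℝ}
    (hg : ∀ x, HasDerivAt g (g' x) x) (hg' : ∀ x, HasDerivAt g' (g'' x) x)
    (hk : ∀ x, HasDerivAt k (k' x) x) (hgc : Continuous g'') (hkc : Continuous k')
    (hh : Continuous h) {R : ℝ} (hR : 1 / 2 ≤ R) (hg0 : ∀ x, |x| = R → g x = 0)
    (hg0' : ∀ x, |x| = R → g' x = 0) (hk0 : ∀ x, |x| = R → k x = 0) :
    ∫ x in -R..R, (mult ε x * ((g'' x - Q x * g x - h x) * g' x + k x * k' x)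
        + mult' ε x / 2 * (k x ^ 2 + g x * (g'' x - Q x * g x - h x)))
      ≤ -(1 / 4) * (∫ x in -R..R, bulk ε Q g g' x)
        - ∫ x in -R..R, h x * (mult ε x * g' x + mult' ε x / 2 * g x) := by
  have cg : Continuous g := continuous_iff_continuousAt.2 fun x => (hg x).continuousAt
  have cg' : Continuous g' := continuous_iff_continuousAt.2 fun x => (hg' x).continuousAt
  have cb := hB.continuous_bulk hε cg cg'
  have cQ' := hB.continuous_deriv
  have cm := continuous_mult hε
  have cm' := continuous_mult' hε
  have hδ := hB.δ₀_pos
  have hδ8 := hB.δ₀_le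
  have hC := hB.C_pos
  have hQ (x : ℝ) : HasDerivAt Q (deriv Q x) x :=
    (hB.smooth.differentiable (by norm_num) x).hasDerivAt
  have h1 := integral_morawetz_le hε hg hg' hk hQ hgc hkc cQ' hh (by linarith) hg0 hg0' hk0
  have h2 := hB.sq_le_integral_bulk hε hε1 hg cg' hδ le_rfl (R := R) (x := 0) (by linarith)
    (by simpa using hδ.le)
  set I := ∫ x in -R..R, bulk ε Q g g' x with hI
  have hI0 : 0 ≤ I :=
    intervalIntegral.integral_nonneg (by linarith) fun x _ => hB.bulk_nonneg hε g g' x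
  have h3 : 4 * C / (δ₀ ^ 3 * (1 + lam ^ 2)) ≤ 4 * C / δ₀ ^ 3 := by
    apply div_le_div_of_nonneg_left (by positivity) (by positivity)
    nlinarith [sq_nonneg lam, pow_pos hδ 3]
  have h4 : ε * g 0 ^ 2 ≤ 1 / 12 * I := by
    calc ε * g 0 ^ 2 ≤ ε * ((4 * C / δ₀ ^ 3 + 24 * δ₀) * I) := by
          gcongr
          refine h2.trans ?_
          gcongr
      _ = ε * (4 * C / δ₀ ^ 3 + 24 * δ₀) * I := by ring
      _ ≤ 1 / 12 * I := by gcongr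
  have h5 : ∫ x in -R..R, (-(1 / 3 * mult' ε x * g' x ^ 2)
        + 1 / 2 * mult ε x * deriv Q x * g x ^ 2 - h x * (mult ε x * g' x + mult' ε x / 2 * g x))
      ≤ ∫ x in -R..R, (-(1 / 3) * bulk ε Q g g' x
        - h x * (mult ε x * g' x + mult' ε x / 2 * g x)) := by
    refine intervalIntegral.integral_mono_on (by linarith)
      ((by fun_prop : Continuous _).intervalIntegrable _ _)
      ((by fun_prop : Continuous _).intervalIntegrable _ _) fun x _ => ?_
    have := mul_nonneg (hB.neg_mult_nonneg hε x) (sq_nonneg (g x))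
    rw [bulk]
    linarith
  have h6 : ∫ x in -R..R, (-(1 / 3) * bulk ε Q g g' x
        - h x * (mult ε x * g' x + mult' ε x / 2 * g x))
      = -(1 / 3) * I - ∫ x in -R..R, h x * (mult ε x * g' x + mult' ε x / 2 * g x) := by
    rw [intervalIntegral.integral_sub ((by fun_prop : Continuous _).intervalIntegrable _ _)
      ((by fun_prop : Continuous _).intervalIntegrable _ _), intervalIntegral.integral_const_mul]
  linarith

/-- The error term of the conformal energy identity is controlled by the Morawetz bulk term and the
potential energy. Only one factor `1 + lam` is lost. -/
theorem integral_conformal_error_le (hB : RepulsiveBounds Q C c δ₀ lam) (hε : 0 ≤ ε) (hε1 : ε ≤ 1)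
    {g g' w η : ℝ → ℝ} (hg : ∀ x, HasDerivAt g (g' x) x) (hg' : Continuous g')
    (hw : Continuous w) (hη : Continuous η) (hη0 : ∀ x, 0 ≤ η x) (hη1 : ∀ x, η x ≤ 1) {R s : ℝ}
    (hR : 1 / 2 ≤ R) (hs : 0 ≤ s) (hgw : ∀ x, 16 * x ^ 2 ≤ 1 + s ^ 2 → g x = w x) :
    ∫ x in -R..R, η x * (4 * s * (x * deriv Q x + 2 * Q x) * w x ^ 2)
      ≤ 4 * c * (∫ x in -R..R, η x * (Q x * w x ^ 2))
        + s * (1 + lam) * (4 * c + 8 * C * (8 * C / δ₀ ^ 2 + 48 * δ₀ ^ 2))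
          * ∫ x in -R..R, bulk ε Q g g' x := by
  have cg : Continuous g := continuous_iff_continuousAt.2 fun x => (hg x).continuousAt
  have cb := hB.continuous_bulk hε cg hg'
  have cQ := hB.smooth.continuous
  have cQ' := hB.continuous_deriv
  have cm := continuous_mult hε
  have hδ₀ := hB.δ₀_pos
  have hδ8 := hB.δ₀_le
  have hC := hB.C_pos
  have hc := hB.c_pos
  have hl0 := hB.lam_nonneg
  have hl : 0 < 1 + lam := by linarith
  set I := ∫ x in -R..R, bulk ε Q g g' x with hI
  have hI0 : 0 ≤ I :=
    intervalIntegral.integral_nonneg (by linarith) fun x _ => hB.bulk_nonneg hε g g' x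
  -- the length scale of the uncertainty principle
  obtain ⟨δ, hδ, hδ', hδ2⟩ : ∃ δ, 0 < δ ∧ δ ≤ δ₀ ∧ δ ^ 2 = δ₀ ^ 2 / (1 + lam) := by
    refine ⟨δ₀ / √(1 + lam), by positivity, div_le_self hδ₀.le ?_, ?_⟩
    · rw [Real.one_le_sqrt]
      linarith
    · rw [div_pow, Real.sq_sqrt hl.le]
  set Z := (4 * C / (δ ^ 3 * (1 + lam ^ 2)) + 24 * δ) * I with hZ
  have hgZ (x : ℝ) (hx : |x| ≤ δ) : g x ^ 2 ≤ Z :=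
    hB.sq_le_integral_bulk hε hε1 hg hg' hδ hδ' (by linarith) hx
  set A : ℝ → ℝ := fun x => η x * (4 * s * (x * deriv Q x + 2 * Q x) * w x ^ 2)
    - 4 * c * (η x * (Q x * w x ^ 2))
    - 4 * s * c * (1 + lam) * (-(mult ε x * deriv Q x) * g x ^ 2) with hA
  have cA : Continuous A := by rw [hA]; fun_prop
  have p1 (x : ℝ) : 0 ≤ 4 * s * c * (1 + lam) * (-(mult ε x * deriv Q x) * g x ^ 2) := by
    have := hB.neg_mult_nonneg hε x
    positivity
  have p2 (x : ℝ) : 0 ≤ 4 * c * (η x * (Q x * w x ^ 2)) := by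
    have := hB.nonneg x
    have := hη0 x
    positivity
  have hout (x : ℝ) (hx : 1 + s ^ 2 ≤ 16 * x ^ 2) : A x ≤ 0 := by
    have h1 := hB.outer s x hs hx
    have h2 : η x * (4 * w x ^ 2 * (s * (x * deriv Q x + 2 * Q x)))
        ≤ η x * (4 * w x ^ 2 * (c * Q x)) := by
      have := hη0 x
      gcongr
    have h3 := p1 x
    simp only [hA]
    linarith
  have hin (x : ℝ) (hx : 16 * x ^ 2 ≤ 1 + s ^ 2) {b : ℝ} (hb0 : 0 ≤ b)
      (hb : x * deriv Q x + 2 * Q x ≤ b) :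
      η x * (4 * s * (x * deriv Q x + 2 * Q x) * w x ^ 2) ≤ 4 * s * b * g x ^ 2 := by
    rw [hgw x hx]
    calc η x * (4 * s * (x * deriv Q x + 2 * Q x) * w x ^ 2)
        ≤ η x * (4 * s * b * w x ^ 2) := by
          have := hη0 x
          gcongr
      _ ≤ 1 * (4 * s * b * w x ^ 2) := by
          gcongr
          exact hη1 x
      _ = _ := one_mul _
  have hfar (x : ℝ) (hx : δ ≤ |x|) : A x ≤ 0 := by
    rcases le_total (1 + s ^ 2) (16 * x ^ 2) with h | h
    · exact hout x h
    · have h1 := hB.inner ε x hε hε1 (by rw [← hδ2, ← sq_abs x]; gcongr)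
      have h0 := hB.neg_mult_nonneg hε x
      have h2 := hin x h (by positivity)
        (h1.trans_eq (by ring : _ = c * (1 + lam) * -(mult ε x * deriv Q x)))
      have h3 := p2 x
      simp only [hA]
      linarith
  have hnear (x : ℝ) (hx : |x| ≤ δ) : A x ≤ 8 * s * C * (1 + lam ^ 2) * Z := by
    have hZ0 : 0 ≤ Z := (sq_nonneg (g x)).trans (hgZ x hx)
    rcases le_total (1 + s ^ 2) (16 * x ^ 2) with h | h
    · exact (hout x h).trans (by positivity)
    · have h1 : x * deriv Q x + 2 * Q x ≤ 2 * C * (1 + lam ^ 2) := by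
        linarith [hB.repulsive x, hB.upper x]
      have h2 := hin x h (by positivity) h1
      have h3 := p2 x
      have h4 := p1 x
      have h5 : 4 * s * (2 * C * (1 + lam ^ 2)) * g x ^ 2 ≤ 8 * s * C * (1 + lam ^ 2) * Z := by
        calc _ = 8 * s * C * (1 + lam ^ 2) * g x ^ 2 := by ring
          _ ≤ _ := by
            gcongr
            exact hgZ x hx
      simp only [hA]
      linarith
  have hAint := integral_le_of_le_on cA continuous_const hδ.le (by linarith : δ ≤ R) hnear hfar
  rw [intervalIntegral.integral_const, smul_eq_mul] at hAint
  have hsplit : ∫ x in -R..R, A x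
      = (∫ x in -R..R, η x * (4 * s * (x * deriv Q x + 2 * Q x) * w x ^ 2))
        - 4 * c * (∫ x in -R..R, η x * (Q x * w x ^ 2))
        - 4 * s * c * (1 + lam) * ∫ x in -R..R, -(mult ε x * deriv Q x) * g x ^ 2 := by
    rw [hA, intervalIntegral.integral_sub ((by fun_prop : Continuous _).intervalIntegrable _ _)
      ((by fun_prop : Continuous _).intervalIntegrable _ _),
      intervalIntegral.integral_sub ((by fun_prop : Continuous _).intervalIntegrable _ _)
      ((by fun_prop : Continuous _).intervalIntegrable _ _),
      intervalIntegral.integral_const_mul, intervalIntegral.integral_const_mul]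
  have hW : ∫ x in -R..R, -(mult ε x * deriv Q x) * g x ^ 2 ≤ I := by
    refine intervalIntegral.integral_mono_on (by linarith)
      ((by fun_prop : Continuous _).intervalIntegrable _ _) (cb.intervalIntegrable _ _)
      fun x _ => ?_
    have := mul_nonneg (mult'_nonneg ε x) (sq_nonneg (g' x))
    rw [bulk]
    linarith
  have hW' : 4 * s * c * (1 + lam) * ∫ x in -R..R, -(mult ε x * deriv Q x) * g x ^ 2
      ≤ 4 * s * c * (1 + lam) * I := by gcongr
  have hfin : (δ - -δ) * (8 * s * C * (1 + lam ^ 2) * Z)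
      ≤ s * (1 + lam) * (8 * C * (8 * C / δ₀ ^ 2 + 48 * δ₀ ^ 2)) * I := by
    have e1 : (δ - -δ) * (8 * s * C * (1 + lam ^ 2) * Z)
        = 8 * s * C * (8 * C / δ ^ 2 + 48 * δ ^ 2 * (1 + lam ^ 2)) * I := by
      rw [hZ]
      field_simp
      ring
    have e2 : 8 * C / δ ^ 2 = (1 + lam) * (8 * C / δ₀ ^ 2) := by
      rw [hδ2]
      field_simp
    have e3 : 48 * δ ^ 2 * (1 + lam ^ 2) ≤ (1 + lam) * (48 * δ₀ ^ 2) := by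
      rw [hδ2, mul_div_assoc', div_mul_eq_mul_div, div_le_iff₀ hl]
      have : 1 + lam ^ 2 ≤ (1 + lam) * (1 + lam) := by nlinarith
      nlinarith [mul_le_mul_of_nonneg_left this (by positivity : 0 ≤ 48 * δ₀ ^ 2)]
    rw [e1]
    calc 8 * s * C * (8 * C / δ ^ 2 + 48 * δ ^ 2 * (1 + lam ^ 2)) * I
        ≤ 8 * s * C * ((1 + lam) * (8 * C / δ₀ ^ 2) + (1 + lam) * (48 * δ₀ ^ 2)) * I := by
          rw [e2]
          gcongr
      _ = _ := by ring
  linarith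

end RepulsiveBounds

/-! ### The Morawetz functional -/

/-- The restriction of `ψ` to the interior of the light cone. -/
noncomputable def cut (ψ : ℝ → ℝ → ℝ) (s x : ℝ) : ℝ := inCone s x * ψ s x

/-- The commutator of the wave operator with the cutoff `inCone`. -/
noncomputable def cutErr (ψ : ℝ → ℝ → ℝ) (s x : ℝ) : ℝ :=
  2 * (dx inCone s x * dx ψ s x - dt inCone s x * dt ψ s x) + box inCone s x * ψ s x

/-- The Morawetz vector field `mult ε ∂ₓ`, with its zeroth order correction, applied to `φ`. -/
noncomputable def field (ε : ℝ) (φ : ℝ → ℝ → ℝ) (s x : ℝ) : ℝ :=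
  mult ε x * dx φ s x + mult' ε x / 2 * φ s x

/-- The density of the Morawetz functional: `∂ₜφ` paired with `field ε φ`, with the weight `s`. -/
noncomputable def current (ε : ℝ) (φ : ℝ → ℝ → ℝ) (s x : ℝ) : ℝ :=
  s * (dt φ s x * field ε φ s x)

/-- The energy density. -/
noncomputable def energyDens (Q : ℝ → ℝ) (ψ : ℝ → ℝ → ℝ) (s x : ℝ) : ℝ :=
  dt ψ s x ^ 2 + dx ψ s x ^ 2 + Q x * ψ s x ^ 2

/-- The radius of the region selected by `inCone`. -/
noncomputable def radius (s : ℝ) : ℝ := √(1 + s ^ 2) / 2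

/-- The energy inside the light cone, at distance of order `s` from its boundary. -/
noncomputable def localEnergy (Q : ℝ → ℝ) (ψ : ℝ → ℝ → ℝ) (s : ℝ) : ℝ :=
  ∫ x in -radius s..radius s, energyDens Q ψ s x

theorem half_le_radius (s : ℝ) : 1 / 2 ≤ radius s := by
  have : 1 ≤ √(1 + s ^ 2) := by
    rw [Real.one_le_sqrt]
    nlinarith [sq_nonneg s]
  rw [radius]
  linarith

theorem radius_sq (s : ℝ) : 4 * radius s ^ 2 = 1 + s ^ 2 := by
  rw [radius, div_pow, Real.sq_sqrt (by positivity)]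
  ring

theorem radius_le {s : ℝ} (hs : 0 ≤ s) : radius s ≤ (1 + s) / 2 := by
  rw [radius]
  have : √(1 + s ^ 2) ≤ 1 + s := by
    rw [Real.sqrt_le_left (by linarith)]
    nlinarith
  linarith

theorem four_mul_sq_le {s x : ℝ} (h : |x| ≤ radius s) : 4 * x ^ 2 ≤ 1 + s ^ 2 := by
  rw [← radius_sq, ← sq_abs x]
  gcongr

theorem le_four_mul_sq {s x : ℝ} (h : radius s ≤ |x|) : 1 + s ^ 2 ≤ 4 * x ^ 2 := by
  rw [← radius_sq, ← sq_abs x]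
  have := half_le_radius s
  gcongr

theorem continuous_slice {a : ℝ → ℝ → ℝ} (ha : Continuous (fun p : ℝ × ℝ => a p.1 p.2)) (s : ℝ) :
    Continuous (a s) :=
  ha.comp (Continuous.prodMk_right s)

section Cut

variable {ψ : ℝ → ℝ → ℝ}

theorem contDiff_cut (hψ : ContDiff ℝ 2 (fun p : ℝ × ℝ => ψ p.1 p.2)) :
    ContDiff ℝ 2 (fun p : ℝ × ℝ => cut ψ p.1 p.2) :=
  contDiff_inCone.mul hψ

theorem dt_cut (hψ : ContDiff ℝ 2 (fun p : ℝ × ℝ => ψ p.1 p.2)) (s x : ℝ) :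
    dt (cut ψ) s x = dt inCone s x * ψ s x + inCone s x * dt ψ s x :=
  ((hasDerivAt_dt (contDiff_inCone.differentiable (by norm_num)) s x).fun_mul
    (hasDerivAt_dt (hψ.differentiable (by norm_num)) s x)).deriv

theorem dx_cut (hψ : ContDiff ℝ 2 (fun p : ℝ × ℝ => ψ p.1 p.2)) (s x : ℝ) :
    dx (cut ψ) s x = dx inCone s x * ψ s x + inCone s x * dx ψ s x :=
  ((hasDerivAt_dx (contDiff_inCone.differentiable (by norm_num)) s x).fun_mul
    (hasDerivAt_dx (hψ.differentiable (by norm_num)) s x)).deriv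

theorem box_cut (hψ : ContDiff ℝ 2 (fun p : ℝ × ℝ => ψ p.1 p.2)) (s x : ℝ) :
    box (cut ψ) s x = inCone s x * box ψ s x + cutErr ψ s x := by
  have t0 := hasDerivAt_dt (contDiff_inCone.differentiable (by norm_num)) s x
  have x0 := hasDerivAt_dx (contDiff_inCone.differentiable (by norm_num)) s x
  have t1 := hasDerivAt_dt (hψ.differentiable (by norm_num)) s x
  have x1 := hasDerivAt_dx (hψ.differentiable (by norm_num)) s x
  have t2 := hasDerivAt_dt ((contDiff_dt contDiff_inCone).differentiable (by norm_num)) s x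
  have x2 := hasDerivAt_dx ((contDiff_dx contDiff_inCone).differentiable (by norm_num)) s x
  have t3 := hasDerivAt_dt ((contDiff_dt hψ).differentiable (by norm_num)) s x
  have x3 := hasDerivAt_dx ((contDiff_dx hψ).differentiable (by norm_num)) s x
  have e1 := ((t2.fun_mul t1).fun_add (t0.fun_mul t3)).deriv
  have e2 := ((x2.fun_mul x1).fun_add (x0.fun_mul x3)).deriv
  have e3 : dt (dt (cut ψ)) s x
      = deriv (fun r => dt inCone r x * ψ r x + inCone r x * dt ψ r x) s :=
    congrArg (fun f => deriv f s) (funext fun r => dt_cut hψ r x)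
  have e4 : dx (dx (cut ψ)) s x
      = deriv (fun y => dx inCone s y * ψ s y + inCone s y * dx ψ s y) x :=
    congrArg (fun f => deriv f x) (funext fun y => dx_cut hψ s y)
  rw [box, e3, e4, e1, e2, cutErr, box, box]
  ring

theorem cut_eq_zero (hψ : ContDiff ℝ 2 (fun p : ℝ × ℝ => ψ p.1 p.2)) {s x : ℝ}
    (h : radius s ≤ |x|) :
    cut ψ s x = 0 ∧ dt (cut ψ) s x = 0 ∧ dx (cut ψ) s x = 0 := by
  obtain ⟨h0, h1, h2, -⟩ := inCone_eq_zero (le_four_mul_sq h)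
  refine ⟨?_, ?_, ?_⟩
  · rw [cut, h0, zero_mul]
  · rw [dt_cut hψ, h0, h1]; ring
  · rw [dx_cut hψ, h0, h2]; ring

theorem field_cut_eq_zero (hψ : ContDiff ℝ 2 (fun p : ℝ × ℝ => ψ p.1 p.2)) (ε : ℝ) {s x : ℝ}
    (h : radius s ≤ |x|) : field ε (cut ψ) s x = 0 := by
  obtain ⟨h0, -, h2⟩ := cut_eq_zero hψ h
  rw [field, h0, h2]
  ring

theorem energyDens_nonneg {Q : ℝ → ℝ} (hQ : ∀ x, 0 ≤ Q x) (s x : ℝ) : 0 ≤ energyDens Q ψ s x := by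
  have := hQ x
  unfold energyDens
  positivity

theorem continuous_energyDens {Q : ℝ → ℝ} (hQ : Continuous Q)
    (hψ : ContDiff ℝ 2 (fun p : ℝ × ℝ => ψ p.1 p.2)) :
    Continuous (fun p : ℝ × ℝ => energyDens Q ψ p.1 p.2) := by
  have h1 := (contDiff_dt hψ).continuous
  have h2 := (contDiff_dx hψ).continuous
  have h3 := hψ.continuous
  unfold energyDens
  fun_prop

theorem sq_mul_add_mul_le {K T n p q r χ : ℝ} (hK : 0 ≤ K) (hχ : χ ^ 2 ≤ 1) (hp : p ^ 2 ≤ K / T)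
    (hr : r ^ 2 ≤ n) (hq : q ^ 2 / T ≤ 3 * n) : (p * q + χ * r) ^ 2 ≤ (2 + 6 * K) * n := by
  have e1 : p ^ 2 * q ^ 2 ≤ 3 * K * n := by
    calc p ^ 2 * q ^ 2 ≤ K / T * q ^ 2 := by gcongr
      _ = K * (q ^ 2 / T) := by ring
      _ ≤ K * (3 * n) := by gcongr
      _ = 3 * K * n := by ring
  have e2 : χ ^ 2 * r ^ 2 ≤ 1 * n := by gcongr
  nlinarith [sq_nonneg (p * q - χ * r)]

theorem sq_mul_cutErr_le {K T n s a b e p q r : ℝ} (hK : 0 ≤ K) (hT : 0 < T) (hs : s ^ 2 ≤ T)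
    (ha : a ^ 2 ≤ K / T) (hb : b ^ 2 ≤ K / T) (he : e ^ 2 ≤ K / T ^ 2) (hp : p ^ 2 ≤ n)
    (hq : q ^ 2 ≤ n) (hr : r ^ 2 / T ≤ 3 * n) :
    (s * (2 * (b * q - a * p) + e * r)) ^ 2 ≤ 33 * K * n := by
  have hn : 0 ≤ n := (sq_nonneg p).trans hp
  have e1 : (2 * (b * q - a * p) + e * r) ^ 2
      ≤ 3 * (4 * (b ^ 2 * q ^ 2) + 4 * (a ^ 2 * p ^ 2) + e ^ 2 * r ^ 2) := by
    have h1 := sq_nonneg (2 * (b * q) + 2 * (a * p))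
    have h2 := sq_nonneg (2 * (b * q) - e * r)
    have h3 := sq_nonneg (2 * (a * p) + e * r)
    linear_combination h1 + h2 + h3
  calc (s * (2 * (b * q - a * p) + e * r)) ^ 2
      = s ^ 2 * (2 * (b * q - a * p) + e * r) ^ 2 := by ring
    _ ≤ T * (3 * (4 * (b ^ 2 * q ^ 2) + 4 * (a ^ 2 * p ^ 2) + e ^ 2 * r ^ 2)) := by gcongr
    _ ≤ T * (3 * (4 * (K / T * n) + 4 * (K / T * n) + K / T ^ 2 * r ^ 2)) := by gcongr
    _ = 24 * K * n + 3 * K * (r ^ 2 / T) := by field_simp; ring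
    _ ≤ 24 * K * n + 3 * K * (3 * n) := by gcongr
    _ = 33 * K * n := by ring

theorem mult'_le {ε : ℝ} (hε : 0 < ε) (hε1 : ε ≤ 1) (x : ℝ) : mult' ε x ≤ ε⁻¹ / (1 + |x|) := by
  have hz : 1 ≤ 1 + ε * |x| := by nlinarith [abs_nonneg x]
  rw [mult', div_le_div_iff₀ (by positivity) (by positivity)]
  have h1 : 1 ≤ ε⁻¹ := (one_le_inv₀ hε).2 hε1
  have h2 : ε⁻¹ * (1 + ε * |x|) = ε⁻¹ + |x| := by field_simp
  calc 1 * (1 + |x|) ≤ ε⁻¹ * (1 + ε * |x|) := by linarith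
    _ ≤ ε⁻¹ * (1 + ε * |x|) ^ 2 := by
      gcongr
      exact le_self_pow₀ hz two_ne_zero

/-- Inside the light cone the cutoff costs only terms controlled by the energy density and the
left-hand side of Hardy's inequality. -/
theorem exists_cut_bound {ε : ℝ} (hε : 0 < ε) (hε1 : ε ≤ 1) :
    ∃ K : ℝ, 0 < K ∧ ∀ (Q : ℝ → ℝ) (ψ : ℝ → ℝ → ℝ), (∀ x, 0 ≤ Q x) →
      ContDiff ℝ 2 (fun p : ℝ × ℝ => ψ p.1 p.2) → ∀ s x, |x| ≤ radius s →
        dt (cut ψ) s x ^ 2 ≤ K * (energyDens Q ψ s x + ψ s x ^ 2 / (1 + |x|) ^ 2) ∧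
        field ε (cut ψ) s x ^ 2 ≤ K * (energyDens Q ψ s x + ψ s x ^ 2 / (1 + |x|) ^ 2) ∧
        (s * cutErr ψ s x) ^ 2 ≤ K * (energyDens Q ψ s x + ψ s x ^ 2 / (1 + |x|) ^ 2) := by
  obtain ⟨K, hK, hb⟩ := exists_inCone_bound
  have hK1 : 0 ≤ 2 + 6 * K := by linarith
  have hK2 : 0 ≤ ε⁻¹ ^ 2 * (5 + 12 * K) := by positivity
  refine ⟨(2 + 6 * K) + ε⁻¹ ^ 2 * (5 + 12 * K) + 33 * K, by positivity, fun Q ψ hQ hψ s x hx => ?_⟩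
  have h4 := four_mul_sq_le hx
  obtain ⟨b1, b2, b3⟩ := hb s x h4
  have hT0 : 0 < 1 + s ^ 2 := by positivity
  have hψv : ψ s x ^ 2 / (1 + s ^ 2) ≤ 3 * (ψ s x ^ 2 / (1 + |x|) ^ 2) := by
    have : (1 + |x|) ^ 2 ≤ 3 * (1 + s ^ 2) := by
      nlinarith [sq_abs x, sq_nonneg (1 - |x|), sq_nonneg s]
    rw [div_le_iff₀ hT0, mul_div_assoc', div_mul_eq_mul_div, le_div_iff₀ (by positivity)]
    nlinarith [sq_nonneg (ψ s x)]
  have hE0 := energyDens_nonneg (ψ := ψ) hQ s x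
  have hE : energyDens Q ψ s x = dt ψ s x ^ 2 + dx ψ s x ^ 2 + Q x * ψ s x ^ 2 := rfl
  have hQψ : 0 ≤ Q x * ψ s x ^ 2 := mul_nonneg (hQ x) (sq_nonneg _)
  have hv0 : 0 ≤ ψ s x ^ 2 / (1 + |x|) ^ 2 := by positivity
  obtain ⟨n, hn⟩ : ∃ n, n = energyDens Q ψ s x + ψ s x ^ 2 / (1 + |x|) ^ 2 := ⟨_, rfl⟩
  rw [← hn]
  have hnt : dt ψ s x ^ 2 ≤ n := by linarith [sq_nonneg (dx ψ s x)]
  have hnx : dx ψ s x ^ 2 ≤ n := by linarith [sq_nonneg (dt ψ s x)]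
  have hnv : ψ s x ^ 2 / (1 + |x|) ^ 2 ≤ n := by linarith
  have hn0 : 0 ≤ n := hv0.trans hnv
  have i2 : inCone s x ^ 2 ≤ 1 := pow_le_one₀ (inCone_nonneg s x) (inCone_le_one s x)
  have hψn : ψ s x ^ 2 / (1 + s ^ 2) ≤ 3 * n := by linarith
  have c1 := sq_mul_add_mul_le hK.le i2 b1 hnt hψn
  have c2 := sq_mul_add_mul_le hK.le i2 b2 hnx hψn
  rw [← dt_cut hψ] at c1
  rw [← dx_cut hψ] at c2
  refine ⟨?_, ?_, ?_⟩
  · refine c1.trans (mul_le_mul_of_nonneg_right ?_ hn0)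
    linarith
  · have m1 : mult ε x ^ 2 ≤ ε⁻¹ ^ 2 := by
      rw [← sq_abs]
      gcongr
      exact abs_mult_le hε x
    have m3 : (mult' ε x * cut ψ s x) ^ 2 ≤ ε⁻¹ ^ 2 * n := by
      calc (mult' ε x * cut ψ s x) ^ 2 = mult' ε x ^ 2 * (inCone s x ^ 2 * ψ s x ^ 2) := by
            rw [cut]; ring
        _ ≤ (ε⁻¹ / (1 + |x|)) ^ 2 * (1 * ψ s x ^ 2) := by
            have := mult'_nonneg ε x
            gcongr
            exact mult'_le hε hε1 x
        _ = ε⁻¹ ^ 2 * (ψ s x ^ 2 / (1 + |x|) ^ 2) := by field_simp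
        _ ≤ ε⁻¹ ^ 2 * n := by gcongr
    have m4 : (mult ε x * dx (cut ψ) s x) ^ 2 ≤ ε⁻¹ ^ 2 * ((2 + 6 * K) * n) := by
      rw [mul_pow]
      gcongr
    have m5 : field ε (cut ψ) s x ^ 2 ≤ 2 * (mult ε x * dx (cut ψ) s x) ^ 2
        + (mult' ε x * cut ψ s x) ^ 2 := by
      have h1 := sq_nonneg (mult ε x * dx (cut ψ) s x - mult' ε x / 2 * cut ψ s x)
      have h2 := sq_nonneg (mult' ε x * cut ψ s x)
      rw [field]
      linarith
    have m6 : field ε (cut ψ) s x ^ 2 ≤ ε⁻¹ ^ 2 * (5 + 12 * K) * n := by linarith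
    refine m6.trans (mul_le_mul_of_nonneg_right ?_ hn0)
    linarith
  · refine (sq_mul_cutErr_le hK.le hT0 (by linarith) b1 b2 b3 hnt hnx hψn).trans
      (mul_le_mul_of_nonneg_right ?_ hn0)
    linarith

end Cut

section Functional

variable {Q : ℝ → ℝ} {ψ H : ℝ → ℝ → ℝ} {C c δ₀ lam ε : ℝ}

/-- The time derivative of `current ε φ`. -/
noncomputable def currentDeriv (ε : ℝ) (φ : ℝ → ℝ → ℝ) (s x : ℝ) : ℝ :=
  dt φ s x * field ε φ s x + s * (mult ε x * (dt (dt φ) s x * dx φ s x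
    + dt φ s x * dx (dt φ) s x) + mult' ε x / 2 * (dt φ s x ^ 2 + φ s x * dt (dt φ) s x))

theorem hasDerivAt_current {φ : ℝ → ℝ → ℝ} (hφ : ContDiff ℝ 2 (fun p : ℝ × ℝ => φ p.1 p.2))
    (ε s x : ℝ) : HasDerivAt (fun r => current ε φ r x) (currentDeriv ε φ s x) s := by
  have t1 := hasDerivAt_dt (hφ.differentiable (by norm_num)) s x
  have t2 := hasDerivAt_dt ((contDiff_dt hφ).differentiable (by norm_num)) s x
  have t3 := hasDerivAt_dt ((contDiff_dx hφ).differentiable (by norm_num)) s x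
  rw [dt_dx_eq_dx_dt hφ] at t3
  refine ((hasDerivAt_id' s).fun_mul (t2.fun_mul ((t3.const_mul (mult ε x)).fun_add
    (t1.const_mul (mult' ε x / 2))))).congr_deriv ?_
  rw [currentDeriv, field]
  ring

theorem continuous_field {φ : ℝ → ℝ → ℝ} (hφ : ContDiff ℝ 2 (fun p : ℝ × ℝ => φ p.1 p.2))
    (hε : 0 ≤ ε) : Continuous (fun p : ℝ × ℝ => field ε φ p.1 p.2) := by
  have h1 := hφ.continuous
  have h3 := (contDiff_dx hφ).continuous
  have h4 := continuous_mult hε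
  have h5 := continuous_mult' hε
  unfold field
  fun_prop

theorem continuous_current {φ : ℝ → ℝ → ℝ} (hφ : ContDiff ℝ 2 (fun p : ℝ × ℝ => φ p.1 p.2))
    (hε : 0 ≤ ε) : Continuous (fun p : ℝ × ℝ => current ε φ p.1 p.2) := by
  have h2 := (contDiff_dt hφ).continuous
  have h3 := continuous_field hφ hε
  unfold current
  fun_prop

theorem continuous_currentDeriv {φ : ℝ → ℝ → ℝ}
    (hφ : ContDiff ℝ 2 (fun p : ℝ × ℝ => φ p.1 p.2)) (hε : 0 ≤ ε) :
    Continuous (fun p : ℝ × ℝ => currentDeriv ε φ p.1 p.2) := by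
  have h1 := hφ.continuous
  have h2 := (contDiff_dt hφ).continuous
  have h3 := (contDiff_dx hφ).continuous
  have h4 := continuous_mult hε
  have h5 := continuous_mult' hε
  have h6 := continuous_dt (contDiff_dt hφ)
  have h7 := continuous_dx (contDiff_dt hφ)
  have h8 := continuous_field hφ hε
  unfold currentDeriv
  fun_prop

theorem continuous_box (hψ : ContDiff ℝ 2 (fun p : ℝ × ℝ => ψ p.1 p.2)) :
    Continuous (fun p : ℝ × ℝ => box ψ p.1 p.2) := by
  have h1 := continuous_dt (contDiff_dt hψ)
  have h2 := continuous_dx (contDiff_dx hψ)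
  unfold box
  fun_prop

theorem continuous_source (hQ : Continuous Q) (hψ : ContDiff ℝ 2 (fun p : ℝ × ℝ => ψ p.1 p.2))
    (hH : ∀ s x, box ψ s x - Q x * ψ s x = H s x) : Continuous (fun p : ℝ × ℝ => H p.1 p.2) := by
  have h1 := continuous_box hψ
  have h2 := hψ.continuous
  have : (fun p : ℝ × ℝ => H p.1 p.2) = fun p => box ψ p.1 p.2 - Q p.2 * ψ p.1 p.2 :=
    funext fun p => (hH p.1 p.2).symm
  rw [this]
  fun_prop

theorem continuous_cutErr (hψ : ContDiff ℝ 2 (fun p : ℝ × ℝ => ψ p.1 p.2)) :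
    Continuous (fun p : ℝ × ℝ => cutErr ψ p.1 p.2) := by
  have h0 := hψ.continuous
  have h1 := (contDiff_dt hψ).continuous
  have h2 := (contDiff_dx hψ).continuous
  have h3 := (contDiff_dt contDiff_inCone).continuous
  have h4 := (contDiff_dx contDiff_inCone).continuous
  have h5 := continuous_box contDiff_inCone
  unfold cutErr
  fun_prop

theorem continuous_hardyDens (hψ : ContDiff ℝ 2 (fun p : ℝ × ℝ => ψ p.1 p.2)) (s : ℝ) :
    Continuous fun x => ψ s x ^ 2 / (1 + |x|) ^ 2 := by
  have h0 := continuous_slice hψ.continuous s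
  have hne (x : ℝ) : (1 + |x|) ^ 2 ≠ 0 := by positivity
  fun_prop (disch := exact hne)

theorem RepulsiveBounds.hardy_localEnergy (hB : RepulsiveBounds Q C c δ₀ lam)
    (hψ : ContDiff ℝ 2 (fun p : ℝ × ℝ => ψ p.1 p.2)) (s : ℝ) :
    ∫ x in -radius s..radius s, (energyDens Q ψ s x + ψ s x ^ 2 / (1 + |x|) ^ 2)
      ≤ (8 * C / δ₀ + 9) * localEnergy Q ψ s := by
  have hρ := half_le_radius s
  have c1 := continuous_slice (continuous_energyDens hB.smooth.continuous hψ) s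
  have c2 := continuous_hardyDens hψ s
  have c3 := continuous_slice (contDiff_dx hψ).continuous s
  have c4 := continuous_slice hψ.continuous s
  have c5 := hB.smooth.continuous
  have h1 := hB.hardy (fun x => hasDerivAt_dx (hψ.differentiable (by norm_num)) s x) c3 hρ
  have h2 : ∫ x in -radius s..radius s, (dx ψ s x ^ 2 + Q x * ψ s x ^ 2) ≤ localEnergy Q ψ s := by
    refine intervalIntegral.integral_mono_on (by linarith)
      ((by fun_prop : Continuous _).intervalIntegrable _ _) (c1.intervalIntegrable _ _)
      fun x _ => ?_
    rw [energyDens]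
    nlinarith [sq_nonneg (dt ψ s x)]
  rw [intervalIntegral.integral_add (c1.intervalIntegrable _ _) (c2.intervalIntegrable _ _)]
  have h3 : 0 ≤ 8 * C / δ₀ + 8 := by
    have := hB.C_pos
    have := hB.δ₀_pos
    positivity
  have h4 := mul_le_mul_of_nonneg_left h2 h3
  have h5 : ∫ x in -radius s..radius s, energyDens Q ψ s x = localEnergy Q ψ s := rfl
  rw [h5]
  linarith

theorem localEnergy_nonneg (hQ : ∀ x, 0 ≤ Q x) (s : ℝ) : 0 ≤ localEnergy Q ψ s :=
  intervalIntegral.integral_nonneg (by linarith [half_le_radius s])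
    fun x _ => energyDens_nonneg hQ s x

/-- The Morawetz functional is bounded by the local energy, and its derivative gains the bulk
term. -/
theorem exists_morawetz_bound (C δ₀ : ℝ) (hC : 0 < C) (hδ₀ : 0 < δ₀) {ε : ℝ} (hε : 0 < ε)
    (hε1 : ε ≤ 1) (hε2 : ε * (4 * C / δ₀ ^ 3 + 24 * δ₀) ≤ 1 / 12) :
    ∃ K : ℝ, 0 < K ∧ ∀ (Q : ℝ → ℝ) (c lam : ℝ) (ψ H : ℝ → ℝ → ℝ),
      RepulsiveBounds Q C c δ₀ lam → ContDiff ℝ 2 (fun p : ℝ × ℝ => ψ p.1 p.2) →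
      (∀ s x, box ψ s x - Q x * ψ s x = H s x) → ∀ R s, 0 ≤ s → radius s ≤ R →
      |∫ x in -R..R, current ε (cut ψ) s x| ≤ K * (s * localEnergy Q ψ s) ∧
      ∫ x in -R..R, currentDeriv ε (cut ψ) s x
        ≤ K * localEnergy Q ψ s
          + K * (√(∫ x in -R..R, (s * H s x) ^ 2) * √(localEnergy Q ψ s))
          - s / 4 * ∫ x in -R..R, bulk ε Q (cut ψ s) (dx (cut ψ) s) x := by
  obtain ⟨K, hK, hb⟩ := exists_cut_bound hε hε1
  set K₁ := K * (8 * C / δ₀ + 9) with hK₁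
  have hK₁0 : 0 < K₁ := by positivity
  refine ⟨2 * K₁ + √K₁, by positivity, fun Q c lam ψ H hB hψ hH R s hs hR => ?_⟩
  have hφ := contDiff_cut hψ
  have hQ0 := hB.nonneg
  have hρ := half_le_radius s
  have cQ := hB.smooth.continuous
  set n : ℝ → ℝ := fun x => energyDens Q ψ s x + ψ s x ^ 2 / (1 + |x|) ^ 2 with hn
  have cn : Continuous n :=
    (continuous_slice (continuous_energyDens cQ hψ) s).add (continuous_hardyDens hψ s)
  have hN := localEnergy_nonneg (ψ := ψ) hQ0 s
  have hnN : ∫ x in -radius s..radius s, K * n x ≤ K₁ * localEnergy Q ψ s := by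
    rw [intervalIntegral.integral_const_mul, hK₁, mul_assoc]
    gcongr
    exact hB.hardy_localEnergy hψ s
  have cF := continuous_slice (continuous_field hφ hε.le) s
  have cT := continuous_slice (contDiff_dt hφ).continuous s
  have cE := continuous_slice (continuous_cutErr hψ) s
  have cχ := continuous_slice contDiff_inCone.continuous s
  have hHc := continuous_source cQ hψ hH
  have cH := continuous_slice hHc s
  -- a product of two quantities controlled by `n` integrates to a multiple of the local energy
  have prod (A B : ℝ → ℝ) (cA : Continuous A) (cB : Continuous B)
      (hA : ∀ x, |x| ≤ radius s → A x ^ 2 ≤ K * n x)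
      (hBn : ∀ x, |x| ≤ radius s → B x ^ 2 ≤ K * n x)
      (h0 : ∀ x, radius s ≤ |x| → B x = 0) :
      ∫ x in -R..R, A x * B x ≤ K₁ * localEnergy Q ψ s := by
    refine (integral_le_of_le_on (A := fun x => A x * B x) (cA.mul cB) (cn.const_mul K)
      (by linarith) hR (fun x hx => ?_)
      (fun x hx => ?_)).trans hnN
    · nlinarith [hA x hx, hBn x hx, sq_nonneg (A x - B x)]
    · rw [h0 x hx, mul_zero]
  have hF0 (x : ℝ) (hx : radius s ≤ |x|) := field_cut_eq_zero hψ ε hx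
  have p1 := prod (dt (cut ψ) s) (field ε (cut ψ) s) cT cF (fun x hx => (hb Q ψ hQ0 hψ s x hx).1)
    (fun x hx => (hb Q ψ hQ0 hψ s x hx).2.1) hF0
  have p2 := prod (fun x => -dt (cut ψ) s x) (field ε (cut ψ) s) cT.neg cF
    (fun x hx => by simpa using (hb Q ψ hQ0 hψ s x hx).1)
    (fun x hx => (hb Q ψ hQ0 hψ s x hx).2.1) hF0
  have p3 := prod (fun x => -(s * cutErr ψ s x)) (field ε (cut ψ) s) (by fun_prop) cF
    (fun x hx => by simpa using (hb Q ψ hQ0 hψ s x hx).2.2)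
    (fun x hx => (hb Q ψ hQ0 hψ s x hx).2.1) hF0
  have hsq := Real.sqrt_nonneg K₁
  constructor
  · have e1 : ∫ x in -R..R, current ε (cut ψ) s x
        = s * ∫ x in -R..R, dt (cut ψ) s x * field ε (cut ψ) s x := by
      rw [← intervalIntegral.integral_const_mul]
      rfl
    have e2 : ∫ x in -R..R, -dt (cut ψ) s x * field ε (cut ψ) s x
        = -∫ x in -R..R, dt (cut ψ) s x * field ε (cut ψ) s x := by
      rw [← intervalIntegral.integral_neg]
      exact intervalIntegral.integral_congr fun x _ => by ring
    rw [e2] at p2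
    rw [e1, abs_mul, abs_of_nonneg hs]
    have h1 : |∫ x in -R..R, dt (cut ψ) s x * field ε (cut ψ) s x| ≤ K₁ * localEnergy Q ψ s :=
      abs_le.2 ⟨by linarith, p1⟩
    calc s * |∫ x in -R..R, dt (cut ψ) s x * field ε (cut ψ) s x|
        ≤ s * (K₁ * localEnergy Q ψ s) := by gcongr
      _ = K₁ * (s * localEnergy Q ψ s) := by ring
      _ ≤ (2 * K₁ + √K₁) * (s * localEnergy Q ψ s) := by
          gcongr
          linarith
  · set h : ℝ → ℝ := fun x => inCone s x * H s x + cutErr ψ s x with hh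
    have ch : Continuous h := by fun_prop
    have hd := hφ.differentiable (by norm_num)
    have hd1 := (contDiff_dx hφ).differentiable (by norm_num)
    have hd2 := (contDiff_dt hφ).differentiable (by norm_num)
    have hbox (x : ℝ) : dt (dt (cut ψ)) s x = dx (dx (cut ψ)) s x - Q x * cut ψ s x - h x := by
      have e1 := box_cut hψ s x
      rw [box] at e1
      have e2 := hH s x
      have e3 : cut ψ s x = inCone s x * ψ s x := rfl
      simp only [hh]
      rw [e3]
      linear_combination -e1 - inCone s x * e2
    have hvan (x : ℝ) (hx : |x| = R) := cut_eq_zero hψ (s := s) (hR.trans hx.ge)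
    have hmor := hB.morawetz_slice hε.le hε1 hε2 (R := R) (hasDerivAt_dx hd s) (hasDerivAt_dx hd1 s)
      (hasDerivAt_dx hd2 s) (continuous_slice (continuous_dx (contDiff_dx hφ)) s)
      (continuous_slice (continuous_dx (contDiff_dt hφ)) s) ch (by linarith)
      (fun x hx => (hvan x hx).1) (fun x hx => (hvan x hx).2.2) (fun x hx => (hvan x hx).2.1)
    simp only [← hbox] at hmor
    have cTF : Continuous fun x => dt (cut ψ) s x * field ε (cut ψ) s x := cT.mul cF
    have cRest : Continuous fun x => mult ε x * (dt (dt (cut ψ)) s x * dx (cut ψ) s x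
        + dt (cut ψ) s x * dx (dt (cut ψ)) s x)
        + mult' ε x / 2 * (dt (cut ψ) s x ^ 2 + cut ψ s x * dt (dt (cut ψ)) s x) := by
      have c1 := continuous_mult hε.le
      have c2 := continuous_mult' hε.le
      have c3 := continuous_slice (continuous_dt (contDiff_dt hφ)) s
      have c4 := continuous_slice (continuous_dx (contDiff_dt hφ)) s
      have c5 := continuous_slice (contDiff_dx hφ).continuous s
      have c6 := continuous_slice hφ.continuous s
      fun_prop
    have e1 : ∫ x in -R..R, currentDeriv ε (cut ψ) s x
        = (∫ x in -R..R, dt (cut ψ) s x * field ε (cut ψ) s x)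
          + s * ∫ x in -R..R, (mult ε x * (dt (dt (cut ψ)) s x * dx (cut ψ) s x
        + dt (cut ψ) s x * dx (dt (cut ψ)) s x)
        + mult' ε x / 2 * (dt (cut ψ) s x ^ 2 + cut ψ s x * dt (dt (cut ψ)) s x)) := by
      rw [← intervalIntegral.integral_const_mul, ← intervalIntegral.integral_add
        (cTF.intervalIntegrable _ _) ((cRest.const_mul s).intervalIntegrable _ _)]
      rfl
    have e2 : s * ∫ x in -R..R, h x * (mult ε x * dx (cut ψ) s x + mult' ε x / 2 * cut ψ s x)
        = -(∫ x in -R..R, (-(s * H s x)) * (inCone s x * field ε (cut ψ) s x))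
          - ∫ x in -R..R, -(s * cutErr ψ s x) * field ε (cut ψ) s x := by
      rw [← intervalIntegral.integral_const_mul, ← intervalIntegral.integral_neg,
        ← intervalIntegral.integral_sub ((by fun_prop : Continuous _).intervalIntegrable _ _)
          ((by fun_prop : Continuous _).intervalIntegrable _ _)]
      refine intervalIntegral.integral_congr fun x _ => ?_
      simp only [hh, field]
      ring
    have cs : ∫ x in -R..R, (-(s * H s x)) * (inCone s x * field ε (cut ψ) s x)
        ≤ √(∫ x in -R..R, (s * H s x) ^ 2) * √(K₁ * localEnergy Q ψ s) := by
      refine (integral_mul_le_sqrt_mul_sqrt (f := fun x => -(s * H s x))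
        (g := fun x => inCone s x * field ε (cut ψ) s x) (by fun_prop) (by fun_prop)
        (by linarith)).trans ?_
      simp only [neg_sq]
      gcongr
      refine (integral_le_of_le_on (by fun_prop) (cn.const_mul K) (by linarith) hR (fun x hx => ?_)
        (fun x hx => ?_)).trans hnN
      · refine le_trans ?_ (hb Q ψ hQ0 hψ s x hx).2.1
        rw [mul_pow]
        exact mul_le_of_le_one_left (sq_nonneg _)
          (pow_le_one₀ (inCone_nonneg s x) (inCone_le_one s x))
      · rw [hF0 x hx]
        simp
    rw [Real.sqrt_mul hK₁0.le] at cs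
    have h1 := mul_le_mul_of_nonneg_left hmor hs
    have hX : 0 ≤ √(∫ x in -R..R, (s * H s x) ^ 2) * √(localEnergy Q ψ s) := by positivity
    rw [e1]
    have h2 := mul_nonneg hsq hN
    have h3 := mul_nonneg hK₁0.le hX
    calc _ ≤ K₁ * localEnergy Q ψ s + (-(s / 4) * (∫ x in -R..R,
          bulk ε Q (cut ψ s) (dx (cut ψ) s) x)
          - s * ∫ x in -R..R, h x * (mult ε x * dx (cut ψ) s x + mult' ε x / 2 * cut ψ s x)) := by
          linarith
      _ ≤ _ := by
          rw [e2]
          linarith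

end Functional

/-! ### Differential inequalities for the cut-off energies -/

/-- The conformal energy density. -/
noncomputable def confDens (Q : ℝ → ℝ) (ψ : ℝ → ℝ → ℝ) (s x : ℝ) : ℝ :=
  (1 + ubar s x ^ 2) * L ψ s x ^ 2 + (1 + u s x ^ 2) * Lbar ψ s x ^ 2
    + (1 + ubar s x ^ 2 + u s x ^ 2) * Q x * ψ s x ^ 2

/-- The weight `1 + |u̲| + |u|`. -/
noncomputable def weight (s x : ℝ) : ℝ := 1 + |ubar s x| + |u s x|

/-- The weighted `L²` norm of the source on `[-R, R]`. -/
noncomputable def srcNorm (H : ℝ → ℝ → ℝ) (R s : ℝ) : ℝ :=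
  √(∫ x in -R..R, (weight s x * H s x) ^ 2)

/-- The energy norm on `[-R, R]`. -/
noncomputable def gradNorm (Q : ℝ → ℝ) (ψ : ℝ → ℝ → ℝ) (R s : ℝ) : ℝ :=
  √(∫ x in -R..R, energyDens Q ψ s x)

/-- The conformal energy norm on `[-R, R]`. -/
noncomputable def confNorm (Q : ℝ → ℝ) (ψ : ℝ → ℝ → ℝ) (R s : ℝ) : ℝ :=
  √(∫ x in -R..R, confDens Q ψ s x)

theorem weight_pos (s x : ℝ) : 0 < weight s x := by unfold weight; positivity

theorem continuous_weight : Continuous (fun p : ℝ × ℝ => weight p.1 p.2) := by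
  unfold weight ubar u
  fun_prop

section

variable {Q : ℝ → ℝ} {ψ H : ℝ → ℝ → ℝ} {C c δ₀ lam R s : ℝ}

theorem confDens_nonneg (hQ : ∀ x, 0 ≤ Q x) (s x : ℝ) : 0 ≤ confDens Q ψ s x := by
  have := hQ x
  unfold confDens
  positivity

theorem continuous_confDens (hQ : Continuous Q)
    (hψ : ContDiff ℝ 2 (fun p : ℝ × ℝ => ψ p.1 p.2)) :
    Continuous (fun p : ℝ × ℝ => confDens Q ψ p.1 p.2) := by
  have h1 := (contDiff_dt hψ).continuous
  have h2 := (contDiff_dx hψ).continuous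
  have h3 := hψ.continuous
  unfold confDens ubar u L Lbar
  fun_prop

theorem continuous_integral {a : ℝ → ℝ → ℝ} (ha : Continuous (fun p : ℝ × ℝ => a p.1 p.2))
    (c d : ℝ) : Continuous fun s => ∫ x in c..d, a s x :=
  intervalIntegral.continuous_parametric_intervalIntegral_of_continuous' ha c d

theorem continuous_srcNorm (hHc : Continuous (fun p : ℝ × ℝ => H p.1 p.2)) (R : ℝ) :
    Continuous (srcNorm H R) := by
  have := continuous_weight
  exact (continuous_integral (a := fun s x => (weight s x * H s x) ^ 2) (by fun_prop) _ _).sqrt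

theorem continuous_gradNorm (hQ : Continuous Q) (hψ : ContDiff ℝ 2 (fun p : ℝ × ℝ => ψ p.1 p.2))
    (R : ℝ) : Continuous (gradNorm Q ψ R) :=
  (continuous_integral (continuous_energyDens hQ hψ) _ _).sqrt

theorem continuous_confNorm (hQ : Continuous Q) (hψ : ContDiff ℝ 2 (fun p : ℝ × ℝ => ψ p.1 p.2))
    (R : ℝ) : Continuous (confNorm Q ψ R) :=
  (continuous_integral (continuous_confDens hQ hψ) _ _).sqrt

theorem continuous_coneEnergy (κ R : ℝ) (hQ : ContDiff ℝ 1 Q)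
    (hψ : ContDiff ℝ 2 (fun p : ℝ × ℝ => ψ p.1 p.2)) : Continuous (coneEnergy κ Q ψ R) :=
  continuous_integral (contDiff_coneDens κ R hQ hψ).continuous _ _

theorem coneDens_zero (Q : ℝ → ℝ) (ψ : ℝ → ℝ → ℝ) (R s x : ℝ) :
    coneDens 0 Q ψ R s x = cone R s x * (2 * energyDens Q ψ s x) := by
  rw [coneDens, densL, densLbar, energyDens]
  ring

theorem coneDens_one (Q : ℝ → ℝ) (ψ : ℝ → ℝ → ℝ) (R s x : ℝ) :
    coneDens 1 Q ψ R s x = cone R s x * (confDens Q ψ s x + Q x * ψ s x ^ 2) := by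
  rw [coneDens, densL, densLbar, confDens, ubar, u, L, Lbar]
  ring

theorem one_add_sq_mul_energyDens_le (hQ : ∀ x, 0 ≤ Q x) {s x : ℝ} (h : |x| ≤ radius s) :
    (1 + s ^ 2) * energyDens Q ψ s x ≤ 2 * confDens Q ψ s x := by
  have h4 := four_mul_sq_le h
  have e1 : 1 + s ^ 2 ≤ 4 * (1 + (s + x) ^ 2) := by nlinarith [sq_nonneg (s + 2 * x)]
  have e2 : 1 + s ^ 2 ≤ 4 * (1 + (s - x) ^ 2) := by nlinarith [sq_nonneg (s - 2 * x)]
  have h1 := mul_le_mul_of_nonneg_right e1 (sq_nonneg (dt ψ s x + dx ψ s x))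
  have h2 := mul_le_mul_of_nonneg_right e2 (sq_nonneg (dt ψ s x - dx ψ s x))
  have e3 : 1 + s ^ 2 ≤ 2 * (1 + (s + x) ^ 2 + (s - x) ^ 2) := by nlinarith
  have h3 := mul_le_mul_of_nonneg_right e3 (mul_nonneg (hQ x) (sq_nonneg (ψ s x)))
  rw [energyDens, confDens, ubar, u, L, Lbar]
  linarith

theorem localEnergy_bounds (hQ : ContDiff ℝ 1 Q) (hQ0 : ∀ x, 0 ≤ Q x)
    (hψ : ContDiff ℝ 2 (fun p : ℝ × ℝ => ψ p.1 p.2)) (hs : 0 ≤ s) (hR : radius s ≤ R - s - 1) :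
    localEnergy Q ψ s ≤ coneEnergy 0 Q ψ R s ∧
      (1 + s ^ 2) * localEnergy Q ψ s ≤ 2 * coneEnergy 1 Q ψ R s ∧
      localEnergy Q ψ s ≤ gradNorm Q ψ R s ^ 2 := by
  have hρ := half_le_radius s
  have cE := continuous_slice (continuous_energyDens hQ.continuous hψ) s
  have c0 := continuous_slice (contDiff_coneDens 0 R hQ hψ).continuous s
  have c1 := continuous_slice (contDiff_coneDens 1 R hQ hψ).continuous s
  have hcone {x : ℝ} (hx : x ∈ Set.Icc (-radius s) (radius s)) : cone R s x = 1 :=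
    cone_eq_one ((abs_le.2 hx).trans hR)
  have n0 (x : ℝ) := energyDens_nonneg (ψ := ψ) hQ0 s x
  refine ⟨?_, ?_, ?_⟩
  · refine (intervalIntegral.integral_mono_on (g := coneDens 0 Q ψ R s) (by linarith)
      (cE.intervalIntegrable _ _) (c0.intervalIntegrable _ _) fun x hx => ?_).trans
      (integral_le_integral_of_subset c0 (fun x => coneDens_nonneg le_rfl hQ0 R s x)
        (by linarith) (by linarith) (by linarith))
    rw [coneDens_zero, hcone hx]
    linarith [n0 x]
  · rw [localEnergy, ← intervalIntegral.integral_const_mul, coneEnergy,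
      ← intervalIntegral.integral_const_mul]
    refine (intervalIntegral.integral_mono_on (g := fun x => 2 * coneDens 1 Q ψ R s x)
      (by linarith) ((cE.const_mul _).intervalIntegrable _ _)
      ((c1.const_mul _).intervalIntegrable _ _) fun x hx => ?_).trans
      (integral_le_integral_of_subset (c1.const_mul _)
        (fun x => mul_nonneg zero_le_two (coneDens_nonneg zero_le_one hQ0 R s x))
        (by linarith) (by linarith) (by linarith))
    have := mul_nonneg (hQ0 x) (sq_nonneg (ψ s x))
    rw [coneDens_one, hcone hx]
    linarith [one_add_sq_mul_energyDens_le (ψ := ψ) hQ0 (abs_le.2 hx)]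
  · rw [gradNorm, Real.sq_sqrt (intervalIntegral.integral_nonneg (by linarith) fun x _ => n0 x)]
    exact integral_le_integral_of_subset cE n0 (by linarith) (by linarith) (by linarith)

theorem potential_bounds (hQ : ContDiff ℝ 1 Q) (hQ0 : ∀ x, 0 ≤ Q x)
    (hψ : ContDiff ℝ 2 (fun p : ℝ × ℝ => ψ p.1 p.2)) (hR : 0 ≤ R) (s : ℝ) :
    ∫ x in -R..R, cone R s x * (Q x * ψ s x ^ 2) ≤ coneEnergy 0 Q ψ R s ∧
      (1 + s ^ 2) * (∫ x in -R..R, cone R s x * (Q x * ψ s x ^ 2))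
        ≤ 2 * coneEnergy 1 Q ψ R s := by
  have c0 := continuous_slice (contDiff_coneDens 0 R hQ hψ).continuous s
  have c1 := continuous_slice (contDiff_coneDens 1 R hQ hψ).continuous s
  have c2 := continuous_slice (continuous_cone R) s
  have c3 := continuous_slice hψ.continuous s
  have c4 := hQ.continuous
  constructor
  · refine intervalIntegral.integral_mono_on (by linarith)
      ((by fun_prop : Continuous _).intervalIntegrable _ _) (c0.intervalIntegrable _ _)
      fun x _ => ?_
    have h1 := mul_nonneg (hQ0 x) (sq_nonneg (ψ s x))
    rw [coneDens_zero, energyDens]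
    refine mul_le_mul_of_nonneg_left ?_ (cone_nonneg R s x)
    linarith [sq_nonneg (dt ψ s x), sq_nonneg (dx ψ s x)]
  · rw [← intervalIntegral.integral_const_mul, coneEnergy, ← intervalIntegral.integral_const_mul]
    refine intervalIntegral.integral_mono_on (by linarith)
      ((by fun_prop : Continuous _).intervalIntegrable _ _)
      ((c1.const_mul _).intervalIntegrable _ _) fun x _ => ?_
    have h1 := mul_nonneg (hQ0 x) (sq_nonneg (ψ s x))
    have h2 := mul_nonneg (sq_nonneg x) h1
    have h4 := mul_nonneg (sq_nonneg s) h1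
    have h3 := cone_nonneg R s x
    have h5 : (1 + s ^ 2) * (Q x * ψ s x ^ 2) ≤ 2 * (confDens Q ψ s x + Q x * ψ s x ^ 2) := by
      have e1 := mul_nonneg (by positivity : 0 ≤ 1 + ubar s x ^ 2) (sq_nonneg (L ψ s x))
      have e2 := mul_nonneg (by positivity : 0 ≤ 1 + u s x ^ 2) (sq_nonneg (Lbar ψ s x))
      have e3 : (1 + ubar s x ^ 2 + u s x ^ 2) * Q x * ψ s x ^ 2
          = Q x * ψ s x ^ 2 + 2 * (s ^ 2 * (Q x * ψ s x ^ 2)) + 2 * (x ^ 2 * (Q x * ψ s x ^ 2)) := by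
        rw [ubar, u]; ring
      rw [confDens]
      linarith
    rw [coneDens_one]
    have := mul_le_mul_of_nonneg_left h5 h3
    linarith

/-- Cauchy-Schwarz for the source terms: `A` is a quantity controlled pointwise by `n`. -/
theorem integral_source_le (hHc : Continuous (fun p : ℝ × ℝ => H p.1 p.2)) {A n : ℝ → ℝ}
    (hA : Continuous A) (hn : Continuous n) (hR : 0 ≤ R) (s : ℝ)
    (h : ∀ x, A x ^ 2 ≤ weight s x ^ 2 * (16 * n x)) :
    ∫ x in -R..R, H s x * A x ≤ 4 * (srcNorm H R s * √(∫ x in -R..R, n x)) := by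
  have cw := continuous_slice continuous_weight s
  have cH := continuous_slice hHc s
  have hw (x : ℝ) : weight s x ≠ 0 := (weight_pos s x).ne'
  have e1 : ∫ x in -R..R, H s x * A x
      = ∫ x in -R..R, (weight s x * H s x) * (A x / weight s x) :=
    intervalIntegral.integral_congr fun x _ => by
      have := hw x
      field_simp
  rw [e1]
  have cA : Continuous fun x => A x / weight s x := by fun_prop (disch := exact hw)
  refine (integral_mul_le_sqrt_mul_sqrt (f := fun x => weight s x * H s x) (by fun_prop) cA
    (by linarith)).trans ?_
  have e2 : √(∫ x in -R..R, (A x / weight s x) ^ 2) ≤ 4 * √(∫ x in -R..R, n x) := by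
    have e3 : (4 : ℝ) = √16 := by rw [show (16 : ℝ) = 4 ^ 2 by norm_num]; simp
    rw [e3, ← Real.sqrt_mul (by norm_num), ← intervalIntegral.integral_const_mul]
    refine Real.sqrt_le_sqrt (intervalIntegral.integral_mono_on (by linarith)
      ((cA.pow 2).intervalIntegrable _ _) ((hn.const_mul _).intervalIntegrable _ _) fun x _ => ?_)
    have := weight_pos s x
    rw [div_pow, div_le_iff₀ (by positivity)]
    linarith [h x]
  calc _ ≤ srcNorm H R s * (4 * √(∫ x in -R..R, n x)) :=
        mul_le_mul_of_nonneg_left e2 (Real.sqrt_nonneg _)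
    _ = _ := by ring

theorem one_le_weight_sq (s x : ℝ) : 1 ≤ weight s x ^ 2 := by
  refine one_le_pow₀ ?_
  rw [weight]
  linarith [abs_nonneg (ubar s x), abs_nonneg (u s x)]

theorem one_add_sq_le_weight_sq (s x : ℝ) :
    1 + (s + x) ^ 2 ≤ weight s x ^ 2 ∧ 1 + (s - x) ^ 2 ≤ weight s x ^ 2 := by
  rw [weight, ubar, u, ← sq_abs (s + x), ← sq_abs (s - x)]
  have := abs_nonneg (s + x)
  have := abs_nonneg (s - x)
  constructor <;> nlinarith

theorem le_weight (s x : ℝ) : s ≤ weight s x := by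
  rw [weight, ubar, u]
  linarith [le_abs_self (s + x), le_abs_self (s - x), abs_nonneg (s + x), abs_nonneg (s - x)]

/-- Growth of the standard energy. -/
theorem coneEnergy_zero_le (hQ : ContDiff ℝ 1 Q) (hQ0 : ∀ x, 0 ≤ Q x)
    (hψ : ContDiff ℝ 2 (fun p : ℝ × ℝ => ψ p.1 p.2))
    (hH : ∀ s x, box ψ s x - Q x * ψ s x = H s x) (hR : 0 ≤ R) (hs : 0 ≤ s) :
    coneEnergy 0 Q ψ R s
      ≤ coneEnergy 0 Q ψ R 0 + ∫ r in 0..s, 4 * (srcNorm H R r * gradNorm Q ψ R r) := by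
  have hHc := continuous_source hQ.continuous hψ hH
  have hP := contDiff_coneDens 0 R hQ hψ
  have hsub := integral_sub_eq_integral_integral
    (fun s x => hasDerivAt_dt (hP.differentiable (by norm_num)) s x) hP.continuous
    (continuous_dt hP) 0 s (-R) R
  have e1 := continuous_srcNorm hHc R
  have e2 := continuous_gradNorm hQ.continuous hψ R
  have hle : ∫ r in 0..s, ∫ x in -R..R, dt (coneDens 0 Q ψ R) r x
      ≤ ∫ r in 0..s, 4 * (srcNorm H R r * gradNorm Q ψ R r) := by
    refine intervalIntegral.integral_mono_on hs
      ((continuous_integral (continuous_dt hP) _ _).intervalIntegrable _ _)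
      ((by fun_prop : Continuous _).intervalIntegrable _ _) fun r hr => ?_
    refine (integral_dt_coneDens_le le_rfl hQ hQ0 hψ hH hHc hR hr.1).trans ?_
    have c1 := continuous_slice (continuous_cone R) r
    have c2 := continuous_slice (contDiff_dt hψ).continuous r
    have c3 := continuous_slice (continuous_energyDens hQ.continuous hψ) r
    have h1 := integral_source_le (R := R) hHc (A := fun x => -4 * (cone R r x * dt ψ r x))
      (by fun_prop) c3 hR r fun x => ?_
    · refine le_trans (le_of_eq ?_) h1
      exact intervalIntegral.integral_congr fun x _ => by ring
    · have h2 : cone R r x ^ 2 ≤ 1 := pow_le_one₀ (cone_nonneg _ _ _) (cone_le_one _ _ _)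
      have h3 : dt ψ r x ^ 2 ≤ energyDens Q ψ r x := by
        have := mul_nonneg (hQ0 x) (sq_nonneg (ψ r x))
        rw [energyDens]
        nlinarith [sq_nonneg (dx ψ r x)]
      have h4 := energyDens_nonneg (ψ := ψ) hQ0 r x
      calc (-4 * (cone R r x * dt ψ r x)) ^ 2 = 16 * (cone R r x ^ 2 * dt ψ r x ^ 2) := by ring
        _ ≤ 16 * (1 * energyDens Q ψ r x) := by gcongr
        _ = 1 * (16 * energyDens Q ψ r x) := by ring
        _ ≤ weight r x ^ 2 * (16 * energyDens Q ψ r x) := by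
          gcongr
          exact one_le_weight_sq r x
  have e3 : coneEnergy 0 Q ψ R s - coneEnergy 0 Q ψ R 0
      = ∫ r in 0..s, ∫ x in -R..R, dt (coneDens 0 Q ψ R) r x := hsub
  linarith

/-- The conformal energy identity on a slice, with the source estimated by Cauchy-Schwarz. -/
theorem integral_dt_coneDens_one_le (hQ : ContDiff ℝ 1 Q) (hQ0 : ∀ x, 0 ≤ Q x)
    (hψ : ContDiff ℝ 2 (fun p : ℝ × ℝ => ψ p.1 p.2))
    (hH : ∀ s x, box ψ s x - Q x * ψ s x = H s x) (hR : 0 ≤ R) (hs : 0 ≤ s) :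
    ∫ x in -R..R, dt (coneDens 1 Q ψ R) s x
      ≤ (∫ x in -R..R, cone R s x * (4 * s * (x * deriv Q x + 2 * Q x) * ψ s x ^ 2))
        + 4 * (srcNorm H R s * confNorm Q ψ R s) := by
  have hHc := continuous_source hQ.continuous hψ hH
  refine (integral_dt_coneDens_le zero_le_one hQ hQ0 hψ hH hHc hR hs).trans ?_
  have c0 := continuous_slice hψ.continuous s
  have c1 := continuous_slice (continuous_cone R) s
  have c2 := continuous_slice (contDiff_dt hψ).continuous s
  have c3 := continuous_slice (contDiff_dx hψ).continuous s
  have c4 := continuous_slice (continuous_confDens hQ.continuous hψ) s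
  have c5 := hQ.continuous
  have c6 : Continuous (deriv Q) := hQ.continuous_deriv (by norm_num)
  have c7 := continuous_slice hHc s
  set A : ℝ → ℝ := fun x => -2 * (cone R s x * ((1 + (s + x) ^ 2) * (dt ψ s x + dx ψ s x)
          + (1 + (s - x) ^ 2) * (dt ψ s x - dx ψ s x))) with hA
  have cA : Continuous A := by rw [hA]; fun_prop
  have h1 := integral_source_le (R := R) hHc cA c4 hR s fun x => ?_
  · rw [intervalIntegral.integral_congr (g := fun x =>
      cone R s x * (4 * s * (x * deriv Q x + 2 * Q x) * ψ s x ^ 2) + H s x * A x)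
      (fun x _ => by simp only [hA]; ring),
      intervalIntegral.integral_add ((by fun_prop : Continuous _).intervalIntegrable _ _)
        ((by fun_prop : Continuous _).intervalIntegrable _ _)]
    have : confNorm Q ψ R s = √(∫ x in -R..R, confDens Q ψ s x) := rfl
    rw [this]
    linarith
  · obtain ⟨w1, w2⟩ := one_add_sq_le_weight_sq s x
    have h2 : cone R s x ^ 2 ≤ 1 := pow_le_one₀ (cone_nonneg _ _ _) (cone_le_one _ _ _)
    have hp : 0 ≤ 1 + (s + x) ^ 2 := by positivity
    have hq : 0 ≤ 1 + (s - x) ^ 2 := by positivity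
    have h3 : (1 + (s + x) ^ 2) * (dt ψ s x + dx ψ s x) ^ 2
        + (1 + (s - x) ^ 2) * (dt ψ s x - dx ψ s x) ^ 2 ≤ confDens Q ψ s x := by
      have : 0 ≤ (1 + (s + x) ^ 2 + (s - x) ^ 2) * Q x * ψ s x ^ 2 := by
        have := hQ0 x
        positivity
      rw [confDens, ubar, u, L, Lbar]
      linarith
    have h4 := confDens_nonneg (ψ := ψ) hQ0 s x
    calc A x ^ 2 = 4 * (cone R s x ^ 2 * ((1 + (s + x) ^ 2) * (dt ψ s x + dx ψ s x)
          + (1 + (s - x) ^ 2) * (dt ψ s x - dx ψ s x)) ^ 2) := by simp only [hA]; ring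
      _ ≤ 4 * (1 * (2 * ((1 + (s + x) ^ 2) * ((1 + (s + x) ^ 2) * (dt ψ s x + dx ψ s x) ^ 2)
          + (1 + (s - x) ^ 2) * ((1 + (s - x) ^ 2) * (dt ψ s x - dx ψ s x) ^ 2)))) := by
          have e := add_sq_le (a := (1 + (s + x) ^ 2) * (dt ψ s x + dx ψ s x))
            (b := (1 + (s - x) ^ 2) * (dt ψ s x - dx ψ s x))
          gcongr
          linarith
      _ ≤ 4 * (1 * (2 * (weight s x ^ 2 * ((1 + (s + x) ^ 2) * (dt ψ s x + dx ψ s x) ^ 2)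
          + weight s x ^ 2 * ((1 + (s - x) ^ 2) * (dt ψ s x - dx ψ s x) ^ 2)))) := by gcongr
      _ = 8 * (weight s x ^ 2 * ((1 + (s + x) ^ 2) * (dt ψ s x + dx ψ s x) ^ 2
        + (1 + (s - x) ^ 2) * (dt ψ s x - dx ψ s x) ^ 2)) := by ring
      _ ≤ 16 * (weight s x ^ 2 * confDens Q ψ s x) := by
          gcongr
          norm_num
      _ = weight s x ^ 2 * (16 * confDens Q ψ s x) := by ring

end

/-- The integrated estimate for the conformal energy, before absorption. The function `μ` stands
for any bound on quantities that are dominated by the standard energy and by the conformal energy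
divided by `1 + s²`. -/
theorem exists_coneEnergy_one_le (C c δ₀ : ℝ) (hC : 0 < C) (hc : 0 < c) (hδ₀ : 0 < δ₀) :
    ∃ K : ℝ, 0 < K ∧ ∀ (Q : ℝ → ℝ) (lam : ℝ) (ψ H : ℝ → ℝ → ℝ),
      RepulsiveBounds Q C c δ₀ lam → ContDiff ℝ 2 (fun p : ℝ × ℝ => ψ p.1 p.2) →
      (∀ s x, box ψ s x - Q x * ψ s x = H s x) → ∀ (R t : ℝ) (μ : ℝ → ℝ), 0 ≤ t → 2 * t + 3 ≤ R →
      Continuous μ → (∀ s ∈ Set.Icc 0 t, ∀ m, m ≤ coneEnergy 0 Q ψ R s →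
        (1 + s ^ 2) * m ≤ 2 * coneEnergy 1 Q ψ R s → m ≤ μ s) →
      coneEnergy 1 Q ψ R t ≤ coneEnergy 1 Q ψ R 0 + K * (1 + lam) * (t * localEnergy Q ψ t)
        + ∫ s in 0..t, (K * (1 + lam) * μ s + 4 * (srcNorm H R s * confNorm Q ψ R s)
          + K * (1 + lam) * (srcNorm H R s * gradNorm Q ψ R s)) := by
  set κ := 4 * C / δ₀ ^ 3 + 24 * δ₀ with hκ
  have hκ0 : 0 < κ := by positivity
  -- `ε` is small enough for the corner of the multiplier to be absorbed
  obtain ⟨ε, hε, hε1, hε2⟩ : ∃ ε, 0 < ε ∧ ε ≤ 1 ∧ ε * κ ≤ 1 / 12 := by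
    refine ⟨min 1 (1 / (12 * κ)), by positivity, min_le_left _ _, ?_⟩
    calc min 1 (1 / (12 * κ)) * κ ≤ 1 / (12 * κ) * κ := by gcongr; exact min_le_right _ _
      _ = 1 / 12 := by field_simp
  obtain ⟨K₁, hK₁, hmor⟩ := exists_morawetz_bound C δ₀ hC hδ₀ hε hε1 hε2
  set Λ := 4 * (4 * c + 8 * C * (8 * C / δ₀ ^ 2 + 48 * δ₀ ^ 2)) with hΛ
  have hΛ0 : 0 < Λ := by positivity
  refine ⟨4 * c + Λ * K₁, by positivity, fun Q lam ψ H hB hψ hH R t μ ht hR hμ hbd => ?_⟩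
  have hQ := hB.smooth
  have hQ0 := hB.nonneg
  have hl : 1 ≤ 1 + lam := by linarith [hB.lam_nonneg]
  have hl0 : 0 < 1 + lam := by linarith
  have hR0 : 0 ≤ R := by linarith
  have hHc := continuous_source hQ.continuous hψ hH
  have hφ := contDiff_cut hψ
  have hP := contDiff_coneDens 1 R hQ hψ
  have hrad {s : ℝ} (hs : s ∈ Set.Icc 0 t) : radius s ≤ R - s - 1 := by
    linarith [radius_le hs.1, hs.1, hs.2]
  have hsub := integral_sub_eq_integral_integral
    (fun s x => hasDerivAt_dt (hP.differentiable (by norm_num)) s x) hP.continuous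
    (continuous_dt hP) 0 t (-R) R
  have hsubM := integral_sub_eq_integral_integral (hasDerivAt_current hφ ε)
    (continuous_current hφ hε.le) (continuous_currentDeriv hφ hε.le) 0 t (-R) R
  have i1 : IntervalIntegrable (fun s => ∫ x in -R..R, dt (coneDens 1 Q ψ R) s x) volume 0 t :=
    (continuous_integral (continuous_dt hP) (-R) R).intervalIntegrable _ _
  have i2 : IntervalIntegrable (fun s => ∫ x in -R..R, currentDeriv ε (cut ψ) s x) volume 0 t :=
    (continuous_integral (continuous_currentDeriv hφ hε.le) (-R) R).intervalIntegrable _ _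
  have s1 := continuous_srcNorm hHc R
  have s2 := continuous_gradNorm hQ.continuous hψ R
  have s3 := continuous_confNorm hQ.continuous hψ R
  have hslice : ∫ s in 0..t, ((∫ x in -R..R, dt (coneDens 1 Q ψ R) s x)
        + Λ * (1 + lam) * ∫ x in -R..R, currentDeriv ε (cut ψ) s x)
      ≤ ∫ s in 0..t, ((4 * c + Λ * K₁) * (1 + lam) * μ s
        + 4 * (srcNorm H R s * confNorm Q ψ R s)
        + (4 * c + Λ * K₁) * (1 + lam) * (srcNorm H R s * gradNorm Q ψ R s)) := by
    refine intervalIntegral.integral_mono_on ht (i1.add (i2.const_mul _))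
      ((by fun_prop : Continuous _).intervalIntegrable _ _) fun s hs => ?_
    have hρ := hrad hs
    have hRρ : radius s ≤ R := by linarith [hs.1]
    obtain ⟨n1, n2, n3⟩ := localEnergy_bounds hQ hQ0 hψ hs.1 hρ
    obtain ⟨w1, w2⟩ := potential_bounds hQ hQ0 hψ hR0 s
    have hN := hbd s hs _ n1 n2
    have hW := hbd s hs _ w1 w2
    have hN0 := localEnergy_nonneg (ψ := ψ) hQ0 s
    have d1 := integral_dt_coneDens_one_le hQ hQ0 hψ hH hR0 hs.1
    have d2 := (hmor Q c lam ψ H hB hψ hH R s hs.1 hRρ).2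
    have d3 := hB.integral_conformal_error_le hε.le hε1
      (fun x => hasDerivAt_dx (hφ.differentiable (by norm_num)) s x)
      (continuous_slice (contDiff_dx hφ).continuous s) (continuous_slice hψ.continuous s)
      (continuous_slice (continuous_cone R) s) (cone_nonneg R s) (cone_le_one R s)
      (R := R) (by linarith) hs.1 fun x hx => by rw [cut, inCone_eq_one hx, one_mul]
    set I := ∫ x in -R..R, bulk ε Q (cut ψ s) (dx (cut ψ) s) x with hI
    set W := ∫ x in -R..R, cone R s x * (Q x * ψ s x ^ 2) with hWdef
    have hsrc : √(∫ x in -R..R, (s * H s x) ^ 2) ≤ srcNorm H R s := by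
      have cH := continuous_slice hHc s
      have cw := continuous_slice continuous_weight s
      refine Real.sqrt_le_sqrt (intervalIntegral.integral_mono_on (by linarith)
        ((by fun_prop : Continuous _).intervalIntegrable _ _)
        ((by fun_prop : Continuous _).intervalIntegrable _ _) fun x _ => ?_)
      rw [mul_pow, mul_pow]
      have := hs.1
      gcongr
      exact le_weight s x
    have hsg : √(localEnergy Q ψ s) ≤ gradNorm Q ψ R s :=
      Real.sqrt_le_iff.2 ⟨Real.sqrt_nonneg _, n3⟩
    have hab : √(∫ x in -R..R, (s * H s x) ^ 2) * √(localEnergy Q ψ s)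
        ≤ srcNorm H R s * gradNorm Q ψ R s :=
      mul_le_mul hsrc hsg (Real.sqrt_nonneg _) (Real.sqrt_nonneg _)
    have hab0 : 0 ≤ srcNorm H R s * gradNorm Q ψ R s :=
      mul_nonneg (Real.sqrt_nonneg _) (Real.sqrt_nonneg _)
    have d4 : Λ * (1 + lam) * (∫ x in -R..R, currentDeriv ε (cut ψ) s x)
        ≤ Λ * (1 + lam) * (K₁ * μ s + K₁ * (srcNorm H R s * gradNorm Q ψ R s) - s / 4 * I) := by
      refine mul_le_mul_of_nonneg_left (d2.trans ?_) (by positivity)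
      have := mul_le_mul_of_nonneg_left hN hK₁.le
      have := mul_le_mul_of_nonneg_left hab hK₁.le
      linarith
    have hμ0 : 0 ≤ μ s := hN0.trans hN
    have d5 : 4 * c * W ≤ 4 * c * (1 + lam) * μ s := by
      calc 4 * c * W ≤ 4 * c * μ s := by gcongr
        _ = 4 * c * 1 * μ s := by ring
        _ ≤ _ := by gcongr
    have d6 : 0 ≤ 4 * c * (1 + lam) * (srcNorm H R s * gradNorm Q ψ R s) := by positivity
    have d7 : s * (1 + lam) * (4 * c + 8 * C * (8 * C / δ₀ ^ 2 + 48 * δ₀ ^ 2)) * I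
        = Λ * (1 + lam) * (s / 4 * I) := by rw [hΛ]; ring
    rw [d7] at d3
    linarith
  rw [intervalIntegral.integral_add i1 (i2.const_mul _), intervalIntegral.integral_const_mul,
    ← hsub, ← hsubM] at hslice
  have hM0 : ∫ x in -R..R, current ε (cut ψ) 0 x = 0 := by simp [current]
  rw [hM0, sub_zero] at hslice
  have htt : t ∈ Set.Icc 0 t := ⟨ht, le_rfl⟩
  have hMt := (hmor Q c lam ψ H hB hψ hH R t ht (by linarith [hrad htt])).1
  have hMt' := mul_le_mul_of_nonneg_left (abs_le.1 hMt).1 (by positivity : 0 ≤ Λ * (1 + lam))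
  have hx : 0 ≤ 4 * c * (1 + lam) * (t * localEnergy Q ψ t) := by
    have := localEnergy_nonneg (ψ := ψ) hQ0 t
    positivity
  have e1 : coneEnergy 1 Q ψ R t = ∫ x in -R..R, coneDens 1 Q ψ R t x := rfl
  have e2 : coneEnergy 1 Q ψ R 0 = ∫ x in -R..R, coneDens 1 Q ψ R 0 x := rfl
  rw [e1, e2]
  linarith

/-! ### Absorption -/

theorem integral_inv_add_sq_le {N t : ℝ} (hN : 0 < N) (ht : 0 ≤ t) :
    ∫ s in 0..t, 1 / (N ^ 2 + (1 + s ^ 2)) ≤ 2 / N := by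
  have hc1 : Continuous fun s : ℝ => 1 / (N ^ 2 + (1 + s ^ 2)) := by
    have (s : ℝ) : N ^ 2 + (1 + s ^ 2) ≠ 0 := by positivity
    fun_prop (disch := exact this)
  have hc2 : Continuous fun s : ℝ => 1 / (N ^ 2 + s ^ 2) := by
    have (s : ℝ) : N ^ 2 + s ^ 2 ≠ 0 := by positivity
    fun_prop (disch := exact this)
  have hd (s : ℝ) : HasDerivAt (fun s => Real.arctan (s / N) / N) (1 / (N ^ 2 + s ^ 2)) s := by
    refine (((hasDerivAt_id' s).div_const N).arctan.div_const N).congr_deriv ?_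
    field_simp
  calc ∫ s in 0..t, 1 / (N ^ 2 + (1 + s ^ 2)) ≤ ∫ s in 0..t, 1 / (N ^ 2 + s ^ 2) := by
        refine intervalIntegral.integral_mono_on ht (hc1.intervalIntegrable _ _)
          (hc2.intervalIntegrable _ _) fun s _ => ?_
        apply one_div_le_one_div_of_le (by positivity)
        linarith
    _ = Real.arctan (t / N) / N - Real.arctan (0 / N) / N :=
        intervalIntegral.integral_eq_sub_of_hasDerivAt (fun s _ => hd s)
          (hc2.intervalIntegrable _ _)
    _ ≤ 2 / N := by
        rw [zero_div, Real.arctan_zero, zero_div, sub_zero]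
        gcongr
        linarith [Real.arctan_lt_pi_div_two (t / N), Real.pi_le_four]

section

variable {Q : ℝ → ℝ} {ψ : ℝ → ℝ → ℝ}

theorem coneEnergy_zero_le_one (hQ : ContDiff ℝ 1 Q) (hQ0 : ∀ x, 0 ≤ Q x)
    (hψ : ContDiff ℝ 2 (fun p : ℝ × ℝ => ψ p.1 p.2)) {R : ℝ} (hR : 0 ≤ R) (s : ℝ) :
    coneEnergy 0 Q ψ R s ≤ coneEnergy 1 Q ψ R s := by
  have c0 := continuous_slice (contDiff_coneDens 0 R hQ hψ).continuous s
  have c1 := continuous_slice (contDiff_coneDens 1 R hQ hψ).continuous s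
  refine intervalIntegral.integral_mono_on (by linarith) (c0.intervalIntegrable _ _)
    (c1.intervalIntegrable _ _) fun x _ => ?_
  rw [coneDens_zero, coneDens_one]
  refine mul_le_mul_of_nonneg_left ?_ (cone_nonneg R s x)
  have h1 := mul_nonneg (sq_nonneg (s + x)) (sq_nonneg (dt ψ s x + dx ψ s x))
  have h2 := mul_nonneg (sq_nonneg (s - x)) (sq_nonneg (dt ψ s x - dx ψ s x))
  have h3 := mul_nonneg (add_nonneg (sq_nonneg (s + x)) (sq_nonneg (s - x)))
    (mul_nonneg (hQ0 x) (sq_nonneg (ψ s x)))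
  rw [energyDens, confDens, ubar, u, L, Lbar]
  linarith

theorem coneEnergy_nonneg {κ : ℝ} (hκ : 0 ≤ κ) (hQ0 : ∀ x, 0 ≤ Q x) {R : ℝ} (hR : 0 ≤ R) (s : ℝ) :
    0 ≤ coneEnergy κ Q ψ R s :=
  intervalIntegral.integral_nonneg (by linarith) fun x _ => coneDens_nonneg hκ hQ0 R s x

end

/-- The conformal energy estimate in a truncated cone. -/
theorem exists_coneEnergy_bound (C c δ₀ : ℝ) (hC : 0 < C) (hc : 0 < c) (hδ₀ : 0 < δ₀) :
    ∃ K : ℝ, 0 < K ∧ ∀ (Q : ℝ → ℝ) (lam : ℝ) (ψ H : ℝ → ℝ → ℝ),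
      RepulsiveBounds Q C c δ₀ lam → ContDiff ℝ 2 (fun p : ℝ × ℝ => ψ p.1 p.2) →
      (∀ s x, box ψ s x - Q x * ψ s x = H s x) → ∀ R t : ℝ, 0 ≤ t → 2 * t + 3 ≤ R →
      coneEnergy 1 Q ψ R t ≤ K * ((1 + lam ^ 2) * coneEnergy 1 Q ψ R 0
        + (1 + lam) ^ 2 * (∫ s in 0..t, srcNorm H R s * gradNorm Q ψ R s)
        + ∫ s in 0..t, srcNorm H R s * confNorm Q ψ R s) := by
  obtain ⟨K, hK, hmain⟩ := exists_coneEnergy_one_le C c δ₀ hC hc hδ₀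
  refine ⟨10 + 2 * K + 500 * K ^ 2, by positivity,
    fun Q lam ψ H hB hψ hH R t ht hR => ?_⟩
  have hQ := hB.smooth
  have hQ0 := hB.nonneg
  have hlam := hB.lam_nonneg
  have hl : 1 ≤ 1 + lam := by linarith
  have hR0 : 0 ≤ R := by linarith
  have hHc := continuous_source hQ.continuous hψ hH
  have s1 := continuous_srcNorm hHc R
  have s2 := continuous_gradNorm hQ.continuous hψ R
  have s3 := continuous_confNorm hQ.continuous hψ R
  have ab0 (s : ℝ) : 0 ≤ srcNorm H R s * gradNorm Q ψ R s :=
    mul_nonneg (Real.sqrt_nonneg _) (Real.sqrt_nonneg _)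
  have ac0 (s : ℝ) : 0 ≤ srcNorm H R s * confNorm Q ψ R s :=
    mul_nonneg (Real.sqrt_nonneg _) (Real.sqrt_nonneg _)
  set A := ∫ s in 0..t, srcNorm H R s * gradNorm Q ψ R s with hA
  set B := ∫ s in 0..t, srcNorm H R s * confNorm Q ψ R s with hBdef
  have hA0 : 0 ≤ A := intervalIntegral.integral_nonneg ht fun s _ => ab0 s
  have hAle {r : ℝ} (hr : r ∈ Set.Icc 0 t) : ∫ s in 0..r, srcNorm H R s * gradNorm Q ψ R s ≤ A :=
    integral_le_integral_of_subset (s1.mul s2) ab0 le_rfl hr.1 hr.2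
  have hBle {r : ℝ} (hr : r ∈ Set.Icc 0 t) : ∫ s in 0..r, srcNorm H R s * confNorm Q ψ R s ≤ B :=
    integral_le_integral_of_subset (s1.mul s3) ac0 le_rfl hr.1 hr.2
  obtain ⟨τ, hτ, hmax⟩ := isCompact_Icc.exists_isMaxOn (Set.nonempty_Icc.2 ht)
    (continuous_coneEnergy 1 R hQ hψ).continuousOn
  set S := coneEnergy 1 Q ψ R τ with hS
  set F₀ := coneEnergy 1 Q ψ R 0 with hF₀
  set S₀ := coneEnergy 0 Q ψ R 0 + 4 * A with hS₀
  have hS0 : 0 ≤ S := coneEnergy_nonneg zero_le_one hQ0 hR0 τ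
  have hF0 : 0 ≤ F₀ := coneEnergy_nonneg zero_le_one hQ0 hR0 0
  have he0 : 0 ≤ coneEnergy 0 Q ψ R 0 := coneEnergy_nonneg le_rfl hQ0 hR0 0
  have he0F : coneEnergy 0 Q ψ R 0 ≤ F₀ := coneEnergy_zero_le_one hQ hQ0 hψ hR0 0
  have hS₀0 : 0 ≤ S₀ := by positivity
  have hle0 {s : ℝ} (hs : s ∈ Set.Icc 0 t) : coneEnergy 0 Q ψ R s ≤ S₀ := by
    have h1 := coneEnergy_zero_le hQ hQ0 hψ hH hR0 hs.1
    rw [intervalIntegral.integral_const_mul] at h1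
    linarith [hAle hs]
  -- `min (S₀, 2 S / (1 + s²)) ≤ μ s` with integral of size `N S₀ + S / N`; `N` of size `1 + lam`
  -- makes the second term absorbable and the first one of size `(1 + lam)² S₀`
  set N := 16 * K * (1 + lam) with hN
  have hN0 : 0 < N := by positivity
  set μ : ℝ → ℝ := fun s => (N ^ 2 * S₀ + 2 * S) * (1 / (N ^ 2 + (1 + s ^ 2))) with hμ
  have cμ : Continuous μ := by
    have (s : ℝ) : N ^ 2 + (1 + s ^ 2) ≠ 0 := by positivity
    rw [hμ]
    fun_prop (disch := exact this)
  have hbd : ∀ s ∈ Set.Icc 0 τ, ∀ m, m ≤ coneEnergy 0 Q ψ R s →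
      (1 + s ^ 2) * m ≤ 2 * coneEnergy 1 Q ψ R s → m ≤ μ s := by
    intro s hs m h1 h2
    have hst : s ∈ Set.Icc 0 t := ⟨hs.1, hs.2.trans hτ.2⟩
    have h3 : m ≤ S₀ := h1.trans (hle0 hst)
    have h4 : (1 + s ^ 2) * m ≤ 2 * S := h2.trans (by linarith [isMaxOn_iff.1 hmax s hst])
    simp only [hμ]
    rw [mul_one_div, le_div_iff₀ (by positivity)]
    have := mul_le_mul_of_nonneg_left h3 (sq_nonneg N)
    linarith
  have hest := hmain Q lam ψ H hB hψ hH R τ μ hτ.1 (by linarith [hτ.2]) cμ hbd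
  have hint (μ : ℝ → ℝ) (cμ : Continuous μ) :
      ∫ s in 0..τ, (K * (1 + lam) * μ s + 4 * (srcNorm H R s * confNorm Q ψ R s)
      + K * (1 + lam) * (srcNorm H R s * gradNorm Q ψ R s))
      = K * (1 + lam) * (∫ s in 0..τ, μ s) + 4 * (∫ s in 0..τ, srcNorm H R s * confNorm Q ψ R s)
      + K * (1 + lam) * ∫ s in 0..τ, srcNorm H R s * gradNorm Q ψ R s := by
    rw [intervalIntegral.integral_add ((by fun_prop : Continuous _).intervalIntegrable _ _)
      ((by fun_prop : Continuous _).intervalIntegrable _ _),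
      intervalIntegral.integral_add ((by fun_prop : Continuous _).intervalIntegrable _ _)
      ((by fun_prop : Continuous _).intervalIntegrable _ _),
      intervalIntegral.integral_const_mul, intervalIntegral.integral_const_mul,
      intervalIntegral.integral_const_mul]
  rw [hint μ cμ] at hest
  have hμint : ∫ s in 0..τ, μ s ≤ (N ^ 2 * S₀ + 2 * S) * (2 / N) := by
    simp only [hμ]
    rw [intervalIntegral.integral_const_mul]
    gcongr
    exact integral_inv_add_sq_le hN0 hτ.1
  have h1 : K * (1 + lam) * (∫ s in 0..τ, μ s) ≤ 32 * K ^ 2 * ((1 + lam) ^ 2 * S₀) + S / 4 := by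
    calc K * (1 + lam) * (∫ s in 0..τ, μ s)
        ≤ K * (1 + lam) * ((N ^ 2 * S₀ + 2 * S) * (2 / N)) := by gcongr
      _ = 32 * K ^ 2 * ((1 + lam) ^ 2 * S₀) + S / 4 := by
          rw [hN]
          field_simp
          ring
  -- the boundary term at time `τ`, by the arithmetic-geometric mean inequality
  have h2 : K * (1 + lam) * (τ * localEnergy Q ψ τ)
      ≤ 2 * K ^ 2 * ((1 + lam) ^ 2 * S₀) + S / 4 := by
    obtain ⟨n1, n2, -⟩ := localEnergy_bounds (R := R) hQ hQ0 hψ hτ.1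
      (by linarith [radius_le hτ.1, hτ.1, hτ.2])
    have n0 := localEnergy_nonneg (ψ := ψ) hQ0 τ
    have n3 := n1.trans (hle0 hτ)
    obtain ⟨n, hn⟩ : ∃ n, n = localEnergy Q ψ τ := ⟨_, rfl⟩
    rw [← hn] at n0 n2 n3 ⊢
    have e1 : K * (1 + lam) * τ ≤ 2 * (K * (1 + lam)) ^ 2 + τ ^ 2 / 8 := by
      linarith [sq_nonneg (4 * (K * (1 + lam)) - τ)]
    have e2 := mul_le_mul_of_nonneg_right e1 n0
    have e3 : (K * (1 + lam)) ^ 2 * n ≤ (K * (1 + lam)) ^ 2 * S₀ := by gcongr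
    linarith
  have h3 : K * (1 + lam) * (∫ s in 0..τ, srcNorm H R s * gradNorm Q ψ R s)
      ≤ K * ((1 + lam) ^ 2 * A) := by
    calc _ ≤ K * (1 + lam) * A := by
          gcongr
          exact hAle hτ
      _ ≤ K * (1 + lam) ^ 2 * A := by
          gcongr
          exact le_self_pow₀ hl two_ne_zero
      _ = _ := by ring
  have h4 := hBle hτ
  have h5 : (1 + lam) ^ 2 * S₀ ≤ 2 * ((1 + lam ^ 2) * F₀) + 4 * ((1 + lam) ^ 2 * A) := by
    have e1 : (1 + lam) ^ 2 ≤ 2 * (1 + lam ^ 2) := by linarith [sq_nonneg (1 - lam)]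
    have e2 : (1 + lam) ^ 2 * coneEnergy 0 Q ψ R 0 ≤ 2 * (1 + lam ^ 2) * F₀ := by gcongr
    rw [hS₀]
    linarith
  have h6 : coneEnergy 1 Q ψ R t ≤ S := isMaxOn_iff.1 hmax t ⟨ht, le_rfl⟩
  have h7 : F₀ ≤ (1 + lam ^ 2) * F₀ := by
    linarith [mul_nonneg (sq_nonneg lam) hF0]
  have h8 : 0 ≤ (1 + lam) ^ 2 * A := by positivity
  have hB0 : 0 ≤ B := intervalIntegral.integral_nonneg ht fun s _ => ac0 s
  have h9 := mul_le_mul_of_nonneg_left h5 (sq_nonneg K)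
  have h10 := mul_nonneg hK.le hB0
  have h11 := mul_nonneg (sq_nonneg K) hB0
  have h12 := mul_nonneg hK.le (hF0.trans h7)
  have h13 := mul_nonneg (sq_nonneg K) (hF0.trans h7)
  have h14 := mul_nonneg hK.le h8
  have h15 := mul_nonneg (sq_nonneg K) h8
  linarith

/-! ### Passage to extended nonnegative integrals -/

theorem ofReal_integral_eq_setLIntegral {f : ℝ → ℝ} (hf : Continuous f) (h0 : ∀ x, 0 ≤ f x)
    {a b : ℝ} (hab : a ≤ b) :
    ENNReal.ofReal (∫ x in a..b, f x) = ∫⁻ x in Set.Icc a b, ENNReal.ofReal (f x) := by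
  rw [intervalIntegral.integral_of_le hab, ← integral_Icc_eq_integral_Ioc]
  exact ofReal_integral_eq_lintegral_ofReal
    (hf.continuousOn.integrableOn_compact isCompact_Icc) (Filter.Eventually.of_forall h0)

theorem ofReal_sqrt_integral_le_eLpNorm {f : ℝ → ℝ} (hf : Continuous f) {a b : ℝ} (hab : a ≤ b) :
    ENNReal.ofReal √(∫ x in a..b, f x ^ 2) ≤ eLpNorm f 2 volume := by
  rw [eLpNorm_eq_lintegral_rpow_enorm_toReal two_ne_zero ENNReal.ofNat_ne_top, Real.sqrt_eq_rpow,
    ← ENNReal.ofReal_rpow_of_nonneg (intervalIntegral.integral_nonneg hab fun x _ => sq_nonneg _)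
      (by norm_num), ofReal_integral_eq_setLIntegral (f := fun x => f x ^ 2) (hf.pow 2)
      (fun x => sq_nonneg _) hab]
  simp only [ENNReal.toReal_ofNat]
  refine ENNReal.rpow_le_rpow ((setLIntegral_le_lintegral _ _).trans
    (lintegral_mono fun x => le_of_eq ?_)) (by norm_num)
  rw [Real.enorm_eq_ofReal_abs, ENNReal.ofReal_rpow_of_nonneg (abs_nonneg _) (by norm_num)]
  norm_num

end Morawetz

open Morawetz in
theorem theorem2 (C : ℝ) (hC : 0 < C) (ℓ₁ ℓ₂ : ℝ) :
    ∃ K : ℝ≥0, ∀ (lam a₁ b₁ a₂ b₂ : ℝ) (Q : ℝ → ℝ) (ψ H : ℝ → ℝ → ℝ),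
      0 ≤ lam →
      a₁ ≤ 0 → 0 ≤ b₁ → b₁ - a₁ = ℓ₁ →
      a₂ ≤ 0 → 0 ≤ b₂ → b₂ - a₂ = ℓ₂ →
      ContDiff ℝ (⊤ : ℕ∞) Q →
      Morawetz.StronglyRepulsive Q C lam (Set.Icc a₁ b₁) (Set.Icc a₂ b₂) →
      ContDiff ℝ 2 (fun p : ℝ × ℝ => ψ p.1 p.2) →
      (∀ t, HasCompactSupport (ψ t)) →
      (∀ t x, Morawetz.box ψ t x - Q x * ψ t x = H t x) →
      ∀ t : ℝ, 0 ≤ t →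
        Morawetz.conformalEnergy Q ψ t ≤
          (K : ℝ≥0∞) *
            (ENNReal.ofReal (1 + lam ^ 2) * Morawetz.conformalEnergy Q ψ 0
              + (∫⁻ s in Set.Icc 0 t,
                  eLpNorm (fun x => (1 + |Morawetz.ubar s x| + |Morawetz.u s x|)
                    * (1 + lam) * H s x) 2 volume
                  * eLpNorm (fun x => (1 + lam)
                    * (√(Morawetz.dt ψ s x ^ 2 + Morawetz.dx ψ s x ^ 2)
                      + √(Q x) * |ψ s x|)) 2 volume)
              + ∫⁻ s in Set.Icc 0 t,
                  eLpNorm (fun x => (1 + |Morawetz.ubar s x| + |Morawetz.u s x|)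
                    * H s x) 2 volume
                  * Morawetz.conformalEnergy Q ψ s ^ (1 / 2 : ℝ)) := by
  rcases le_or_gt ℓ₁ 0 with hℓ | hℓ
  · refine ⟨0, fun lam a₁ b₁ a₂ b₂ Q ψ H _ ha₁ hb₁ h₁ _ _ _ hQ hrep => ?_⟩
    have := hrep.length_pos hC ha₁ hb₁ (hQ.of_le (by exact_mod_cast le_top))
    linarith
  set δ₀ := min (1 / 8) (ℓ₁ / 2) with hδ₀
  have hδ : 0 < δ₀ := by positivity
  set c := 4 * C + 8 * |ℓ₂| + 2 * C / δ₀ + 2 * C ^ 2 / δ₀ ^ 2 * (1 + ℓ₁) with hc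
  have e1 : 0 < 2 * C / δ₀ := by positivity
  have e2 : 0 < 2 * C ^ 2 / δ₀ ^ 2 * (1 + ℓ₁) := by positivity
  have e3 : ℓ₂ ≤ |ℓ₂| := le_abs_self _
  have e4 : 0 ≤ |ℓ₂| := abs_nonneg _
  obtain ⟨K, hK, hmain⟩ := exists_coneEnergy_bound C c δ₀ hC (by positivity) hδ
  refine ⟨(2 * K).toNNReal, fun lam a₁ b₁ a₂ b₂ Q ψ H hlam ha₁ hb₁ h₁ ha₂ hb₂ h₂ hQs hrep
    hψ _ hH t ht => ?_⟩
  have hQ : ContDiff ℝ 1 Q := hQs.of_le (by exact_mod_cast le_top)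
  have hB : RepulsiveBounds Q C c δ₀ lam :=
    hrep.repulsiveBounds hC hlam ha₁ hb₁ ha₂ hb₂ hQ hδ (min_le_left _ _)
      (by linarith [min_le_right (1 / 8) (ℓ₁ / 2)]) (by rw [h₂]; linarith) (by linarith)
      (by rw [h₁]; linarith)
  have hQ0 := hB.nonneg
  have hl : 0 < 1 + lam := by linarith
  have hHc := continuous_source hQ.continuous hψ hH
  have hcont (s : ℝ) := continuous_slice (continuous_confDens hQ.continuous hψ) s
  have hconf0 (s x : ℝ) := confDens_nonneg (ψ := ψ) hQ0 s x
  change conformalEnergy Q ψ t ≤ ENNReal.ofReal (2 * K) * _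
  -- exhaust the slice by the bases of truncated cones
  have hcov := (aecover_Icc (μ := (volume : Measure ℝ)) (l := Filter.atTop)
    (a := fun r : ℝ => -r) (b := fun r : ℝ => r) Filter.tendsto_neg_atTop_atBot
    Filter.tendsto_id).lintegral_tendsto_of_countably_generated
    (f := fun x => ENNReal.ofReal (confDens Q ψ t x)) (by fun_prop)
  refine le_of_tendsto hcov ?_
  filter_upwards [Filter.eventually_ge_atTop (t + 2)] with r hr
  obtain ⟨R, hRr⟩ : ∃ R, r = R - t - 1 := ⟨r + t + 1, by ring⟩
  have hR : 2 * t + 3 ≤ R := by linarith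
  have hR0 : 0 ≤ R := by linarith
  have hfin := hmain Q lam ψ H hB hψ hH R t ht hR
  have hleft : ∫ x in -r..r, confDens Q ψ t x ≤ coneEnergy 1 Q ψ R t := by
    have c1 := continuous_slice (contDiff_coneDens 1 R hQ hψ).continuous t
    refine (intervalIntegral.integral_mono_on (g := coneDens 1 Q ψ R t) (by linarith)
      ((hcont t).intervalIntegrable _ _) (c1.intervalIntegrable _ _) fun x hx => ?_).trans
      (integral_le_integral_of_subset c1 (fun x => coneDens_nonneg zero_le_one hQ0 R t x)
        (by linarith) (by linarith) (by linarith))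
    rw [coneDens_one, cone_eq_one (by rw [← hRr]; exact abs_le.2 hx)]
    linarith [mul_nonneg (hQ0 x) (sq_nonneg (ψ t x))]
  rw [← ofReal_integral_eq_setLIntegral (hcont t) (hconf0 t) (by linarith)]
  have s1 := continuous_srcNorm hHc R
  have s2 := continuous_gradNorm hQ.continuous hψ R
  have s3 := continuous_confNorm hQ.continuous hψ R
  have hsrc (s : ℝ) : Continuous fun x => weight s x * H s x :=
    (continuous_slice continuous_weight s).mul (continuous_slice hHc s)
  have hF₀ : ENNReal.ofReal (coneEnergy 1 Q ψ R 0) ≤ 2 * conformalEnergy Q ψ 0 := by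
    have h1 : coneEnergy 1 Q ψ R 0 ≤ 2 * ∫ x in -R..R, confDens Q ψ 0 x := by
      rw [← intervalIntegral.integral_const_mul]
      have c1 := continuous_slice (contDiff_coneDens 1 R hQ hψ).continuous 0
      refine intervalIntegral.integral_mono_on (by linarith) (c1.intervalIntegrable _ _)
        (((hcont 0).const_mul 2).intervalIntegrable _ _) fun x _ => ?_
      have h2 : Q x * ψ 0 x ^ 2 ≤ confDens Q ψ 0 x := by
        have e1 := mul_nonneg (by positivity : 0 ≤ 1 + ubar 0 x ^ 2) (sq_nonneg (L ψ 0 x))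
        have e2 := mul_nonneg (by positivity : 0 ≤ 1 + u 0 x ^ 2) (sq_nonneg (Lbar ψ 0 x))
        have e3 := mul_nonneg (add_nonneg (sq_nonneg (ubar 0 x)) (sq_nonneg (u 0 x)))
          (mul_nonneg (hQ0 x) (sq_nonneg (ψ 0 x)))
        rw [confDens]
        linarith
      have h3 := mul_nonneg (hQ0 x) (sq_nonneg (ψ 0 x))
      rw [coneDens_one]
      calc cone R 0 x * (confDens Q ψ 0 x + Q x * ψ 0 x ^ 2)
          ≤ 1 * (confDens Q ψ 0 x + Q x * ψ 0 x ^ 2) := by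
            gcongr
            · linarith
            · exact cone_le_one R 0 x
        _ ≤ 2 * confDens Q ψ 0 x := by linarith
    calc ENNReal.ofReal (coneEnergy 1 Q ψ R 0)
        ≤ ENNReal.ofReal (2 * ∫ x in -R..R, confDens Q ψ 0 x) := ENNReal.ofReal_le_ofReal h1
      _ = 2 * ∫⁻ x in Set.Icc (-R) R, ENNReal.ofReal (confDens Q ψ 0 x) := by
          rw [ENNReal.ofReal_mul zero_le_two,
            ofReal_integral_eq_setLIntegral (hcont 0) (hconf0 0) (by linarith), ENNReal.ofReal_ofNat]
      _ ≤ 2 * conformalEnergy Q ψ 0 := by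
          gcongr
          exact setLIntegral_le_lintegral _ _
  have hsrc0 (s : ℝ) : 0 ≤ srcNorm H R s := Real.sqrt_nonneg _
  have hab : ENNReal.ofReal ((1 + lam) ^ 2 * ∫ s in 0..t, srcNorm H R s * gradNorm Q ψ R s)
      ≤ ∫⁻ s in Set.Icc 0 t, eLpNorm (fun x => (1 + |ubar s x| + |u s x|) * (1 + lam) * H s x) 2
          volume * eLpNorm (fun x => (1 + lam) * (√(dt ψ s x ^ 2 + dx ψ s x ^ 2)
            + √(Q x) * |ψ s x|)) 2 volume := by
    rw [← intervalIntegral.integral_const_mul, ofReal_integral_eq_setLIntegral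
      (f := fun s => (1 + lam) ^ 2 * (srcNorm H R s * gradNorm Q ψ R s)) (by fun_prop)
      (fun s => mul_nonneg (sq_nonneg _) (mul_nonneg (Real.sqrt_nonneg _) (Real.sqrt_nonneg _))) ht]
    refine lintegral_mono fun s => ?_
    have h1 : ENNReal.ofReal ((1 + lam) * srcNorm H R s)
        ≤ eLpNorm (fun x => (1 + |ubar s x| + |u s x|) * (1 + lam) * H s x) 2 volume := by
      have h2 : (1 + lam) * srcNorm H R s
          = √(∫ x in -R..R, ((1 + |ubar s x| + |u s x|) * (1 + lam) * H s x) ^ 2) := by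
        rw [srcNorm, ← Real.sqrt_sq hl.le, ← Real.sqrt_mul (sq_nonneg _), Real.sqrt_sq hl.le,
          ← intervalIntegral.integral_const_mul]
        congr 1
        refine intervalIntegral.integral_congr fun x _ => ?_
        simp only [weight]
        ring
      rw [h2]
      refine ofReal_sqrt_integral_le_eLpNorm ?_ (by linarith)
      have := (hsrc s).const_mul (1 + lam)
      refine this.congr fun x => ?_
      rw [weight]
      ring
    have h3 : ENNReal.ofReal ((1 + lam) * gradNorm Q ψ R s)
        ≤ eLpNorm (fun x => (1 + lam) * (√(dt ψ s x ^ 2 + dx ψ s x ^ 2)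
            + √(Q x) * |ψ s x|)) 2 volume := by
      have c1 := continuous_slice (contDiff_dt hψ).continuous s
      have c2 := continuous_slice (contDiff_dx hψ).continuous s
      have c3 := continuous_slice hψ.continuous s
      have c4 := hQ.continuous
      have c5 := continuous_slice (continuous_energyDens hQ.continuous hψ) s
      have h2 : (1 + lam) * gradNorm Q ψ R s ≤ √(∫ x in -R..R, ((1 + lam)
          * (√(dt ψ s x ^ 2 + dx ψ s x ^ 2) + √(Q x) * |ψ s x|)) ^ 2) := by
        rw [gradNorm, ← Real.sqrt_sq hl.le, ← Real.sqrt_mul (sq_nonneg _), Real.sqrt_sq hl.le,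
          ← intervalIntegral.integral_const_mul]
        refine Real.sqrt_le_sqrt (intervalIntegral.integral_mono_on (by linarith)
          ((c5.const_mul _).intervalIntegrable _ _)
          ((by fun_prop : Continuous _).intervalIntegrable _ _) fun x _ => ?_)
        rw [mul_pow]
        gcongr
        have e1 := Real.sq_sqrt (by positivity : 0 ≤ dt ψ s x ^ 2 + dx ψ s x ^ 2)
        have e2 := Real.sq_sqrt (hQ0 x)
        have e3 : 0 ≤ √(dt ψ s x ^ 2 + dx ψ s x ^ 2) * (√(Q x) * |ψ s x|) := by positivity
        calc energyDens Q ψ s x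
            = √(dt ψ s x ^ 2 + dx ψ s x ^ 2) ^ 2 + √(Q x) ^ 2 * |ψ s x| ^ 2 := by
              rw [e1, e2, sq_abs, energyDens]
          _ ≤ (√(dt ψ s x ^ 2 + dx ψ s x ^ 2) + √(Q x) * |ψ s x|) ^ 2 := by linarith
      exact (ENNReal.ofReal_le_ofReal h2).trans
        (ofReal_sqrt_integral_le_eLpNorm (by fun_prop) (by linarith))
    calc ENNReal.ofReal ((1 + lam) ^ 2 * (srcNorm H R s * gradNorm Q ψ R s))
        = ENNReal.ofReal ((1 + lam) * srcNorm H R s)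
          * ENNReal.ofReal ((1 + lam) * gradNorm Q ψ R s) := by
          rw [← ENNReal.ofReal_mul (mul_nonneg hl.le (hsrc0 s))]
          congr 1
          ring
      _ ≤ _ := mul_le_mul' h1 h3
  have hac : ENNReal.ofReal (∫ s in 0..t, srcNorm H R s * confNorm Q ψ R s)
      ≤ ∫⁻ s in Set.Icc 0 t, eLpNorm (fun x => (1 + |ubar s x| + |u s x|) * H s x) 2 volume
          * conformalEnergy Q ψ s ^ (1 / 2 : ℝ) := by
    rw [ofReal_integral_eq_setLIntegral (f := fun s => srcNorm H R s * confNorm Q ψ R s)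
      (by fun_prop) (fun s => mul_nonneg (Real.sqrt_nonneg _) (Real.sqrt_nonneg _)) ht]
    refine lintegral_mono fun s => ?_
    rw [ENNReal.ofReal_mul (hsrc0 s)]
    refine mul_le_mul' (ofReal_sqrt_integral_le_eLpNorm (hsrc s) (by linarith)) ?_
    rw [confNorm, Real.sqrt_eq_rpow, ← ENNReal.ofReal_rpow_of_nonneg
      (intervalIntegral.integral_nonneg (by linarith) fun x _ => hconf0 s x) (by norm_num),
      ofReal_integral_eq_setLIntegral (hcont s) (hconf0 s) (by linarith)]
    gcongr
    exact setLIntegral_le_lintegral _ _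
  have hA0 : 0 ≤ (1 + lam) ^ 2 * ∫ s in 0..t, srcNorm H R s * gradNorm Q ψ R s :=
    mul_nonneg (sq_nonneg _) (intervalIntegral.integral_nonneg ht fun s _ =>
      mul_nonneg (Real.sqrt_nonneg _) (Real.sqrt_nonneg _))
  have hB0 : 0 ≤ ∫ s in 0..t, srcNorm H R s * confNorm Q ψ R s :=
    intervalIntegral.integral_nonneg ht fun s _ =>
      mul_nonneg (Real.sqrt_nonneg _) (Real.sqrt_nonneg _)
  have hF0 := coneEnergy_nonneg (ψ := ψ) zero_le_one hQ0 hR0 0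
  have hl2 : 0 ≤ 1 + lam ^ 2 := by positivity
  refine (ENNReal.ofReal_le_ofReal (hleft.trans hfin)).trans ?_
  rw [ENNReal.ofReal_mul hK.le, ENNReal.ofReal_add (by positivity) hB0,
    ENNReal.ofReal_add (by positivity) hA0, ENNReal.ofReal_mul hl2, mul_comm (2 : ℝ) K,
    ENNReal.ofReal_mul hK.le, ENNReal.ofReal_ofNat, mul_assoc]
  gcongr
  rw [mul_add, mul_add]
  refine add_le_add (add_le_add ?_ ?_) ?_
  · calc _ ≤ ENNReal.ofReal (1 + lam ^ 2) * (2 * conformalEnergy Q ψ 0) := by gcongr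
      _ = _ := by ring
  · exact hab.trans (le_mul_of_one_le_left' one_le_two)
  · exact hac.trans (le_mul_of_one_le_left' one_le_two)
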